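/- Let $\mathbb{R}^{3,4}$ be $\mathbb{R}^7$ with a bilinear form $q$ of signature $(3,4)$, realized as the imaginary split octonions, and let $\times$ be its cross product, $x\times y=\mathrm{Im}(xy)$. Let $G_2'=\mathrm{Aut}(\mathbb{R}^{3,4},\times)=\{g\in \mathrm{GL}(7,\mathbb{R}) : g(x\times y)=g(x)\times g(y)\}$ be the split real group of type $G_2$. Its flag manifolds are \[ \mathrm{Ein}^{2,3}=\{\ell \text{ an isotropic line}\},\quad \mathrm{Pho}^\times=\{\omega \text{ a totally isotropic } 2\text{-plane with } \omega\times\omega=0\},\quad \mathcal{F}_{1,2}^\times=\{(\ell,\omega)\in \mathrm{Ein}^{2,3}\times\mathrm{Pho}^\times : \ell\subset\omega\}. \] Elements of $\mathrm{Pho}^\times$ are called annihilator photons, and elements of $\mathcal{F}_{1,2}^\times$ pointed annihilator photons. For a subspace $W$ put $\mathrm{Ein}(W)=\{\ell\in\mathrm{Ein}^{2,3}:\ell\subset W\}$ and $\mathrm{Pho}^\times(W)=\{\omega\in\mathrm{Pho}^\times:\omega\subset W\}$. Two points of a flag manifold $\mathcal{F}$ of $G_2'$ are transverse if they lie in the open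 $G_2'$-orbit of $\mathcal{F}\times\mathcal{F}$; a subset of $\mathcal{F}$ is transverse if any two of its distinct points are transverse, and maximally transverse if moreover it is not properly contained in another transverse subset of $\mathcal{F}$. Let $P$ be a point of the symmetric space of $G_2'$, that is, a $3$-plane $P\subset\mathbb{R}^{3,4}$ on which $q$ is positive definite and with $P\times P=P$. Let $P^\perp$ be its $q$-orthogonal complement, $\pi_P:\mathbb{R}^{3,4}\to P$ the $q$-orthogonal projection, and $H_P=\{\varphi\in G_2' : \varphi(x)=x \text{ for all } x\in P\}$. Then $H_P$ is isomorphic, as a Lie group, to $\mathrm{Sp}(1)$, and the following hold. (a) $\ell\mapsto\pi_P(\ell)$ defines a principal $H_P$-bundle $\mathrm{Ein}^{2,3}\to\mathrm{Gr}_1(P)$. The fiber over $U^1$ is $\mathrm{Ein}(U^1\oplus P^\perp)$; here $U^1\oplus P^\perp$ is isometric to $\mathbb{R}^{1,4}$, and such an isometry identifies the fiber with $\mathrm{Ein}^{0,3}$, the space of isotropic lines of $\mathbb{R}^{1,4}$. (b) $\omega\mapsto\pi_P(\omega)$ defines a principal $H_P$-bundle $\mathrm{Pho}^\times\to\mathrm{Gr}_2(P)$.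 The fiber over $U^2$ is $\mathrm{Pho}^\times(U^2\oplus P^\perp)$; here $U^2\oplus P^\perp$ has signature $(2,4)$, and for every subspace $W\subset\mathbb{R}^{3,4}$ of signature $(2,4)$ some element of $G_2'$ carries the fiber onto $\mathrm{Pho}^\times(W)$. (c) $(\ell,\omega)\mapsto(\pi_P(\ell),\pi_P(\omega))$ defines a principal $H_P$-bundle $\mathcal{F}_{1,2}^\times\to\mathrm{Flag}(P)$, where $\mathrm{Flag}(P)$ is the space of full flags $U^1\subset U^2\subset P$. The fiber over $(U^1,U^2)$ consists of all pointed annihilator photons $(\ell,\omega)$ such that $\ell$ is the graph of a linear map $U^1\to P^\perp$ and $\omega$ is the graph of a linear map $U^2\to P^\perp$. The bundles are smooth, and in each of (a), (b), (c) every fiber is a $3$-sphere that is maximally transverse in the flag manifold. -/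

import Mathlib

open scoped Quaternion ContDiff

noncomputable section

namespace SplitG2

/-! ### Pseudo-Euclidean spaces -/

/-- The diagonal symmetric bilinear form `∑ wᵢ xᵢ yᵢ` on `ℝⁿ`. -/
def diagForm {n : ℕ} (w : Fin n → ℝ) : LinearMap.BilinForm ℝ (EuclideanSpace ℝ (Fin n)) :=
  LinearMap.mk₂ ℝ (fun x y => ∑ i, w i * x i * y i)
    (fun x x' y => by simp [mul_add, add_mul, Finset.sum_add_distrib])
    (fun c x y => by
      simp only [PiLp.smul_apply, smul_eq_mul, Finset.mul_sum]
      exact Finset.sum_congr rfl fun i _ => by ring)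
    (fun x y y' => by simp [mul_add, Finset.sum_add_distrib])
    (fun c x y => by
      simp only [PiLp.smul_apply, smul_eq_mul, Finset.mul_sum]
      exact Finset.sum_congr rfl fun i _ => by ring)

/-- Weights of `ℝ^{3,4}`, `ℝ^{1,4}` and `ℝ^{2,4}`. -/
def w34 : Fin 7 → ℝ := ![1, 1, 1, -1, -1, -1, -1]

def w14 : Fin 5 → ℝ := ![1, -1, -1, -1, -1]

def w24 : Fin 6 → ℝ := ![1, 1, -1, -1, -1, -1]

/-- The vector space underlying `ℝ^{3,4}`. Its Euclidean structure is used only to put the usual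
smooth structure on Grassmannians; the geometry is that of the form `q`. -/
abbrev V : Type := EuclideanSpace ℝ (Fin 7)

/-- The form of signature `(3,4)`. -/
def q : LinearMap.BilinForm ℝ V := diagForm w34

lemma q_apply (x y : V) :
    q x y = x 0 * y 0 + x 1 * y 1 + x 2 * y 2 - x 3 * y 3 - x 4 * y 4 - x 5 * y 5 - x 6 * y 6 := by
  simp [q, diagForm, w34, Fin.sum_univ_succ]
  ring

lemma q_comm (x y : V) : q x y = q y x := by
  simp only [q_apply]; ring

/-! ### The cross product of `ℝ^{3,4}` -/

/-- `V` is identified with the imaginary split octonions `Im ℍ ⊕ ℍ`; first component. -/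
def fstQ (x : V) : ℍ[ℝ] := ⟨0, x 0, x 1, x 2⟩

/-- Second component. -/
def sndQ (x : V) : ℍ[ℝ] := ⟨x 3, x 4, x 5, x 6⟩

@[simp] lemma fstQ_re (x : V) : (fstQ x).re = 0 := rfl

@[simp] lemma fstQ_imI (x : V) : (fstQ x).imI = x 0 := rfl

@[simp] lemma fstQ_imJ (x : V) : (fstQ x).imJ = x 1 := rfl

@[simp] lemma fstQ_imK (x : V) : (fstQ x).imK = x 2 := rfl

@[simp] lemma sndQ_re (x : V) : (sndQ x).re = x 3 := rfl

@[simp] lemma sndQ_imI (x : V) : (sndQ x).imI = x 4 := rfl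

@[simp] lemma sndQ_imJ (x : V) : (sndQ x).imJ = x 5 := rfl

@[simp] lemma sndQ_imK (x : V) : (sndQ x).imK = x 6 := rfl

/-- First component of the split octonion product
`(a, b)(c, d) = (ac + d b*, a* d + c b)` on `ℍ ⊕ ℍ`. -/
def mulFst (a b c d : ℍ[ℝ]) : ℍ[ℝ] := a * c + d * star b

/-- Second component of the split octonion product. -/
def mulSnd (a b c d : ℍ[ℝ]) : ℍ[ℝ] := star a * d + c * b

/-- The cross product `x × y = Im (x y)` of imaginary split octonions. -/
def crossFun (x y : V) : V :=
  let s := mulFst (fstQ x) (sndQ x) (fstQ y) (sndQ y)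
  let t := mulSnd (fstQ x) (sndQ x) (fstQ y) (sndQ y)
  !₂[s.imI, s.imJ, s.imK, t.re, t.imI, t.imJ, t.imK]

/-- The cross product in coordinates. -/
lemma crossFun_eq (x y : V) : crossFun x y =
    !₂[x 1 * y 2 - x 2 * y 1 - y 3 * x 4 + y 4 * x 3 - y 5 * x 6 + y 6 * x 5,
      x 2 * y 0 - x 0 * y 2 - y 3 * x 5 + y 4 * x 6 + y 5 * x 3 - y 6 * x 4,
      x 0 * y 1 - x 1 * y 0 - y 3 * x 6 - y 4 * x 5 + y 5 * x 4 + y 6 * x 3,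
      x 0 * y 4 + x 1 * y 5 + x 2 * y 6 - y 0 * x 4 - y 1 * x 5 - y 2 * x 6,
      -x 0 * y 3 - x 1 * y 6 + x 2 * y 5 + y 0 * x 3 + y 1 * x 6 - y 2 * x 5,
      x 0 * y 6 - x 1 * y 3 - x 2 * y 4 - y 0 * x 6 + y 1 * x 3 + y 2 * x 4,
      -x 0 * y 5 + x 1 * y 4 - x 2 * y 3 + y 0 * x 5 - y 1 * x 4 + y 2 * x 3] := by
  ext i
  fin_cases i <;> simp [crossFun, mulFst, mulSnd] <;> ring

lemma crossFun_add_left (x x' y : V) :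
    crossFun (x + x') y = crossFun x y + crossFun x' y := by
  simp only [crossFun_eq]
  ext i
  fin_cases i <;> simp <;> ring

lemma crossFun_smul_left (c : ℝ) (x y : V) : crossFun (c • x) y = c • crossFun x y := by
  simp only [crossFun_eq]
  ext i
  fin_cases i <;> simp <;> ring

lemma crossFun_add_right (x y y' : V) :
    crossFun x (y + y') = crossFun x y + crossFun x y' := by
  simp only [crossFun_eq]
  ext i
  fin_cases i <;> simp <;> ring

lemma crossFun_smul_right (c : ℝ) (x y : V) : crossFun x (c • y) = c • crossFun x y := by
  simp only [crossFun_eq]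
  ext i
  fin_cases i <;> simp <;> ring

/-- The cross product as a bilinear map. -/
def cross : V →ₗ[ℝ] V →ₗ[ℝ] V :=
  LinearMap.mk₂ ℝ crossFun crossFun_add_left crossFun_smul_left crossFun_add_right
    crossFun_smul_right

lemma cross_apply (x y : V) : cross x y = crossFun x y := rfl

/-- The cross product is alternating. -/
lemma cross_self (x : V) : cross x x = 0 := by
  rw [cross_apply, crossFun_eq]
  ext i
  fin_cases i <;> simp <;> ring

/-- The cross product is orthogonal to its first factor (hence to both). -/
lemma q_cross_left (x y : V) : q (cross x y) x = 0 := by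
  rw [q_apply, cross_apply, crossFun_eq]
  simp
  ring

/-- The normalization of the cross product. -/
lemma q_cross_cross (x y : V) : q (cross x y) (cross x y) = q x x * q y y - q x y ^ 2 := by
  simp only [q_apply, cross_apply, crossFun_eq]
  simp
  ring

/-- The double cross product identity. -/
lemma cross_cross (x y : V) : cross x (cross x y) = -(q x x) • y + q x y • x := by
  simp only [q_apply, cross_apply, crossFun_eq]
  ext i
  fin_cases i <;> simp <;> ring

/-! ### The group `G₂'` -/

/-- `G₂' = Aut(ℝ^{3,4}, ×)`, with the topology of `GL(V)`. -/
def G2 : Subgroup (V →L[ℝ] V)ˣ where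
  carrier := {g | ∀ x y : V, (g : V →L[ℝ] V) (cross x y) =
    cross ((g : V →L[ℝ] V) x) ((g : V →L[ℝ] V) y)}
  mul_mem' := by
    intro a b ha hb x y
    have hb' := hb x y
    have ha' := ha ((b : V →L[ℝ] V) x) ((b : V →L[ℝ] V) y)
    simp only [Units.val_mul, mul_apply_eq_comp]
    rw [hb', ha']
  one_mem' := by intro x y; simp
  inv_mem' := by
    intro a ha x y
    have h1 : ∀ z, a.val (a⁻¹.val z) = z := fun z => by
      have h := a.mul_inv
      exact DFunLike.congr_fun h z
    have h2 : ∀ z, a⁻¹.val (a.val z) = z := fun z => by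
      have h := a.inv_mul
      exact DFunLike.congr_fun h z
    have h := ha (a⁻¹.val x) (a⁻¹.val y)
    rw [h1, h1] at h
    rw [← h, h2]

/-- The linear map of `V` given by an element of `G₂'`. -/
def lin (g : G2) : V →ₗ[ℝ] V := (((g : (V →L[ℝ] V)ˣ) : V →L[ℝ] V) : V →ₗ[ℝ] V)

lemma lin_one : lin 1 = LinearMap.id := rfl

lemma lin_mul (g h : G2) : lin (g * h) = lin g ∘ₗ lin h := rfl

lemma lin_injective (g : G2) : Function.Injective (lin g) := by
  have h : lin g⁻¹ ∘ₗ lin g = LinearMap.id := by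
    rw [← lin_mul, inv_mul_cancel, lin_one]
  exact Function.LeftInverse.injective (g := lin g⁻¹) fun x => LinearMap.congr_fun h x

lemma lin_cross (g : G2) (x y : V) : lin g (cross x y) = cross (lin g x) (lin g y) := g.2 x y

lemma q_lin_self (g : G2) (x : V) : q (lin g x) (lin g x) = q x x := by
  by_cases hx : x = 0
  · simp [hx]
  obtain ⟨y, hy⟩ : ∃ y : V, y ∉ Submodule.span ℝ {x} := by
    by_contra! hall
    have h1 : Submodule.span ℝ {x} = ⊤ := Submodule.eq_top_iff'.2 hall
    have h2 := finrank_span_singleton (K := ℝ) hx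
    rw [h1, finrank_top] at h2
    simp at h2
  have e1 := congrArg (lin g) (cross_cross x y)
  rw [lin_cross, lin_cross, cross_cross] at e1
  have e2 : lin g ((q x x - q (lin g x) (lin g x)) • y) =
      lin g ((q x y - q (lin g x) (lin g y)) • x) := by
    simp only [map_add, map_smul, neg_smul, map_neg, sub_smul] at e1 ⊢
    rw [map_sub, map_sub]
    simp only [map_smul]
    linear_combination (norm := module) e1
  have e3 := lin_injective g e2
  by_contra hne
  apply hy
  have hc : q x x - q (lin g x) (lin g x) ≠ 0 := fun h => hne (by linarith)
  rw [Submodule.mem_span_singleton]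
  refine ⟨(q x x - q (lin g x) (lin g x))⁻¹ * (q x y - q (lin g x) (lin g y)), ?_⟩
  rw [mul_smul, ← e3, smul_smul, inv_mul_cancel₀ hc, one_smul]

lemma q_lin (g : G2) (x y : V) : q (lin g x) (lin g y) = q x y := by
  have h := q_lin_self g (x + y)
  simp only [map_add, LinearMap.add_apply, q_lin_self] at h
  have h1 := q_comm (lin g x) (lin g y)
  have h2 := q_comm x y
  linarith

/-! ### Smooth maps between embedded submanifolds of vector spaces -/

section Smooth

variable {X Y E E' : Type*} [NormedAddCommGroup E] [NormedSpace ℝ E]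
  [NormedAddCommGroup E'] [NormedSpace ℝ E']

/-- Smoothness of a map between spaces embedded in normed vector spaces by `eX` and `eY`: locally
it extends to a smooth map of the ambient spaces. -/
def SmoothMap (eX : X → E) (eY : Y → E') (f : X → Y) : Prop :=
  ∀ x, ∃ O : Set E, IsOpen O ∧ eX x ∈ O ∧ ∃ g : E → E', ContDiffOn ℝ ∞ g O ∧
    ∀ y, eX y ∈ O → g (eX y) = eY (f y)

/-- A bijection that is smooth in both directions. -/
def IsDiffeo (eX : X → E) (eY : Y → E') (f : X ≃ Y) : Prop :=
  SmoothMap eX eY f ∧ SmoothMap eY eX f.symm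

/-- The set `S` is a smooth 3-sphere: it is diffeomorphic to the unit sphere of `ℝ⁴`. -/
def IsThreeSphere (eX : X → E) (S : Set X) : Prop :=
  ∃ f : Metric.sphere (0 : EuclideanSpace ℝ (Fin 4)) 1 ≃ S,
    IsDiffeo (fun x : Metric.sphere (0 : EuclideanSpace ℝ (Fin 4)) 1 => x.1) (fun s : S => eX s) f

end Smooth

/-- `π : F → B` is a smooth principal bundle with structure group `H` acting on `F`. -/
structure IsPrincipalBundle {F B H E₁ E₂ E₃ : Type*}
    [NormedAddCommGroup E₁] [NormedSpace ℝ E₁] [NormedAddCommGroup E₂] [NormedSpace ℝ E₂]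
    [NormedAddCommGroup E₃] [NormedSpace ℝ E₃] [Group H] [MulAction H F]
    (eF : F → E₁) (eB : B → E₂) (eH : H → E₃) (π : F → B) : Prop where
  smooth_action : SmoothMap (fun p : H × F => (eH p.1, eF p.2)) eF (fun p => p.1 • p.2)
  smooth_proj : SmoothMap eF eB π
  surjective : Function.Surjective π
  /-- The fibers are exactly the orbits. -/
  fiber_iff : ∀ x y, π x = π y ↔ ∃ h : H, h • x = y
  free : ∀ (h : H) (x : F), h • x = x → h = 1
  /-- Equivariant local triviality over an open neighborhood of every point of the base. -/
  locally_trivial : ∀ b : B, ∃ N : Set B, b ∈ N ∧ (∃ O : Set E₂, IsOpen O ∧ N = eB ⁻¹' O) ∧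
    ∃ Φ : N × H ≃ π ⁻¹' N,
      (∀ p, π (Φ p) = p.1) ∧
      (∀ (c : N) (h k : H), (Φ (c, h * k) : F) = h • (Φ (c, k) : F)) ∧
      IsDiffeo (fun p : N × H => (eB p.1, eH p.2)) (fun x : π ⁻¹' N => eF x) Φ

/-! ### Transversality -/

section Transversality

variable (G : Type*) {F : Type*} [Group G] [TopologicalSpace F] [MulAction G F]

/-- Two points are transverse if they lie in the open `G`-orbit of `F × F`. -/
def Transverse (x y : F) : Prop := IsOpen (MulAction.orbit G ((x, y) : F × F))

def TransverseSet (S : Set F) : Prop := S.Pairwise (Transverse G)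

/-- A transverse subset not properly contained in another transverse subset. -/
def MaximallyTransverse (S : Set F) : Prop :=
  TransverseSet G S ∧ ∀ T : Set F, TransverseSet G T → S ⊆ T → T = S

end Transversality

/-! ### Flag manifolds -/

/-- The embedding of Grassmannians of a Euclidean space into its endomorphisms: a subspace is sent
to the Euclidean orthogonal projection onto it. -/
def grEmb {n : ℕ} (W : Submodule ℝ (EuclideanSpace ℝ (Fin n))) :
    EuclideanSpace ℝ (Fin n) →L[ℝ] EuclideanSpace ℝ (Fin n) :=
  W.starProjection

/-- Totally isotropic `k`-planes for the diagonal form with weights `w`. -/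
def Iso {n : ℕ} (w : Fin n → ℝ) (k : ℕ) : Type :=
  {W : Submodule ℝ (EuclideanSpace ℝ (Fin n)) //
    Module.finrank ℝ W = k ∧ ∀ x ∈ W, ∀ y ∈ W, diagForm w x y = 0}

/-- `Ein^{2,3}`, the isotropic lines of `ℝ^{3,4}`. -/
abbrev Ein : Type := Iso w34 1

/-- `Ein^{0,3}`, the isotropic lines of `ℝ^{1,4}`. -/
abbrev Ein03 : Type := Iso w14 1

/-- Annihilator photons: isotropic planes of `ℝ^{3,4}` with vanishing cross product. -/
def Pho : Type := {W : Iso w34 2 // ∀ x ∈ W.1, ∀ y ∈ W.1, cross x y = 0}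

def Pho.plane (W : Pho) : Submodule ℝ V := W.1.1

/-- Pointed annihilator photons, the full flag manifold of `G₂'`. -/
def F12 : Type := {p : Ein × Pho // p.1.1 ≤ p.2.plane}

def F12.line (p : F12) : Submodule ℝ V := p.1.1.1

def F12.plane (p : F12) : Submodule ℝ V := p.1.2.plane

def Iso.emb {n k : ℕ} {w : Fin n → ℝ} (W : Iso w k) :
    EuclideanSpace ℝ (Fin n) →L[ℝ] EuclideanSpace ℝ (Fin n) := grEmb W.1

def Pho.emb (W : Pho) : V →L[ℝ] V := grEmb W.plane

def F12.emb (p : F12) : (V →L[ℝ] V) × (V →L[ℝ] V) := (grEmb p.line, grEmb p.plane)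

instance {n k : ℕ} {w : Fin n → ℝ} : TopologicalSpace (Iso w k) := .induced Iso.emb inferInstance

instance : TopologicalSpace Pho := .induced Pho.emb inferInstance

instance : TopologicalSpace F12 := .induced F12.emb inferInstance

lemma finrank_map (g : G2) (W : Submodule ℝ V) :
    Module.finrank ℝ (W.map (lin g)) = Module.finrank ℝ W :=
  (Submodule.equivMapOfInjective (lin g) (lin_injective g) W).finrank_eq.symm

/-- `G₂'` acts on all its flag manifolds by taking images of subspaces. -/
instance {k : ℕ} : MulAction G2 (Iso w34 k) where
  smul g W := ⟨W.1.map (lin g), (finrank_map g W.1).trans W.2.1, by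
    rintro _ ⟨x, hx, rfl⟩ _ ⟨y, hy, rfl⟩
    exact (q_lin g x y).trans (W.2.2 x hx y hy)⟩
  one_smul W := Subtype.ext (Submodule.map_id _)
  mul_smul g h W := Subtype.ext (Submodule.map_comp _ _ _)

instance : MulAction G2 Pho where
  smul g W := ⟨g • W.1, by
    rintro _ ⟨x, hx, rfl⟩ _ ⟨y, hy, rfl⟩
    rw [← lin_cross, W.2 x hx y hy, map_zero]⟩
  one_smul W := Subtype.ext (one_smul _ _)
  mul_smul g h W := Subtype.ext (mul_smul _ _ _)

instance : MulAction G2 F12 where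
  smul g p := ⟨(g • p.1.1, g • p.1.2), Submodule.map_mono p.2⟩
  one_smul p := Subtype.ext (Prod.ext (one_smul G2 p.1.1) (one_smul G2 p.1.2))
  mul_smul g h p := Subtype.ext (Prod.ext (mul_smul g h p.1.1) (mul_smul g h p.1.2))

/-! ### The symmetric space -/

/-- The symmetric space of `G₂'`: positive definite 3-planes `P` with `P × P = P`. -/
def SymSpace : Type :=
  {P : Submodule ℝ V // Module.finrank ℝ P = 3 ∧ (∀ x ∈ P, x ≠ 0 → 0 < q x x) ∧
    Submodule.map₂ cross P P = P}

namespace SymSpace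

variable (P : SymSpace)

/-- The `q`-orthogonal complement of `P`. -/
def perp : Submodule ℝ V := q.orthogonal P.1

lemma isCompl : IsCompl P.1 P.perp := by
  have hr : q.IsRefl := fun x y h => by rw [q_comm]; exact h
  refine (LinearMap.BilinForm.isCompl_orthogonal_iff_disjoint hr).2 ?_
  rw [Submodule.disjoint_def]
  intro x hx hx'
  by_contra hne
  have h0 : q x x = 0 := hx' x hx
  exact absurd h0 (P.2.2.1 x hx hne).ne'

/-- The `q`-orthogonal projection onto `P`. -/
def proj : V →ₗ[ℝ] V := P.1.projection P.perp P.isCompl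

/-- The pointwise stabilizer of `P` in `G₂'`. -/
def H : Subgroup G2 where
  carrier := {g | ∀ x ∈ P.1, lin g x = x}
  mul_mem' := by
    intro a b ha hb x hx
    rw [lin_mul, LinearMap.comp_apply, hb x hx, ha x hx]
  one_mem' := fun x _ => rfl
  inv_mem' := by
    intro a ha x hx
    have h : lin a⁻¹ (lin a x) = x := by
      rw [← LinearMap.comp_apply, ← lin_mul, inv_mul_cancel]; rfl
    rwa [ha x hx] at h

def hEmb (h : P.H) : V →L[ℝ] V := ((h : G2) : (V →L[ℝ] V)ˣ)

/-- The Grassmannian of `k`-planes in `P`. -/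
def Gr (k : ℕ) : Type := {U : Submodule ℝ V // U ≤ P.1 ∧ Module.finrank ℝ U = k}

/-- Full flags in `P`. -/
def Flag : Type := {U : P.Gr 1 × P.Gr 2 // U.1.1 ≤ U.2.1}

variable {P}

def Gr.emb {k : ℕ} (U : P.Gr k) : V →L[ℝ] V := grEmb U.1

def Flag.emb (U : P.Flag) : (V →L[ℝ] V) × (V →L[ℝ] V) := (U.1.1.emb, U.1.2.emb)

variable (P)

/-- `W` is the graph of a linear map `U → P^⊥`. -/
def IsGraphOver (U W : Submodule ℝ V) : Prop :=
  ∃ φ : U →ₗ[ℝ] V, (∀ u, φ u ∈ P.perp) ∧ W = LinearMap.range (U.subtype + φ)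

end SymSpace

/-- A linear map `f : ℝⁿ → ℝ^{3,4}` is isometric for the diagonal form with weights `w`. -/
def IsIsometric {n : ℕ} (w : Fin n → ℝ) (f : EuclideanSpace ℝ (Fin n) →ₗ[ℝ] V) : Prop :=
  ∀ x y, q (f x) (f y) = diagForm w x y

/-- Annihilator photons contained in a subspace. -/
def PhoIn (W : Submodule ℝ V) : Set Pho := {T | T.plane ≤ W}

end SplitG2

end

open SplitG2

noncomputable section

namespace SplitG2

/-! ### Identities for the cross product -/

/-! The engine is that `G₂'` acts simply transitively on triads: `x`, `y` orthonormal and `z` with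
`q z z = -1` orthogonal to `x`, `y` and `x × y`. Such a triple generates the algebra with a fixed
multiplication table (`IsTriad.frameMap_cross`), and an element of `G₂'` is determined by its values
on the triple. Fixing `x`, `y` in `P`, one finds that `H_P` acts simply transitively on the unit
3-sphere of the negative definite space `P^⊥` (`SymSpace.exists_transport`). In coordinates adapted
to `P` it is right multiplication by unit quaternions on the second factor of `Im ℍ ⊕ ℍ`
(`SymSpace.exists_unitary_mulEquiv`).

An isotropic `W` meets `P^⊥` only in zero, so it is a graph over `U = π_P(W)`. Let `a ∈ U` be a unit
vector and `a + b ∈ W` with `b ∈ P^⊥`. Then `q b b = -1`, and `W × W = 0` forces `W` to be the image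
of `U` under `x ↦ x - a × (x × b)` (`SymSpace.eq_map_graphMap`). Conversely, over a line or plane
`U` every unit `b` gives an annihilator subspace this way (`SymSpace.isAnnihilator_map_graphMap`).
As `H_P` acts on these graphs through `b` alone, each fiber is one free `H_P`-orbit, for lines,
photons and flags alike. Local sections come from keeping `b` fixed and taking for `a` the
normalized Euclidean projection of a fixed vector to `U`. Smoothness rests on the fact that the
orthogonal projection onto the range of an analytic family of linear maps of constant rank is
analytic (`AnalyticNear.grEmb`).

Opposition of lines or photons means that `q` pairs them with full rank. It is open and invariant,
and a normal form in terms of triads shows that opposite pairs form one orbit (`ein_transitive`,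
`pho_transitive`, `flag_transitive`); so opposite pairs are transverse. Two distinct points of a
fiber have parameters `b ≠ b'`, and `1 + q b b' > 0` makes them opposite. For maximality, each point
outside a fiber admits a fiber point in special position: an orthogonal line when the lines project
differently, and a photon meeting the given one when the planes do, since distinct planes in `P`
share a line. A rotation in `H_P` destroys this position at once, so the orbit of the pair is not
open (`not_transverse_of_path`). -/

lemma cross_swap (x y : V) : cross x y = -cross y x := by
  simp only [cross_apply, crossFun_eq]
  ext i
  fin_cases i <;> simp <;> ring

/-- The double cross product identity linearized in its repeated argument. -/
lemma cross_cross_polar (x y z : V) :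
    cross x (cross y z) = -cross y (cross x z) - (2 * q x y) • z + q x z • y + q y z • x := by
  have h := cross_cross (x + y) z
  simp only [map_add, LinearMap.add_apply, cross_cross x z, cross_cross y z, q_comm y x] at h
  linear_combination (norm := module) h

lemma q_cross_left_eq (x y z : V) : q (cross x y) z = -q y (cross x z) := by
  simp only [q_apply, cross_apply, crossFun_eq]
  simp
  ring

lemma q_cross_right (x y : V) : q (cross x y) y = 0 := by
  rw [cross_swap, map_neg, LinearMap.neg_apply, q_cross_left, neg_zero]

lemma q_cross_cyclic (x y z : V) : q (cross x y) z = q (cross y z) x := by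
  simp only [q_apply, cross_apply, crossFun_eq]
  simp
  ring

lemma q_cross_cross_polar (x y z : V) :
    q (cross x y) (cross x z) = q x x * q y z - q x y * q x z := by
  rw [q_cross_left_eq, cross_cross]
  simp [q_comm y x]
  ring

lemma cross_cross_of_orthogonal {x y z : V} (hxy : q x y = 0) (hxz : q x z = 0)
    (hyz : q y z = 0) : cross x (cross y z) = -cross y (cross x z) := by
  rw [cross_cross_polar, hxy, hxz, hyz]
  simp

/-! ### Triads and the elements of `G₂'` they define -/

/-- A triple that generates the split octonions and has the multiplication table of the standard
generators. -/
structure IsTriad (x y z : V) : Prop where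
  xx : q x x = 1
  yy : q y y = 1
  zz : q z z = -1
  xy : q x y = 0
  xz : q x z = 0
  yz : q y z = 0
  xyz : q (cross x y) z = 0

/-- The linear map carrying the standard basis to the basis generated by `x`, `y`, `z`. -/
def frameMap (x y z : V) : V →L[ℝ] V :=
  (EuclideanSpace.proj 0 : V →L[ℝ] ℝ).smulRight x +
  (EuclideanSpace.proj 1 : V →L[ℝ] ℝ).smulRight y +
  (EuclideanSpace.proj 2 : V →L[ℝ] ℝ).smulRight (cross x y) +
  (EuclideanSpace.proj 3 : V →L[ℝ] ℝ).smulRight z -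
  -- In the standard basis `e₀ × e₃ = -e₄`, `e₁ × e₃ = -e₅` and `e₂ × e₃ = -e₆`, hence the signs.
  (EuclideanSpace.proj 4 : V →L[ℝ] ℝ).smulRight (cross x z) -
  (EuclideanSpace.proj 5 : V →L[ℝ] ℝ).smulRight (cross y z) -
  (EuclideanSpace.proj 6 : V →L[ℝ] ℝ).smulRight (cross (cross x y) z)

lemma frameMap_apply (x y z v : V) : frameMap x y z v =
    v 0 • x + v 1 • y + v 2 • cross x y + v 3 • z - v 4 • cross x z - v 5 • cross y z -
      v 6 • cross (cross x y) z := by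
  simp [frameMap]

namespace IsTriad

variable {x y z : V}

/-- The triad relations fix the whole multiplication table. Of the 21 products of the seven basis
vectors, four define new basis vectors; the other 17 follow from the double cross product identity
and from the anticommutation of multiplications by orthogonal vectors. Both sides then expand to the
same combination. -/
lemma frameMap_cross (h : IsTriad x y z) (u v : V) :
    frameMap x y z (cross u v) = cross (frameMap x y z u) (frameMap x y z v) := by
  obtain ⟨xx, yy, zz, xy, xz, yz, xyz⟩ := h
  have yx : q y x = 0 := by rw [q_comm, xy]
  have zx : q z x = 0 := by rw [q_comm, xz]
  have zy : q z y = 0 := by rw [q_comm, yz]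
  obtain ⟨c, hc⟩ : ∃ c, c = cross x y := ⟨_, rfl⟩
  rw [← hc] at xyz
  have cx : q c x = 0 := by rw [hc, q_cross_left]
  have cy : q c y = 0 := by rw [hc, q_cross_right]
  have xc : q x c = 0 := by rw [q_comm, cx]
  have yc : q y c = 0 := by rw [q_comm, cy]
  have zc : q z c = 0 := by rw [q_comm, xyz]
  have cc : q c c = 1 := by rw [hc, q_cross_cross, xx, yy, xy]; norm_num
  have t1 : cross x c = -y := by rw [hc, cross_cross, xx, xy]; simp
  have t2 : cross y c = x := by rw [hc, cross_swap x y, map_neg, cross_cross, yy, yx]; simp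
  obtain ⟨a', ha⟩ : ∃ a', a' = cross x z := ⟨_, rfl⟩
  obtain ⟨b', hb⟩ : ∃ b', b' = cross y z := ⟨_, rfl⟩
  obtain ⟨c', hc'⟩ : ∃ c', c' = cross c z := ⟨_, rfl⟩
  have t3 : cross x a' = -z := by rw [ha, cross_cross, xx, xz]; simp
  have t4 : cross y b' = -z := by rw [hb, cross_cross, yy, yz]; simp
  have t5 : cross c c' = -z := by rw [hc', cross_cross, cc, xyz]; simp
  have t6 : cross x b' = -c' := by
    rw [hc', hc, cross_swap _ z, cross_cross_of_orthogonal zx zy xy, cross_swap z y, hb]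
    simp
  have t7 : cross y a' = c' := by
    rw [ha, cross_cross_of_orthogonal yx yz xz, ← hb, t6, neg_neg]
  have xb' : q x b' = 0 := by rw [hb, q_comm, q_cross_cyclic, q_cross_cyclic, ← hc, xyz]
  have ya' : q y a' = 0 := by
    rw [ha, q_comm, q_cross_cyclic, cross_swap z y, ← hb]; simp [q_comm b' x, xb']
  have xa' : q x a' = 0 := by rw [ha, q_comm, q_cross_left]
  have yb' : q y b' = 0 := by rw [hb, q_comm, q_cross_left]
  have za' : q z a' = 0 := by rw [ha, q_comm, q_cross_right]
  have zb' : q z b' = 0 := by rw [hb, q_comm, q_cross_right]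
  have zc' : q z c' = 0 := by rw [hc', q_comm, q_cross_right]
  have c't : c' = -cross x b' := by rw [t6, neg_neg]
  have t8 : cross x c' = b' := by rw [c't, map_neg, cross_cross, xx, xb']; simp
  have t9 : cross y c' = -a' := by rw [← t7, cross_cross, yy, ya']; simp
  have t10 : cross c a' = -b' := by
    rw [ha, cross_cross_of_orthogonal cx xyz xz, ← hc', t8]
  have t11 : cross c b' = a' := by
    rw [hb, cross_cross_of_orthogonal cy xyz yz, ← hc', t9, neg_neg]
  have t12 : cross z a' = -x := by
    rw [ha, cross_swap x z, map_neg, cross_cross, zz, zx]; simp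
  have t13 : cross z b' = -y := by
    rw [hb, cross_swap y z, map_neg, cross_cross, zz, zy]; simp
  have t14 : cross z c' = -c := by
    rw [hc', cross_swap c z, map_neg, cross_cross, zz, zc]; simp
  have xc' : q x c' = 0 := by rw [c't, map_neg, q_comm, q_cross_left, neg_zero]
  have yc' : q y c' = 0 := by rw [← t7, q_comm, q_cross_left]
  have t15 : cross a' b' = c := by
    rw [cross_swap a' b', ha, cross_cross_of_orthogonal (by rw [q_comm, xb']) (by rw [q_comm, zb'])
      xz, cross_swap b' z, t13, hc]
    simp
  have t16 : cross a' c' = -y := by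
    rw [cross_swap a' c', ha, cross_cross_of_orthogonal (by rw [q_comm, xc']) (by rw [q_comm, zc'])
      xz, cross_swap c' z, t14]
    simp [t1]
  have t17 : cross b' c' = x := by
    rw [cross_swap b' c', hb, cross_cross_of_orthogonal (by rw [q_comm, yc']) (by rw [q_comm, zc'])
      yz, cross_swap c' z, t14]
    simp [t2]
  simp only [frameMap_apply, ← hc, ← ha, ← hb, ← hc', map_add, map_sub, map_smul,
    LinearMap.add_apply, LinearMap.sub_apply, LinearMap.smul_apply, cross_self,
    cross_swap y x, cross_swap c x, cross_swap z x, cross_swap a' x, cross_swap b' x,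
    cross_swap c' x, cross_swap c y, cross_swap z y, cross_swap a' y, cross_swap b' y,
    cross_swap c' y, cross_swap z c, cross_swap a' c, cross_swap b' c, cross_swap c' c,
    cross_swap a' z, cross_swap b' z, cross_swap c' z, cross_swap b' a', cross_swap c' a',
    cross_swap c' b', t1, t2, t3, t4, t5, t6, t7, t8, t9, t10, t11, t12, t13, t14, t15, t16, t17]
  simp only [cross_apply u v, crossFun_eq u v]
  simp only [Matrix.cons_val]
  module

/-- If a multiplicative map `f` kills `v`, then applying it to `u × (u × v)` gives `q u v • f u =
0`. A `u` not orthogonal to `v` would therefore be killed. Since `f e₀ = x ≠ 0`, `v` is orthogonal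
to `e₀`; then `u` and `u + e₀` would both be killed, which is absurd. So `v` lies in the radical of
`q`. -/
lemma frameMap_injective (h : IsTriad x y z) : Function.Injective (frameMap x y z) := by
  rw [injective_iff_map_eq_zero]
  intro v hv
  have key : ∀ u : V, q u v ≠ 0 → frameMap x y z u = 0 := by
    intro u hu
    have h1 : frameMap x y z (cross u (cross u v)) = 0 := by
      rw [h.frameMap_cross, h.frameMap_cross, hv]; simp
    rw [cross_cross, map_add, map_smul, map_smul, hv, smul_zero, zero_add] at h1
    exact (smul_eq_zero.1 h1).resolve_left hu
  have he : frameMap x y z (EuclideanSpace.single 0 1) = x := by simp [frameMap_apply]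
  have hx : x ≠ 0 := fun h0 => by simpa [h0] using h.xx
  have h0 : q (EuclideanSpace.single 0 1 : V) v = 0 := by
    by_contra hne
    exact hx (he ▸ key _ hne)
  have hall : ∀ u, q u v = 0 := by
    intro u
    by_contra hne
    have h1 := key u hne
    have h2 := key (u + EuclideanSpace.single 0 1) (by
      rw [map_add, LinearMap.add_apply, h0, add_zero]; exact hne)
    rw [map_add, h1, zero_add, he] at h2
    exact hx h2
  ext i
  have := hall (EuclideanSpace.single i 1)
  rw [q_apply] at this
  fin_cases i <;> simpa using this

/-- The element of `G₂'` carrying the standard triad to `x`, `y`, `z`. -/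
def frame (h : IsTriad x y z) : G2 :=
  ⟨ContinuousLinearEquiv.toUnit (LinearEquiv.ofInjectiveEndo (frameMap x y z : V →ₗ[ℝ] V)
    h.frameMap_injective).toContinuousLinearEquiv, h.frameMap_cross⟩

lemma lin_frame (h : IsTriad x y z) (v : V) : lin h.frame v = frameMap x y z v := rfl

end IsTriad

lemma lin_ext {g h : G2} (e : ∀ v, lin g v = lin h v) : g = h :=
  Subtype.ext (Units.ext (ContinuousLinearMap.ext e))

lemma lin_inv_apply (g : G2) (v : V) : lin g⁻¹ (lin g v) = v := by
  rw [← LinearMap.comp_apply, ← lin_mul, inv_mul_cancel]; rfl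

lemma lin_apply_inv (g : G2) (v : V) : lin g (lin g⁻¹ v) = v := by
  rw [← LinearMap.comp_apply, ← lin_mul, mul_inv_cancel]; rfl

lemma lin_frameMap (g : G2) (x y z v : V) :
    lin g (frameMap x y z v) = frameMap (lin g x) (lin g y) (lin g z) v := by
  simp only [frameMap_apply, map_add, map_sub, map_smul, lin_cross]

/-- With `x`, `y` fixed in `P`, this makes an element of `H_P` an analytic function of its value at
one vector. -/
lemma contDiff_frameMap (x y : V) : ContDiff ℝ ω (frameMap x y) := by
  have hc : ∀ w : V, ContDiff ℝ ω fun z : V => cross w z := fun w =>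
    (LinearMap.toContinuousLinearMap (cross w)).contDiff
  unfold frameMap
  exact ((((((contDiff_const.add contDiff_const).add contDiff_const).add
    (contDiff_const.smulRight contDiff_id)).sub (contDiff_const.smulRight (hc x))).sub
    (contDiff_const.smulRight (hc y)))).sub (contDiff_const.smulRight (hc (cross x y)))


/-! ### Analytic functions on embedded spaces -/

open Filter Topology in
/-- Near `x₀` the function `F` is the restriction along `eX` of an analytic function. -/
def AnalyticNear {X E E' : Type*} [NormedAddCommGroup E] [NormedSpace ℝ E]
    [NormedAddCommGroup E'] [NormedSpace ℝ E'] (eX : X → E) (F : X → E') (x₀ : X) : Prop :=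
  ∃ g : E → E', ContDiffAt ℝ ω g (eX x₀) ∧ ∀ᶠ y in comap eX (𝓝 (eX x₀)), g (eX y) = F y

section AnalyticNear

open Filter Topology

/-- The filter `comap eX (𝓝 (eX x₀))` plays the role of the neighbourhood filter of `x₀`, so `X`
itself needs no topology. -/
lemma self_of_comap_nhds {X E : Type*} [TopologicalSpace E] {eX : X → E} {x₀ : X} {p : X → Prop}
    (h : ∀ᶠ y in comap eX (𝓝 (eX x₀)), p y) : p x₀ := by
  rw [eventually_comap] at h
  exact h.self_of_nhds x₀ rfl

variable {X Y E E' E'' E₃ : Type*} [NormedAddCommGroup E] [NormedSpace ℝ E]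
  [NormedAddCommGroup E'] [NormedSpace ℝ E'] [NormedAddCommGroup E''] [NormedSpace ℝ E'']
  [NormedAddCommGroup E₃] [NormedSpace ℝ E₃]
  {eX : X → E} {eY : Y → E'} {x₀ : X}

/-- Being `C^ω` at a point persists on a neighbourhood, whereas for `C^∞` at a point the
neighbourhood may shrink with the order of differentiation. This is why local smoothness is proved
in the analytic category. -/
lemma smoothMap_of_analyticNear {f : X → Y} (h : ∀ x, AnalyticNear eX (fun y => eY (f y)) x) :
    SmoothMap eX eY f := by
  intro x
  obtain ⟨g, hg, he⟩ := h x
  rw [eventually_comap] at he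
  obtain ⟨O, hO, hOo, hx⟩ := eventually_nhds_iff.1 (he.and (hg.eventually (by simp)))
  exact ⟨O, hOo, hx, g, fun y hy => ((hO y hy).2.of_le (by simp)).contDiffWithinAt,
    fun y hy => (hO _ hy).1 y rfl⟩

namespace AnalyticNear

lemma of_contDiffAt {F : E → E'} (h : ContDiffAt ℝ ω F (eX x₀)) :
    AnalyticNear eX (fun x => F (eX x)) x₀ := ⟨F, h, Eventually.of_forall fun _ => rfl⟩

lemma emb : AnalyticNear eX eX x₀ := of_contDiffAt (F := id) contDiffAt_id

lemma const (c : E') : AnalyticNear eX (fun _ => c) x₀ :=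
  of_contDiffAt (F := fun _ => c) contDiffAt_const

lemma congr {F G : X → E'} (h : AnalyticNear eX F x₀)
    (e : ∀ᶠ y in comap eX (𝓝 (eX x₀)), F y = G y) : AnalyticNear eX G x₀ := by
  obtain ⟨g, hg, he⟩ := h
  exact ⟨g, hg, by filter_upwards [he, e] with y h1 h2 using h1.trans h2⟩

lemma tendsto {F : X → E'} (h : AnalyticNear eX F x₀) :
    Tendsto F (comap eX (𝓝 (eX x₀))) (𝓝 (F x₀)) := by
  obtain ⟨g, hg, he⟩ := h
  rw [← self_of_comap_nhds he]
  exact Tendsto.congr' he (hg.continuousAt.tendsto.comp tendsto_comap)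

/-- Postcomposition with an analytic map of the ambient space. -/
lemma comp {F : X → E'} (h : AnalyticNear eX F x₀) {G : E' → E''}
    (hG : ContDiffAt ℝ ω G (F x₀)) : AnalyticNear eX (fun x => G (F x)) x₀ := by
  obtain ⟨g, hg, he⟩ := h
  rw [← self_of_comap_nhds he] at hG
  exact ⟨G ∘ g, hG.comp _ hg, by filter_upwards [he] with y hy; simp [hy]⟩

/-- Precomposition with a map between embedded spaces. -/
lemma comp_map {f : X → Y} {F : Y → E''} (hF : AnalyticNear eY F (f x₀))
    (hf : AnalyticNear eX (fun x => eY (f x)) x₀) : AnalyticNear eX (fun x => F (f x)) x₀ := by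
  have ht : Tendsto f (comap eX (𝓝 (eX x₀))) (comap eY (𝓝 (eY (f x₀)))) :=
    tendsto_comap_iff.2 hf.tendsto
  obtain ⟨g, hg, he⟩ := hF
  exact (hf.comp hg).congr (ht.eventually he)

lemma prodMk {F : X → E'} {G : X → E''} (hF : AnalyticNear eX F x₀)
    (hG : AnalyticNear eX G x₀) : AnalyticNear eX (fun x => (F x, G x)) x₀ := by
  obtain ⟨f, hf, ef⟩ := hF
  obtain ⟨g, hg, eg⟩ := hG
  exact ⟨fun t => (f t, g t), hf.prodMk hg, by filter_upwards [ef, eg] with y h1 h2; simp [h1, h2]⟩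

lemma comp₂ {F : X → E'} {G : X → E''} (hF : AnalyticNear eX F x₀)
    (hG : AnalyticNear eX G x₀) {B : E' → E'' → E₃}
    (hB : ContDiffAt ℝ ω (fun p : E' × E'' => B p.1 p.2) (F x₀, G x₀)) :
    AnalyticNear eX (fun x => B (F x) (G x)) x₀ :=
  (hF.prodMk hG).comp (G := fun p : E' × E'' => B p.1 p.2) hB

lemma add {F G : X → E'} (hF : AnalyticNear eX F x₀) (hG : AnalyticNear eX G x₀) :
    AnalyticNear eX (fun x => F x + G x) x₀ :=
  hF.comp₂ hG (contDiffAt_fst.add contDiffAt_snd)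

lemma sub {F G : X → E'} (hF : AnalyticNear eX F x₀) (hG : AnalyticNear eX G x₀) :
    AnalyticNear eX (fun x => F x - G x) x₀ :=
  hF.comp₂ hG (contDiffAt_fst.sub contDiffAt_snd)

lemma smul {c : X → ℝ} {G : X → E'} (hF : AnalyticNear eX c x₀) (hG : AnalyticNear eX G x₀) :
    AnalyticNear eX (fun x => c x • G x) x₀ :=
  hF.comp₂ hG (contDiffAt_fst.smul contDiffAt_snd)

lemma clm_comp {F : X → E'' →L[ℝ] E₃} {G : X → E' →L[ℝ] E''} (hF : AnalyticNear eX F x₀)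
    (hG : AnalyticNear eX G x₀) : AnalyticNear eX (fun x => F x ∘L G x) x₀ :=
  hF.comp₂ hG (contDiffAt_fst.clm_comp contDiffAt_snd)

lemma clm_apply {F : X → E'' →L[ℝ] E₃} {G : X → E''} (hF : AnalyticNear eX F x₀)
    (hG : AnalyticNear eX G x₀) : AnalyticNear eX (fun x => F x (G x)) x₀ :=
  hF.comp₂ hG (contDiffAt_fst.clm_apply contDiffAt_snd)

lemma clm (L : E' →L[ℝ] E'') {F : X → E'} (hF : AnalyticNear eX F x₀) :
    AnalyticNear eX (fun x => L (F x)) x₀ := hF.comp L.contDiff.contDiffAt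

lemma linearMap [FiniteDimensional ℝ E'] (L : E' →ₗ[ℝ] E'') {F : X → E'}
    (hF : AnalyticNear eX F x₀) : AnalyticNear eX (fun x => L (F x)) x₀ :=
  hF.clm (LinearMap.toContinuousLinearMap L)

end AnalyticNear

/-! ### Orthogonal projections depend analytically on the subspace -/

variable {n : ℕ}

local notation "𝔼" => EuclideanSpace ℝ (Fin n)

lemma grEmb_range (W : Submodule ℝ 𝔼) : LinearMap.range (grEmb W : 𝔼 →ₗ[ℝ] 𝔼) = W :=
  Submodule.range_starProjection W

lemma grEmb_apply_mem (W : Submodule ℝ 𝔼) (v : 𝔼) : grEmb W v ∈ W :=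
  Submodule.starProjection_apply_mem W v

lemma grEmb_apply_eq {W : Submodule ℝ 𝔼} {v : 𝔼} (hv : v ∈ W) : grEmb W v = v :=
  Submodule.starProjection_eq_self_iff.2 hv

open ContinuousLinearMap in
/-- For an idempotent `r` the operator `r + r* - 1` is invertible. -/
lemma isUnit_add_star_sub_one {r : 𝔼 →L[ℝ] 𝔼} (hr : r * r = r) : IsUnit (r + star r - 1) := by
  rw [ContinuousLinearMap.isUnit_iff_bijective]
  have hinj : Function.Injective (r + star r - 1 : 𝔼 →L[ℝ] 𝔼) := by
    rw [injective_iff_map_eq_zero]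
    intro v hv
    have hv' : r v + star r v = v := by
      rw [_root_.sub_apply, _root_.add_apply, sub_eq_zero] at hv
      exact hv
    have hr' : ∀ w, r (r w) = r w := fun w => DFunLike.congr_fun hr w
    have hs' : ∀ w, star r (star r w) = star r w := fun w => by
      have := congrArg star hr
      rw [star_mul] at this
      exact DFunLike.congr_fun this w
    -- Applying `r` to `v = r v + r* v` gives `r r* v = 0`, so `‖r* v‖² = 0`; by symmetry `r v = 0`
    -- as well.
    have h1 : r (star r v) = 0 := by
      have := congrArg r hv'
      rw [map_add, hr'] at this
      simpa using this
    have h2 : star r (r v) = 0 := by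
      have := congrArg (star r : 𝔼 →L[ℝ] 𝔼) hv'
      rw [map_add, hs'] at this
      simpa using this
    have h3 : star r v = 0 := by
      have h := congrArg (fun w => inner ℝ v w) h1
      simp only [inner_zero_right] at h
      rw [← adjoint_inner_left, ← star_eq_adjoint] at h
      exact inner_self_eq_zero.1 h
    have h4 : r v = 0 := by
      have h := congrArg (fun w => inner ℝ w v) h2
      simp only [inner_zero_left] at h
      rw [star_eq_adjoint, adjoint_inner_left] at h
      exact inner_self_eq_zero.1 h
    rw [← hv', h3, h4, add_zero]
  exact ⟨hinj, (LinearMap.injective_iff_surjective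
    (f := ((r + star r - 1 : 𝔼 →L[ℝ] 𝔼) : 𝔼 →ₗ[ℝ] 𝔼))).1 hinj⟩

/-- The orthogonal projection onto the range of an idempotent. -/
lemma grEmb_eq_of_idempotent {W : Submodule ℝ 𝔼} {r : 𝔼 →L[ℝ] 𝔼} (hr : r * r = r)
    (hW : LinearMap.range (r : 𝔼 →ₗ[ℝ] 𝔼) = W) : grEmb W = r * Ring.inverse (r + star r - 1) := by
  -- Let `p` be the orthogonal projection. As `p` and `r` have the same range, `p r = r` and `r p =
  -- p`; the adjoint of the latter is `p r* = p`. Adding up, `p (r + r* - 1) = r`.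
  have hp : star (grEmb W) = grEmb W := (isSelfAdjoint_starProjection W).star_eq
  have h1 : grEmb W * r = r := by
    ext1 v
    exact grEmb_apply_eq (hW ▸ LinearMap.mem_range_self (r : 𝔼 →ₗ[ℝ] 𝔼) v)
  have h2 : r * grEmb W = grEmb W := by
    ext1 v
    obtain ⟨w, hw⟩ : grEmb W v ∈ LinearMap.range (r : 𝔼 →ₗ[ℝ] 𝔼) := hW ▸ grEmb_apply_mem W v
    change r (grEmb W v) = _
    rw [← hw]
    exact DFunLike.congr_fun hr w
  have h3 : grEmb W * star r = grEmb W := by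
    have := congrArg star h2
    rwa [star_mul, hp] at this
  have h4 : grEmb W * (r + star r - 1) = r := by
    rw [mul_sub, mul_add, h1, h3, mul_one, add_sub_cancel_right]
  rw [Ring.eq_mul_inverse_iff_mul_eq _ _ _ (isUnit_add_star_sub_one hr), h4]

lemma AnalyticNear.ringInverse {F : X → 𝔼 →L[ℝ] 𝔼} (hF : AnalyticNear eX F x₀)
    (hu : IsUnit (F x₀)) : AnalyticNear eX (fun x => Ring.inverse (F x)) x₀ := by
  obtain ⟨u, hu⟩ := hu
  exact hF.comp (hu ▸ contDiffAt_ringInverse ℝ u)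

lemma AnalyticNear.mul {F G : X → 𝔼 →L[ℝ] 𝔼} (hF : AnalyticNear eX F x₀)
    (hG : AnalyticNear eX G x₀) : AnalyticNear eX (fun x => F x * G x) x₀ := hF.clm_comp hG

lemma AnalyticNear.star {F : X → 𝔼 →L[ℝ] 𝔼} (hF : AnalyticNear eX F x₀) :
    AnalyticNear eX (fun x => star (F x)) x₀ :=
  hF.comp (G := fun r => Star.star r)
    (starL' ℝ : (𝔼 →L[ℝ] 𝔼) ≃L[ℝ] (𝔼 →L[ℝ] 𝔼)).contDiff.contDiffAt

/-- The range of an analytic family of idempotents is analytic. -/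
lemma AnalyticNear.grEmb_of_idempotent {W : X → Submodule ℝ 𝔼} {r : X → 𝔼 →L[ℝ] 𝔼}
    (hr : AnalyticNear eX r x₀)
    (hi : ∀ᶠ x in comap eX (𝓝 (eX x₀)), r x * r x = r x)
    (hW : ∀ᶠ x in comap eX (𝓝 (eX x₀)), LinearMap.range (r x : 𝔼 →ₗ[ℝ] 𝔼) = W x) :
    AnalyticNear eX (fun x => grEmb (W x)) x₀ := by
  have hs : AnalyticNear eX (fun x => r x + Star.star (r x) - 1) x₀ :=
    (hr.add hr.star).sub (.const 1)
  have h₀ : r x₀ * r x₀ = r x₀ :=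
    self_of_comap_nhds (p := fun x => r x * r x = r x) hi
  refine (hr.mul (hs.ringInverse (isUnit_add_star_sub_one h₀))).congr ?_
  filter_upwards [hi, hW] with x h1 h2 using (grEmb_eq_of_idempotent h1 h2).symm

/-- If `D` is an invertible operator then `D p D⁻¹` is an idempotent with range `D W`, where `p` is
the orthogonal projection onto `W`. -/
lemma conj_grEmb (W : Submodule ℝ 𝔼) {D D' : 𝔼 →L[ℝ] 𝔼} (h : D' * D = 1) :
    (D * grEmb W * D') * (D * grEmb W * D') = D * grEmb W * D' ∧
      LinearMap.range ((D * grEmb W * D' : 𝔼 →L[ℝ] 𝔼) : 𝔼 →ₗ[ℝ] 𝔼) =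
        W.map (D : 𝔼 →ₗ[ℝ] 𝔼) := by
  have hp : grEmb W * grEmb W = grEmb W := by
    ext1 v; exact grEmb_apply_eq (grEmb_apply_mem _ _)
  refine ⟨?_, ?_⟩
  · calc D * grEmb W * D' * (D * grEmb W * D') = D * grEmb W * (D' * D) * grEmb W * D' := by
          simp only [mul_assoc]
      _ = D * grEmb W * D' := by rw [h, mul_one, mul_assoc D, hp]
  · apply le_antisymm
    · rintro _ ⟨v, rfl⟩
      exact ⟨_, grEmb_apply_mem W (D' v), rfl⟩
    · rintro _ ⟨v, hv, rfl⟩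
      refine ⟨D v, ?_⟩
      change D (grEmb W ((D' * D) v)) = D v
      rw [h]
      exact congrArg _ (grEmb_apply_eq hv)

/-- A family of subspaces that is the range of an analytic family of linear maps is analytic. -/
lemma AnalyticNear.grEmb {W : X → Submodule ℝ 𝔼} {A : X → E' →L[ℝ] 𝔼}
    (hA : AnalyticNear eX A x₀)
    (hr : ∀ᶠ x in comap eX (𝓝 (eX x₀)), LinearMap.range (A x : E' →ₗ[ℝ] 𝔼) = W x)
    (hd : ∀ x, Module.finrank ℝ (W x) = Module.finrank ℝ (W x₀)) :
    AnalyticNear eX (fun x => SplitG2.grEmb (W x)) x₀ := by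
  obtain ⟨p₀, hp₀⟩ : ∃ p, p = SplitG2.grEmb (W x₀) := ⟨_, rfl⟩
  have hpv : ∀ v ∈ W x₀, p₀ v = v := fun v hv => by rw [hp₀]; exact grEmb_apply_eq hv
  have hpm : ∀ v, p₀ v ∈ W x₀ := fun v => by rw [hp₀]; exact grEmb_apply_mem _ _
  have hp : p₀ * p₀ = p₀ := by
    ext1 v; exact hpv _ (hpm v)
  obtain ⟨C, hC⟩ : ∃ C : 𝔼 →L[ℝ] E', A x₀ ∘L C = p₀ := by
    obtain ⟨s, hs⟩ := LinearMap.exists_rightInverse_of_surjective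
      (LinearMap.rangeRestrict (A x₀ : E' →ₗ[ℝ] 𝔼)) (LinearMap.range_rangeRestrict _)
    have hmem : ∀ v, (p₀ : 𝔼 →ₗ[ℝ] 𝔼) v ∈ LinearMap.range (A x₀ : E' →ₗ[ℝ] 𝔼) := fun v => by
      rw [self_of_comap_nhds hr]; exact hpm v
    refine ⟨LinearMap.toContinuousLinearMap (s ∘ₗ LinearMap.codRestrict _ _ hmem), ?_⟩
    ext1 v
    exact congrArg Subtype.val (LinearMap.congr_fun hs ⟨_, hmem v⟩)
  -- `D x` is `A x ∘ C` on `W x₀` and the identity on its Euclidean complement. It equals `1` at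
  -- `x₀`, so it is invertible nearby, and by constancy of the dimension it carries `W x₀` onto `W
  -- x`. Conjugating `p₀` by it gives an analytic family of idempotents.
  obtain ⟨D, hD⟩ : ∃ D : X → 𝔼 →L[ℝ] 𝔼, ∀ x, D x = (A x ∘L C) * p₀ + (1 - p₀) := ⟨_, fun _ => rfl⟩
  have hDa : AnalyticNear eX D x₀ := by
    rw [funext hD]
    exact ((hA.clm_comp (.const C)).mul (.const p₀)).add (.const _)
  have hD₀ : D x₀ = 1 := by rw [hD, hC, hp]; exact add_sub_cancel _ _
  have hDu : ∀ᶠ x in comap eX (𝓝 (eX x₀)), Ring.inverse (D x) * D x = 1 := by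
    have : ∀ᶠ x in comap eX (𝓝 (eX x₀)), IsUnit (D x) := by
      refine hDa.tendsto.eventually ?_
      rw [hD₀]
      exact Units.isOpen.mem_nhds isUnit_one
    filter_upwards [this] with x hx using Ring.inverse_mul_cancel _ hx
  have hra : AnalyticNear eX (fun x => D x * p₀ * Ring.inverse (D x)) x₀ :=
    (hDa.mul (.const p₀)).mul (hDa.ringInverse (by rw [hD₀]; exact isUnit_one))
  refine hra.grEmb_of_idempotent ?_ ?_
  · filter_upwards [hDu] with x hx
    rw [hp₀]
    exact (conj_grEmb (W x₀) hx).1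
  · filter_upwards [hDu, hr] with x hx hrx
    rw [hp₀, (conj_grEmb (W x₀) hx).2]
    have hDi : Function.Injective (D x : 𝔼 →ₗ[ℝ] 𝔼) :=
      Function.LeftInverse.injective (g := (Ring.inverse (D x) : 𝔼 →L[ℝ] 𝔼)) fun v =>
        DFunLike.congr_fun hx v
    refine Submodule.eq_of_le_of_finrank_eq ?_ ?_
    · rintro _ ⟨v, hv, rfl⟩
      have : D x v = A x (C v) := by
        rw [hD]
        change A x (C (p₀ v)) + (v - p₀ v) = _
        rw [hpv v hv, sub_self, add_zero]
      rw [← hrx]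
      exact ⟨C v, this.symm⟩
    · rw [hd x]
      exact (Submodule.equivMapOfInjective _ hDi _).finrank_eq.symm

lemma AnalyticNear.grEmb_map {m : ℕ} {W : X → Submodule ℝ (EuclideanSpace ℝ (Fin m))}
    {W' : X → Submodule ℝ 𝔼} {A : X → EuclideanSpace ℝ (Fin m) →L[ℝ] 𝔼}
    (hA : AnalyticNear eX A x₀) (hW : AnalyticNear eX (fun x => SplitG2.grEmb (W x)) x₀)
    (hr : ∀ x, W' x = (W x).map (A x : EuclideanSpace ℝ (Fin m) →ₗ[ℝ] 𝔼))
    (hd : ∀ x, Module.finrank ℝ (W' x) = Module.finrank ℝ (W' x₀)) :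
    AnalyticNear eX (fun x => SplitG2.grEmb (W' x)) x₀ := by
  refine (hA.clm_comp hW).grEmb (Eventually.of_forall fun x => ?_) hd
  rw [hr]
  exact (LinearMap.range_comp _ _).trans (congrArg _ (grEmb_range (W x)))

end AnalyticNear


/-! ### Principal bundles from local sections -/

section Bundle

open Filter Topology

variable {X Y Z E E' E'' : Type*} [NormedAddCommGroup E] [NormedSpace ℝ E]
  [NormedAddCommGroup E'] [NormedSpace ℝ E'] [NormedAddCommGroup E''] [NormedSpace ℝ E'']

lemma SmoothMap.comp {eX : X → E} {eY : Y → E'} {eZ : Z → E''} {f : X → Y} {g : Y → Z}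
    (hg : SmoothMap eY eZ g) (hf : SmoothMap eX eY f) : SmoothMap eX eZ (fun x => g (f x)) := by
  intro x
  obtain ⟨O, hO, hx, F, hF, e⟩ := hf x
  obtain ⟨O', hO', hx', G, hG, e'⟩ := hg (f x)
  refine ⟨O ∩ F ⁻¹' O', hF.continuousOn.isOpen_inter_preimage hO hO', ⟨hx, ?_⟩, G ∘ F, ?_, ?_⟩
  · rw [Set.mem_preimage, e x hx]; exact hx'
  · exact hG.comp (hF.mono Set.inter_subset_left) fun t ht => ht.2
  · rintro y ⟨h1, h2⟩
    rw [Set.mem_preimage, e y h1] at h2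
    rw [Function.comp_apply, e y h1, e' _ h2]

lemma smoothMap_of_contDiff {eX : X → E} {eY : Y → E'} {f : X → Y} {F : E → E'}
    (hF : ContDiff ℝ ∞ F) (h : ∀ x, F (eX x) = eY (f x)) : SmoothMap eX eY f :=
  fun _ => ⟨Set.univ, isOpen_univ, trivial, F, hF.contDiffOn, fun y _ => h y⟩

lemma IsDiffeo.trans {eX : X → E} {eY : Y → E'} {eZ : Z → E''} {f : X ≃ Y} {g : Y ≃ Z}
    (hf : IsDiffeo eX eY f) (hg : IsDiffeo eY eZ g) : IsDiffeo eX eZ (f.trans g) :=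
  ⟨hg.1.comp hf.1, hf.2.comp hg.2⟩

variable {F B H E₁ E₂ E₃ : Type*}
  [NormedAddCommGroup E₁] [NormedSpace ℝ E₁] [NormedAddCommGroup E₂] [NormedSpace ℝ E₂]
  [NormedAddCommGroup E₃] [NormedSpace ℝ E₃] [Group H] [MulAction H F]
  {eF : F → E₁} {eB : B → E₂} {eH : H → E₃} {π : F → B}

/-- A free action with an invariant map `π` is a principal bundle as soon as there are analytic
local sections `s`, meeting all orbits over their domain, such that the group element carrying
`s (π x)` to `x` depends analytically on `x`. -/
theorem isPrincipalBundle_of_sections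
    (hact : ∀ p, AnalyticNear (fun p : H × F => (eH p.1, eF p.2)) (fun p => eF (p.1 • p.2)) p)
    (hproj : ∀ x, AnalyticNear eF (fun x => eB (π x)) x)
    (hinv : ∀ (h : H) x, π (h • x) = π x)
    (hfree : ∀ (h : H) (x : F), h • x = x → h = 1)
    (hsec : ∀ b : B, ∃ N : Set B, b ∈ N ∧ (∃ O : Set E₂, IsOpen O ∧ N = eB ⁻¹' O) ∧
      ∃ s : N → F, (∀ c, π (s c) = c) ∧
        (∀ c, AnalyticNear (fun c : N => eB c) (fun c => eF (s c)) c) ∧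
        (∀ (x : F) (hx : π x ∈ N), ∃ h : H, h • s ⟨π x, hx⟩ = x) ∧
        ∀ x₀ : F, π x₀ ∈ N → ∃ D : F → E₃, AnalyticNear eF D x₀ ∧
          ∀ᶠ x in comap eF (𝓝 (eF x₀)), ∀ (hx : π x ∈ N) (h : H),
            h • s ⟨π x, hx⟩ = x → D x = eH h) :
    IsPrincipalBundle eF eB eH π := by
  have hsurj : Function.Surjective π := fun b => by
    obtain ⟨N, hb, -, s, hs, -⟩ := hsec b
    exact ⟨s ⟨b, hb⟩, hs _⟩
  refine ⟨smoothMap_of_analyticNear hact, smoothMap_of_analyticNear hproj, hsurj, ?_, hfree, ?_⟩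
  · intro x y
    constructor
    · intro hxy
      obtain ⟨N, hb, -, s, hs, -, ht, -⟩ := hsec (π x)
      obtain ⟨h, hh⟩ := ht x hb
      obtain ⟨k, hk⟩ := ht y (hxy ▸ hb)
      refine ⟨k * h⁻¹, ?_⟩
      rw [mul_smul, inv_smul_eq_iff.2 hh.symm, ← hk]
      congr 2
      exact Subtype.ext hxy
    · rintro ⟨h, rfl⟩
      exact (hinv h x).symm
  · intro b
    obtain ⟨N, hb, hN, s, hs, hsa, ht, hd⟩ := hsec b
    choose δ hδ using ht
    refine ⟨N, hb, hN, ?_⟩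
    -- The trivialization is `(c, h) ↦ h • s c`. Freeness makes `δ` the group coordinate of its
    -- inverse, and the maps `D` are local analytic expressions for `δ`.
    let Φ : N × H ≃ π ⁻¹' N :=
      { toFun := fun p => ⟨p.2 • s p.1, by
          rw [Set.mem_preimage, hinv, hs]; exact p.1.2⟩
        invFun := fun x => (⟨π x, x.2⟩, δ x x.2)
        left_inv := fun p => by
          have h1 : π (p.2 • s p.1) = p.1 := by rw [hinv, hs]
          refine Prod.ext (Subtype.ext h1) ?_
          have h2 : π (p.2 • s p.1) ∈ N := by rw [h1]; exact p.1.2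
          have h3 := hδ (p.2 • s p.1) h2
          have h4 : (⟨π (p.2 • s p.1), h2⟩ : N) = p.1 := Subtype.ext h1
          rw [h4] at h3
          have h5 := hfree (p.2⁻¹ * δ (p.2 • s p.1) h2) (s p.1) (by
            rw [mul_smul, h3, inv_smul_smul])
          exact (inv_mul_eq_one.1 h5).symm
        right_inv := fun x => Subtype.ext (hδ x x.2) }
    refine ⟨Φ, fun p => ?_, fun c h k => mul_smul h k (s c), ?_, ?_⟩
    · change π (p.2 • s p.1) = p.1
      rw [hinv, hs]
    · refine smoothMap_of_analyticNear fun p => ?_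
      have h1 : AnalyticNear (fun p : N × H => (eB p.1, eH p.2)) (fun p => eB p.1) p :=
        AnalyticNear.of_contDiffAt (F := Prod.fst) contDiffAt_fst
      have h2 : AnalyticNear (fun p : N × H => (eB p.1, eH p.2)) (fun p => eH p.2) p :=
        AnalyticNear.of_contDiffAt (F := Prod.snd) contDiffAt_snd
      have h3 := AnalyticNear.comp_map (f := fun p : N × H => p.1) (hsa p.1) h1
      exact AnalyticNear.comp_map (f := fun p : N × H => (p.2, s p.1)) (hact (p.2, s p.1))
        (h2.prodMk h3)
    · refine smoothMap_of_analyticNear fun x => ?_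
      have hval : AnalyticNear (fun x : π ⁻¹' N => eF x) (fun x => eF x) x := AnalyticNear.emb
      refine (AnalyticNear.comp_map (f := fun x : π ⁻¹' N => (x : F)) (hproj x) hval).prodMk ?_
      obtain ⟨D, hD, he⟩ := hd x x.2
      have ht : Tendsto (fun x : π ⁻¹' N => (x : F))
          (comap (fun x : π ⁻¹' N => eF x) (𝓝 (eF x))) (comap eF (𝓝 (eF x))) :=
        tendsto_comap_iff.2 tendsto_comap
      refine (AnalyticNear.comp_map (f := fun x : π ⁻¹' N => (x : F)) hD hval).congr ?_
      filter_upwards [ht.eventually he] with y hy using hy y.2 _ (hδ y y.2)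

/-- Every fiber of a principal bundle is diffeomorphic to the structure group. -/
theorem IsPrincipalBundle.exists_fiber_diffeo (hb : IsPrincipalBundle eF eB eH π) (b : B) :
    ∃ f : H ≃ π ⁻¹' {b}, IsDiffeo eH (fun x : π ⁻¹' {b} => eF x) f := by
  obtain ⟨N, hN, -, Φ, hΦ, -, h1, h2⟩ := hb.locally_trivial b
  let c : N := ⟨b, hN⟩
  have hsymm : ∀ x : π ⁻¹' N, ((Φ.symm x).1 : B) = π x := fun x => by
    rw [← hΦ, Φ.apply_symm_apply]
  have hmem : ∀ x : π ⁻¹' {b}, π x ∈ N := fun x => by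
    have : π x = b := x.2
    rw [this]; exact hN
  let f : H ≃ π ⁻¹' {b} :=
    { toFun := fun h => ⟨Φ (c, h), hΦ (c, h)⟩
      invFun := fun x => (Φ.symm ⟨x, hmem x⟩).2
      left_inv := fun h => by
        change (Φ.symm (Φ (c, h))).2 = h
        rw [Φ.symm_apply_apply]
      right_inv := fun x => by
        refine Subtype.ext ?_
        have : (c, (Φ.symm ⟨x, hmem x⟩).2) = Φ.symm ⟨x, hmem x⟩ :=
          Prod.ext (Subtype.ext ((hsymm ⟨x, hmem x⟩).trans x.2).symm) rfl
        change (Φ (c, (Φ.symm ⟨x, hmem x⟩).2) : F) = x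
        rw [this, Φ.apply_symm_apply] }
  refine ⟨f, ?_, ?_⟩
  · have hi : SmoothMap eH (fun p : N × H => (eB p.1, eH p.2)) (fun h => (c, h)) :=
      smoothMap_of_contDiff (F := fun t => (eB b, t)) (contDiff_const.prodMk contDiff_id)
        fun _ => rfl
    exact h1.comp hi
  · have hi : SmoothMap (fun x : π ⁻¹' {b} => eF x) (fun x : π ⁻¹' N => eF x)
        (fun x => ⟨x, hmem x⟩) := smoothMap_of_contDiff (F := id) contDiff_id fun _ => rfl
    have hs : SmoothMap (fun p : N × H => (eB p.1, eH p.2)) eH Prod.snd :=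
      smoothMap_of_contDiff (F := Prod.snd) contDiff_snd fun _ => rfl
    exact hs.comp (h2.comp hi)

end Bundle

/-! ### The unit quaternions -/

lemma mem_unitary_quaternion_iff (a : ℍ[ℝ]) : a ∈ unitary ℍ[ℝ] ↔ ‖a‖ = 1 := by
  rw [Unitary.mem_iff, Quaternion.star_mul_self, Quaternion.self_mul_star,
    Quaternion.normSq_eq_norm_mul_self, and_self]
  constructor
  · intro h
    have h1 : ‖a‖ * ‖a‖ = 1 := Quaternion.coe_injective (h.trans Quaternion.coe_one.symm)
    nlinarith [norm_nonneg a]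
  · intro h
    rw [h]; simp

/-- The unit quaternions are the unit sphere of `ℝ⁴`. -/
lemma exists_sphere_diffeo_unitary :
    ∃ f : Metric.sphere (0 : EuclideanSpace ℝ (Fin 4)) 1 ≃ unitary ℍ[ℝ],
      IsDiffeo (fun x : Metric.sphere (0 : EuclideanSpace ℝ (Fin 4)) 1 => x.1)
        (fun a : unitary ℍ[ℝ] => a.1) f := by
  let e := Quaternion.linearIsometryEquivTuple
  refine ⟨e.symm.toEquiv.subtypeEquiv fun x => ?_, ?_, ?_⟩
  · rw [mem_unitary_quaternion_iff, mem_sphere_zero_iff_norm]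
    exact (e.symm.norm_map x).symm ▸ Iff.rfl
  · exact smoothMap_of_contDiff (F := e.symm) e.symm.contDiff fun _ => rfl
  · exact smoothMap_of_contDiff (F := e) e.contDiff fun _ => rfl

/-- The fibers of a principal bundle whose structure group is the group of unit quaternions are
3-spheres. -/
theorem IsPrincipalBundle.isThreeSphere {F B H E₁ E₂ E₃ : Type*}
    [NormedAddCommGroup E₁] [NormedSpace ℝ E₁] [NormedAddCommGroup E₂] [NormedSpace ℝ E₂]
    [NormedAddCommGroup E₃] [NormedSpace ℝ E₃] [Group H] [MulAction H F]
    {eF : F → E₁} {eB : B → E₂} {eH : H → E₃} {π : F → B}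
    (hb : IsPrincipalBundle eF eB eH π)
    (hH : ∃ φ : unitary ℍ[ℝ] ≃* H, IsDiffeo (fun a : unitary ℍ[ℝ] => a.1) eH φ.toEquiv) (b : B) :
    IsThreeSphere eF (π ⁻¹' {b}) := by
  obtain ⟨f, hf⟩ := hb.exists_fiber_diffeo b
  obtain ⟨φ, hφ⟩ := hH
  obtain ⟨k, hk⟩ := exists_sphere_diffeo_unitary
  exact ⟨k.trans (φ.toEquiv.trans f), hk.trans (hφ.trans hf)⟩


/-! ### The geometry of a point of the symmetric space -/

/-- Rescaling a positive vector to length one. -/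
lemma exists_smul_q_eq_one {v : V} (hv : 0 < q v v) : ∃ c : ℝ, c ≠ 0 ∧ q (c • v) (c • v) = 1 := by
  refine ⟨(√(q v v))⁻¹, inv_ne_zero (Real.sqrt_ne_zero'.2 hv), ?_⟩
  simp only [map_smul, LinearMap.smul_apply, smul_eq_mul]
  rw [← mul_assoc, ← mul_inv, Real.mul_self_sqrt hv.le, inv_mul_cancel₀ hv.ne']

lemma exists_smul_q_eq_neg_one {v : V} (hv : q v v < 0) :
    ∃ c : ℝ, c ≠ 0 ∧ q (c • v) (c • v) = -1 := by
  have hv' : 0 < -q v v := by linarith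
  refine ⟨(√(-q v v))⁻¹, inv_ne_zero (Real.sqrt_ne_zero'.2 hv'), ?_⟩
  simp only [map_smul, LinearMap.smul_apply, smul_eq_mul]
  rw [← mul_assoc, ← mul_inv, Real.mul_self_sqrt hv'.le, inv_neg, neg_mul, inv_mul_cancel₀]
  linarith

lemma q_neg_of_coords {w : V} (e0 : w 0 = 0) (e1 : w 1 = 0) (e2 : w 2 = 0) (hw : w ≠ 0) :
    q w w < 0 := by
  rw [q_apply, e0, e1, e2]
  by_contra hle
  have h3 := mul_self_nonneg (w 3)
  have h4 := mul_self_nonneg (w 4)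
  have h5 := mul_self_nonneg (w 5)
  have h6 := mul_self_nonneg (w 6)
  have e3 : w 3 = 0 := mul_self_eq_zero.1 (by linarith)
  have e4 : w 4 = 0 := mul_self_eq_zero.1 (by linarith)
  have e5 : w 5 = 0 := mul_self_eq_zero.1 (by linarith)
  have e6 : w 6 = 0 := mul_self_eq_zero.1 (by linarith)
  apply hw
  ext i; fin_cases i <;> simp [e0, e1, e2, e3, e4, e5, e6]

namespace SymSpace

variable {P : SymSpace}

lemma q_eq_zero {x v : V} (hx : x ∈ P.1) (hv : v ∈ P.perp) : q x v = 0 := hv x hx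

lemma q_eq_zero' {x v : V} (hx : x ∈ P.1) (hv : v ∈ P.perp) : q v x = 0 := by
  rw [q_comm]; exact hv x hx

lemma cross_mem {x y : V} (hx : x ∈ P.1) (hy : y ∈ P.1) : cross x y ∈ P.1 := by
  rw [← P.2.2.2]
  exact Submodule.apply_mem_map₂ cross hx hy

/-- Multiplication by `x` is skew for `q` and preserves `P`, hence preserves `P^⊥`. -/
lemma cross_mem_perp {x v : V} (hx : x ∈ P.1) (hv : v ∈ P.perp) : cross x v ∈ P.perp := by
  intro y hy
  change q y (cross x v) = 0
  rw [q_comm, q_cross_left_eq, q_eq_zero' (cross_mem hx hy) hv, neg_zero]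

lemma cross_mem_perp' {x v : V} (hx : x ∈ P.1) (hv : v ∈ P.perp) : cross v x ∈ P.perp := by
  rw [cross_swap]
  exact P.perp.neg_mem (cross_mem_perp hx hv)

lemma eq_zero_of_mem {v : V} (h : v ∈ P.1) (h' : v ∈ P.perp) : v = 0 :=
  Submodule.disjoint_def.1 P.isCompl.disjoint v h h'

lemma proj_mem (v : V) : P.proj v ∈ P.1 := Submodule.projection_apply_mem _ v

lemma sub_proj_mem (v : V) : v - P.proj v ∈ P.perp := Submodule.sub_projection_mem _ v

lemma proj_add {x v : V} (hx : x ∈ P.1) (hv : v ∈ P.perp) : P.proj (x + v) = x := by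
  have h1 : P.proj x = x := Submodule.projection_apply_of_mem_left _ hx
  have h2 : P.proj v = 0 := (Submodule.projection_apply_eq_zero_iff _).2 hv
  rw [map_add, h1, h2, add_zero]

/-- Components of a sum. -/
lemma add_eq_add {x x' v v' : V} (hx : x ∈ P.1) (hx' : x' ∈ P.1) (hv : v ∈ P.perp)
    (hv' : v' ∈ P.perp) (h : x + v = x' + v') : x = x' ∧ v = v' := by
  have h1 : x = x' := by rw [← proj_add hx hv, h, proj_add hx' hv']
  exact ⟨h1, by rw [h1] at h; exact add_left_cancel h⟩

/-- An element of `G₂'` carrying `Im ℍ ⊕ 0` to `P` and `0 ⊕ ℍ` to `P^⊥`. -/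
def Adapted (P : SymSpace) (g : G2) : Prop :=
  (∀ v, lin g v ∈ P.1 ↔ v 3 = 0 ∧ v 4 = 0 ∧ v 5 = 0 ∧ v 6 = 0) ∧
    ∀ v, lin g v ∈ P.perp ↔ v 0 = 0 ∧ v 1 = 0 ∧ v 2 = 0

lemma isTriad {x y z : V} (hx : x ∈ P.1) (hy : y ∈ P.1) (hz : z ∈ P.perp) (xx : q x x = 1)
    (yy : q y y = 1) (xy : q x y = 0) (zz : q z z = -1) : IsTriad x y z :=
  ⟨xx, yy, zz, xy, q_eq_zero hx hz, q_eq_zero hy hz, q_eq_zero (cross_mem hx hy) hz⟩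

/-- The frame sends `Im ℍ ⊕ 0` into `P` and `0 ⊕ ℍ` into `P^⊥`. Since it is injective and `P` meets
`P^⊥` trivially, a vector lands in one summand only if its component in the other factor vanishes.
-/
lemma adapted_frame {x y z : V} (h : IsTriad x y z) (hx : x ∈ P.1) (hy : y ∈ P.1)
    (hz : z ∈ P.perp) : P.Adapted h.frame := by
  have hc := cross_mem hx hy
  let a : V → V := fun v => !₂[v 0, v 1, v 2, 0, 0, 0, 0]
  let b : V → V := fun v => !₂[0, 0, 0, v 3, v 4, v 5, v 6]
  have hab : ∀ v, v = a v + b v := fun v => by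
    ext i; fin_cases i <;> simp [a, b]
  have ha : ∀ v, lin h.frame (a v) ∈ P.1 := fun v => by
    rw [h.lin_frame, frameMap_apply]
    have : v 0 • x + v 1 • y + v 2 • cross x y ∈ P.1 := P.1.add_mem
      (P.1.add_mem (P.1.smul_mem _ hx) (P.1.smul_mem _ hy)) (P.1.smul_mem _ hc)
    simpa [a] using this
  have hb : ∀ v, lin h.frame (b v) ∈ P.perp := fun v => by
    rw [h.lin_frame, frameMap_apply]
    have : v 3 • z - v 4 • cross x z - v 5 • cross y z - v 6 • cross (cross x y) z ∈ P.perp :=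
      P.perp.sub_mem (P.perp.sub_mem (P.perp.sub_mem (P.perp.smul_mem _ hz)
        (P.perp.smul_mem _ (cross_mem_perp hx hz))) (P.perp.smul_mem _ (cross_mem_perp hy hz)))
        (P.perp.smul_mem _ (cross_mem_perp hc hz))
    simpa [b] using this
  constructor
  · intro v
    constructor
    · intro hv
      have h1 : lin h.frame (b v) = 0 := by
        refine eq_zero_of_mem ?_ (hb v)
        have : lin h.frame (b v) = lin h.frame v - lin h.frame (a v) := by
          rw [← map_sub]; congr 1; exact eq_sub_of_add_eq' (hab v).symm
        rw [this]
        exact P.1.sub_mem hv (ha v)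
      have h2 : b v = 0 := lin_injective h.frame (by rw [h1, map_zero])
      exact ⟨by simpa [b] using congrArg (fun w : V => w 3) h2,
        by simpa [b] using congrArg (fun w : V => w 4) h2,
        by simpa [b] using congrArg (fun w : V => w 5) h2,
        by simpa [b] using congrArg (fun w : V => w 6) h2⟩
    · rintro ⟨h3, h4, h5, h6⟩
      have : b v = 0 := by ext i; fin_cases i <;> simp [b, h3, h4, h5, h6]
      rw [hab v, this, add_zero]
      exact ha v
  · intro v
    constructor
    · intro hv
      have h1 : lin h.frame (a v) = 0 := by
        refine eq_zero_of_mem (ha v) ?_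
        have : lin h.frame (a v) = lin h.frame v - lin h.frame (b v) := by
          rw [← map_sub]; congr 1; exact eq_sub_of_add_eq (hab v).symm
        rw [this]
        exact P.perp.sub_mem hv (hb v)
      have h2 : a v = 0 := lin_injective h.frame (by rw [h1, map_zero])
      exact ⟨by simpa [a] using congrArg (fun w : V => w 0) h2,
        by simpa [a] using congrArg (fun w : V => w 1) h2,
        by simpa [a] using congrArg (fun w : V => w 2) h2⟩
    · rintro ⟨h0, h1, h2⟩
      have : a v = 0 := by ext i; fin_cases i <;> simp [a, h0, h1, h2]
      rw [hab v, this, zero_add]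
      exact hb v

/-- A unit vector of a subspace of `P` of dimension at least two has an orthogonal partner. -/
lemma exists_orthogonal {U : Submodule ℝ V} (hU : U ≤ P.1) (hd : 1 < Module.finrank ℝ U) {a : V}
    (ha : a ∈ U) (haa : q a a = 1) : ∃ c ∈ U, q c c = 1 ∧ q a c = 0 := by
  obtain ⟨v, hv, hva⟩ : ∃ v ∈ U, v ∉ Submodule.span ℝ {a} := by
    by_contra! hall
    have h1 : Module.finrank ℝ U ≤ Module.finrank ℝ (Submodule.span ℝ {a}) :=
      Submodule.finrank_mono hall
    have h2 := finrank_span_le_card (R := ℝ) ({a} : Set V)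
    simp at h2
    omega
  set w := v - q a v • a with hw
  have hwU : w ∈ U := U.sub_mem hv (U.smul_mem _ ha)
  have hw0 : w ≠ 0 := fun h0 => hva (by
    rw [sub_eq_zero] at h0
    rw [h0]; exact Submodule.smul_mem _ _ (Submodule.mem_span_singleton_self a))
  obtain ⟨c, -, hc⟩ := exists_smul_q_eq_one (P.2.2.1 w (hU hwU) hw0)
  refine ⟨c • w, U.smul_mem _ hwU, hc, ?_⟩
  simp [hw, haa]

lemma exists_unit {U : Submodule ℝ V} (hU : U ≤ P.1) (hd : 0 < Module.finrank ℝ U) :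
    ∃ a ∈ U, q a a = 1 := by
  have : U ≠ ⊥ := fun h => by rw [h, finrank_bot] at hd; exact lt_irrefl _ hd
  obtain ⟨v, hv, hv0⟩ := U.exists_mem_ne_zero_of_ne_bot this
  obtain ⟨c, -, hc⟩ := exists_smul_q_eq_one (P.2.2.1 v (hU hv) hv0)
  exact ⟨c • v, U.smul_mem _ hv, hc⟩

variable (P) in
-- Orthogonality to `P` and the vanishing of the three positive coordinates are six linear
-- conditions on a 7-dimensional space. A nonzero solution is negative and can be rescaled.
lemma exists_mem_perp : ∃ z ∈ P.perp, q z z = -1 := by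
  let L : V →ₗ[ℝ] (Fin 3 → ℝ) × (P.1 →ₗ[ℝ] ℝ) :=
    (LinearMap.pi fun i : Fin 3 => (EuclideanSpace.proj (Fin.castLE (by norm_num) i) :
      V →L[ℝ] ℝ).toLinearMap).prod ((LinearMap.lcomp ℝ ℝ P.1.subtype) ∘ₗ q)
  have hL : LinearMap.ker L ≠ ⊥ := by
    apply LinearMap.ker_ne_bot_of_finrank_lt
    rw [Module.finrank_prod, Module.finrank_linearMap, P.2.1]
    simp
  obtain ⟨w, hw, hw0⟩ := Submodule.exists_mem_ne_zero_of_ne_bot hL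
  have h1 := congrArg Prod.fst (LinearMap.mem_ker.1 hw)
  have h2 := congrArg Prod.snd (LinearMap.mem_ker.1 hw)
  have e0 : w 0 = 0 := congrFun h1 0
  have e1 : w 1 = 0 := congrFun h1 1
  have e2 : w 2 = 0 := congrFun h1 2
  have hwp : w ∈ P.perp := fun x hx => by
    have h3 := LinearMap.congr_fun h2 ⟨x, hx⟩
    change q x w = 0
    rw [q_comm]; exact h3
  obtain ⟨c, -, hc⟩ := exists_smul_q_eq_neg_one (q_neg_of_coords e0 e1 e2 hw0)
  exact ⟨c • w, P.perp.smul_mem _ hwp, hc⟩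

variable (P) in
lemma exists_orthonormal_pair : ∃ x ∈ P.1, ∃ y ∈ P.1, q x x = 1 ∧ q y y = 1 ∧ q x y = 0 := by
  obtain ⟨x, hx, xx⟩ := exists_unit (P := P) le_rfl (by rw [P.2.1]; norm_num)
  obtain ⟨y, hy, yy, xy⟩ := exists_orthogonal (P := P) le_rfl (by rw [P.2.1]; norm_num) hx xx
  exact ⟨x, hx, y, hy, xx, yy, xy⟩

variable (P) in
lemma exists_adapted : ∃ g, P.Adapted g := by
  obtain ⟨x, hx, y, hy, xx, yy, xy⟩ := P.exists_orthonormal_pair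
  obtain ⟨z, hz, zz⟩ := P.exists_mem_perp
  exact ⟨_, adapted_frame (isTriad hx hy hz xx yy xy zz) hx hy hz⟩

/-- An adapted element of `G₂'` identifies `P^⊥` with `0 ⊕ ℍ`, where `q` is minus the Euclidean
form. -/
lemma q_neg {v : V} (hv : v ∈ P.perp) (h0 : v ≠ 0) : q v v < 0 := by
  obtain ⟨g, -, hg⟩ := P.exists_adapted
  obtain ⟨w, rfl⟩ : ∃ w, lin g w = v := ⟨_, lin_apply_inv g v⟩
  obtain ⟨e0, e1, e2⟩ := (hg w).1 hv
  rw [q_lin]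
  exact q_neg_of_coords e0 e1 e2 fun h => h0 (by rw [h, map_zero])

/-- In adapted coordinates, `(0, b)(0, d) = (d b*, 0)`. -/
lemma cross_mem_of_perp {v w : V} (hv : v ∈ P.perp) (hw : w ∈ P.perp) : cross v w ∈ P.1 := by
  obtain ⟨g, hg1, hg⟩ := P.exists_adapted
  obtain ⟨v, rfl⟩ : ∃ w, lin g w = v := ⟨_, lin_apply_inv g v⟩
  obtain ⟨w, rfl⟩ : ∃ w', lin g w' = w := ⟨_, lin_apply_inv g w⟩
  obtain ⟨e0, e1, e2⟩ := (hg v).1 hv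
  obtain ⟨f0, f1, f2⟩ := (hg w).1 hw
  rw [← lin_cross, hg1, cross_apply, crossFun_eq]
  simp [e0, e1, e2, f0, f1, f2]

/-! ### The stabilizer `H_P` -/

lemma lin_mem_perp (h : P.H) {v : V} (hv : v ∈ P.perp) : lin h.1 v ∈ P.perp := by
  intro x hx
  change q x _ = 0
  rw [← h.2 x hx, q_lin, q_eq_zero hx hv]

lemma hEmb_injective : Function.Injective P.hEmb := fun _ _ e =>
  Subtype.ext (lin_ext fun v => DFunLike.congr_fun e v)

/-- Given a unit vector `z` of `P^⊥`, the action of `h ∈ H_P` is an analytic function of `h z`, and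
`h z` can be any unit vector. -/
lemma exists_transport {z : V} (hz : z ∈ P.perp) (zz : q z z = -1) :
    ∃ T : V → V →L[ℝ] V, ContDiff ℝ ω T ∧ (∀ h : P.H, T (lin h.1 z) = P.hEmb h) ∧
      ∀ b ∈ P.perp, q b b = -1 → ∃ h : P.H, lin h.1 z = b := by
  obtain ⟨x, hx, y, hy, xx, yy, xy⟩ := P.exists_orthonormal_pair
  have ht := isTriad hx hy hz xx yy xy zz
  have e3 : ∀ b, frameMap x y b (EuclideanSpace.single 3 1) = b := fun b => by
    simp [frameMap_apply]
  have hfi : lin ht.frame⁻¹ z = EuclideanSpace.single 3 1 := by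
    have h := lin_inv_apply ht.frame (EuclideanSpace.single 3 1)
    rwa [ht.lin_frame, e3] at h
  -- `T b` is the frame of `(x, y, b)` after the inverse frame of `(x, y, z)`. Since `h ∈ H_P` fixes
  -- `x` and `y`, it carries the frame of `(x, y, z)` to that of `(x, y, h z)`; hence `T (h z) = h`.
  let T : V → V →L[ℝ] V := fun b =>
    frameMap x y b ∘L (((ht.frame⁻¹ : G2) : (V →L[ℝ] V)ˣ) : V →L[ℝ] V)
  refine ⟨T, (contDiff_frameMap x y).clm_comp contDiff_const, fun h => ?_, fun b hb bb => ?_⟩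
  · ext1 v
    change frameMap x y (lin h.1 z) (lin ht.frame⁻¹ v) = lin h.1 v
    nth_rw 2 [← lin_apply_inv ht.frame v]
    rw [ht.lin_frame, lin_frameMap, h.2 x hx, h.2 y hy]
  · have ht' := isTriad hx hy hb xx yy xy bb
    have had := adapted_frame ht hx hy hz
    refine ⟨⟨ht'.frame * ht.frame⁻¹, fun p hp => ?_⟩, ?_⟩
    · rw [lin_mul, LinearMap.comp_apply]
      obtain ⟨w, rfl⟩ : ∃ w, lin ht.frame w = p := ⟨_, lin_apply_inv _ p⟩
      obtain ⟨h3, h4, h5, h6⟩ := (had.1 w).1 hp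
      rw [lin_inv_apply, ht.lin_frame, ht'.lin_frame, frameMap_apply, frameMap_apply, h3, h4, h5,
        h6]
      simp
    · change lin (ht'.frame * ht.frame⁻¹) z = b
      rw [lin_mul, LinearMap.comp_apply, hfi, ht'.lin_frame, e3]

lemma exists_H_apply_eq {b b' : V} (hb : b ∈ P.perp) (hb' : b' ∈ P.perp) (bb : q b b = -1)
    (bb' : q b' b' = -1) : ∃ h : P.H, lin h.1 b = b' := by
  obtain ⟨T, -, -, hT⟩ := P.exists_transport hb bb
  exact hT b' hb' bb'

lemma H_ext {b : V} (hb : b ∈ P.perp) (bb : q b b = -1) {h k : P.H}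
    (e : lin h.1 b = lin k.1 b) : h = k := by
  obtain ⟨T, -, hT, -⟩ := P.exists_transport hb bb
  exact hEmb_injective (by rw [← hT h, ← hT k, e])

lemma H_eq_one {b : V} (hb : b ∈ P.perp) (bb : q b b = -1) {h : P.H}
    (e : lin h.1 b = b) : h = 1 := H_ext hb bb e

end SymSpace

/-! ### `H_P` is the group of unit quaternions -/

/-- The right multiplication `(a, b) ↦ (a, b c*)`. -/
def rightMul (c : ℍ[ℝ]) (v : V) : V :=
  !₂[v 0, v 1, v 2, (sndQ v * star c).re, (sndQ v * star c).imI, (sndQ v * star c).imJ,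
    (sndQ v * star c).imK]

lemma fstQ_rightMul (c : ℍ[ℝ]) (v : V) : fstQ (rightMul c v) = fstQ v := by
  ext <;> simp [rightMul]

lemma sndQ_rightMul (c : ℍ[ℝ]) (v : V) : sndQ (rightMul c v) = sndQ v * star c := by
  ext <;> simp [rightMul, sndQ]

lemma fstQ_sndQ_ext {v w : V} (h : fstQ v = fstQ w) (h' : sndQ v = sndQ w) : v = w := by
  ext i
  fin_cases i
  · exact congrArg QuaternionAlgebra.imI h
  · exact congrArg QuaternionAlgebra.imJ h
  · exact congrArg QuaternionAlgebra.imK h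
  · exact congrArg QuaternionAlgebra.re h'
  · exact congrArg QuaternionAlgebra.imI h'
  · exact congrArg QuaternionAlgebra.imJ h'
  · exact congrArg QuaternionAlgebra.imK h'

lemma rightMul_rightMul (c d : ℍ[ℝ]) (v : V) :
    rightMul c (rightMul d v) = rightMul (c * d) v :=
  fstQ_sndQ_ext (by simp only [fstQ_rightMul])
    (by simp only [sndQ_rightMul, star_mul, mul_assoc])

lemma rightMul_one (v : V) : rightMul 1 v = v :=
  fstQ_sndQ_ext (by simp only [fstQ_rightMul]) (by simp only [sndQ_rightMul, star_one, mul_one])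

/-- Multiplying both second components on the right by `c*` leaves `d b*` unchanged because `c* c =
1`, and `c*` factors out of the second component of the product on the right. -/
lemma rightMul_cross {c : ℍ[ℝ]} (hc : star c * c = 1) (v w : V) :
    rightMul c (cross v w) = cross (rightMul c v) (rightMul c w) := by
  have h1 : sndQ w * star c * star (sndQ v * star c) = sndQ w * star (sndQ v) := by
    rw [star_mul, star_star, mul_assoc, ← mul_assoc (star c), hc, one_mul]
  have h2 : star (fstQ v) * (sndQ w * star c) + fstQ w * (sndQ v * star c) =
      (star (fstQ v) * sndQ w + fstQ w * sndQ v) * star c := by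
    rw [add_mul, mul_assoc, mul_assoc]
  apply fstQ_sndQ_ext
  · rw [fstQ_rightMul]
    ext <;> simp only [cross_apply, crossFun, mulFst, fstQ_rightMul, sndQ_rightMul, h1] <;> simp
  · rw [sndQ_rightMul]
    have h3 : ∀ v w, sndQ (cross v w) = star (fstQ v) * sndQ w + fstQ w * sndQ v := fun v w => by
      ext <;> simp [cross_apply, crossFun, mulSnd]
    rw [h3, h3, fstQ_rightMul, fstQ_rightMul, sndQ_rightMul, sndQ_rightMul, h2]

/-- Right multiplication as a bilinear map. -/
def rightMulL : ℍ[ℝ] →ₗ[ℝ] V →ₗ[ℝ] V :=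
  -- Keeping the first component makes `rightMul` only affine in `c`; subtracting its value at `c =
  -- 0` leaves a bilinear map.
  LinearMap.mk₂ ℝ (fun c v => rightMul c v - rightMul 0 v)
    (fun c d v => by ext i; fin_cases i <;> simp [rightMul] <;> ring)
    (fun r c v => by ext i; fin_cases i <;> simp [rightMul])
    (fun c v w => by ext i; fin_cases i <;> simp [rightMul] <;> ring)
    (fun r c v => by ext i; fin_cases i <;> simp [rightMul] <;> ring)

/-- The first component of a split octonion. -/
def rightMulZeroL : V →ₗ[ℝ] V where
  toFun := rightMul 0
  map_add' v w := by ext i; fin_cases i <;> simp [rightMul]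
  map_smul' c w := by ext i; fin_cases i <;> simp [rightMul]

/-- Right multiplication as a continuous linear map depending on a quaternion. -/
def rightMulCLM (c : ℍ[ℝ]) : V →L[ℝ] V :=
  rightMulL.toContinuousBilinearMap c + LinearMap.toContinuousLinearMap rightMulZeroL

lemma rightMulCLM_apply (c : ℍ[ℝ]) (v : V) : rightMulCLM c v = rightMul c v :=
  sub_add_cancel _ _

lemma contDiff_rightMulCLM : ContDiff ℝ ∞ rightMulCLM :=
  rightMulL.toContinuousBilinearMap.contDiff.add contDiff_const

/-- Right multiplication by a unit quaternion as an element of `G₂'`. -/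
def rightMulG2 : unitary ℍ[ℝ] →* G2 where
  toFun c := ⟨⟨rightMulCLM c, rightMulCLM ↑(c⁻¹),
    by ext1 v
       change rightMulCLM c (rightMulCLM ↑(c⁻¹) v) = v
       rw [rightMulCLM_apply, rightMulCLM_apply, rightMul_rightMul, ← Submonoid.coe_mul,
         mul_inv_cancel, Submonoid.coe_one, rightMul_one],
    by ext1 v
       change rightMulCLM ↑(c⁻¹) (rightMulCLM c v) = v
       rw [rightMulCLM_apply, rightMulCLM_apply, rightMul_rightMul, ← Submonoid.coe_mul,
         inv_mul_cancel, Submonoid.coe_one, rightMul_one]⟩,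
    fun v w => by
      change rightMulCLM c _ = cross (rightMulCLM c v) (rightMulCLM c w)
      simp only [rightMulCLM_apply]
      exact rightMul_cross (Unitary.star_mul_self_of_mem c.2) v w⟩
  map_one' := lin_ext fun v => (rightMulCLM_apply 1 v).trans (rightMul_one v)
  map_mul' c d := lin_ext fun v => by
    change rightMulCLM ↑(c * d) v = rightMulCLM c (rightMulCLM d v)
    simp only [rightMulCLM_apply]
    exact (rightMul_rightMul _ _ _).symm

lemma lin_rightMulG2 (c : unitary ℍ[ℝ]) (v : V) : lin (rightMulG2 c) v = rightMul c v :=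
  rightMulCLM_apply c v

/-- The conjugate of the second component as a linear map. -/
def starSndQL : V →ₗ[ℝ] ℍ[ℝ] where
  toFun v := star (sndQ v)
  map_add' v w := by ext <;> simp <;> ring
  map_smul' c w := by ext <;> simp

namespace SymSpace

/-- The stabilizer `H_P` is diffeomorphically isomorphic to the group of unit quaternions. -/
theorem exists_unitary_mulEquiv (P : SymSpace) :
    ∃ φ : unitary ℍ[ℝ] ≃* P.H, IsDiffeo (fun a : unitary ℍ[ℝ] => a.1) P.hEmb φ.toEquiv := by
  obtain ⟨g, hg⟩ := P.exists_adapted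
  let e : V := EuclideanSpace.single 3 1
  have hz : lin g e ∈ P.perp := (hg.2 e).2 (by simp [e])
  have zz : q (lin g e) (lin g e) = -1 := by rw [q_lin, q_apply]; simp [e]
  -- Right multiplications fix `Im ℍ ⊕ 0`, so their conjugates by the adapted element `g` fix `P`.
  let ψ : unitary ℍ[ℝ] →* P.H :=
    { toFun := fun c => ⟨g * rightMulG2 c * g⁻¹, fun x hx => by
        rw [lin_mul, lin_mul, LinearMap.comp_apply, LinearMap.comp_apply]
        obtain ⟨w, rfl⟩ : ∃ w, lin g w = x := ⟨_, lin_apply_inv g x⟩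
        obtain ⟨h3, h4, h5, h6⟩ := (hg.1 w).1 hx
        rw [lin_inv_apply, lin_rightMulG2]
        congr 1
        refine fstQ_sndQ_ext (fstQ_rightMul _ _) ?_
        have : sndQ w = 0 := by ext <;> simp [h3, h4, h5, h6]
        rw [sndQ_rightMul, this, zero_mul]⟩
      map_one' := Subtype.ext (by simp)
      map_mul' := fun c d => Subtype.ext (by simp [mul_assoc]) }
  have hψ : ∀ c v, lin (ψ c).1 v = lin g (rightMul c (lin g⁻¹ v)) := fun c v => by
    change lin (g * rightMulG2 c * g⁻¹) v = _
    rw [lin_mul, lin_mul, LinearMap.comp_apply, LinearMap.comp_apply, lin_rightMulG2]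
  have hse : sndQ e = 1 := by ext <;> simp [e]
  -- Since `e = (0, 1)`, `ψ c` carries `g e` to `g (0, c*)`. This recovers `c` from `ψ c` by a
  -- linear formula, giving both injectivity and a smooth inverse.
  have hinv : ∀ c, star (sndQ (lin g⁻¹ (lin (ψ c).1 (lin g e)))) = c := fun c => by
    rw [hψ, lin_inv_apply, lin_inv_apply, sndQ_rightMul, hse, one_mul, star_star]
  have hbij : Function.Bijective ψ := by
    refine ⟨fun c d h => Subtype.ext (by rw [← hinv c, h, hinv]), fun h => ?_⟩
    -- `w` lies in `0 ⊕ ℍ` and has length `-1`, so its quaternion is a unit. The element of `H_P`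
    -- built from the conjugate agrees with `h` at `g e`, hence everywhere.
    set w := lin g⁻¹ (lin h.1 (lin g e)) with hw
    have hgw : lin g w = lin h.1 (lin g e) := lin_apply_inv _ _
    obtain ⟨w0, w1, w2⟩ := (hg.2 w).1 (by rw [hgw]; exact lin_mem_perp h hz)
    have hn : q w w = -1 := by rw [← q_lin g, hgw, q_lin, zz]
    rw [q_apply, w0, w1, w2] at hn
    have hu : star (sndQ w) ∈ unitary ℍ[ℝ] := by
      rw [mem_unitary_quaternion_iff, norm_star]
      have h1 := Quaternion.normSq_eq_norm_mul_self (sndQ w)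
      rw [Quaternion.normSq_def'] at h1
      simp only [sndQ_re, sndQ_imI, sndQ_imJ, sndQ_imK] at h1
      have h2 : ‖sndQ w‖ * ‖sndQ w‖ = 1 := by rw [← h1]; linarith
      nlinarith [norm_nonneg (sndQ w)]
    refine ⟨⟨star (sndQ w), hu⟩, H_ext hz zz ?_⟩
    rw [hψ, lin_inv_apply, ← hgw]
    congr 1
    refine fstQ_sndQ_ext ?_ ?_
    · rw [fstQ_rightMul]
      ext <;> simp [e, w0, w1, w2]
    · rw [sndQ_rightMul, hse, one_mul, star_star]
  refine ⟨MulEquiv.ofBijective ψ hbij, ?_, ?_⟩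
  · refine smoothMap_of_contDiff (F := fun c => ((g : (V →L[ℝ] V)ˣ) : V →L[ℝ] V) ∘L rightMulCLM c ∘L
      (((g⁻¹ : G2) : (V →L[ℝ] V)ˣ) : V →L[ℝ] V)) ?_ ?_
    · exact contDiff_const.clm_comp (contDiff_rightMulCLM.clm_comp contDiff_const)
    · intro c; rfl
  · refine smoothMap_of_contDiff (F := fun t => LinearMap.toContinuousLinearMap starSndQL
      ((((g⁻¹ : G2) : (V →L[ℝ] V)ˣ) : V →L[ℝ] V) (t (lin g e)))) ?_ ?_
    · exact (ContinuousLinearMap.contDiff _).comp ((ContinuousLinearMap.contDiff _).comp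
        (contDiff_id.clm_apply contDiff_const))
    · intro h
      obtain ⟨c, rfl⟩ := hbij.2 h
      refine (hinv c).trans ?_
      congr 1
      exact ((MulEquiv.ofBijective ψ hbij).symm_apply_apply c).symm

end SymSpace


/-! ### Annihilator subspaces -/

/-- Isotropic subspaces with vanishing cross product; this includes all isotropic lines. -/
structure IsAnnihilator (W : Submodule ℝ V) : Prop where
  q_eq_zero : ∀ x ∈ W, ∀ y ∈ W, q x y = 0
  cross_eq_zero : ∀ x ∈ W, ∀ y ∈ W, cross x y = 0

lemma Iso.isAnnihilator (ℓ : Ein) : IsAnnihilator ℓ.1 := by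
  refine ⟨ℓ.2.2, ?_⟩
  obtain ⟨v, -, hv⟩ := finrank_eq_one_iff'.1 ℓ.2.1
  intro x hx y hy
  obtain ⟨c, hc⟩ := hv ⟨x, hx⟩
  obtain ⟨d, hd⟩ := hv ⟨y, hy⟩
  have hc' : c • (v : V) = x := congrArg Subtype.val hc
  have hd' : d • (v : V) = y := congrArg Subtype.val hd
  rw [← hc', ← hd']
  simp [cross_self]

lemma Pho.isAnnihilator (W : Pho) : IsAnnihilator W.plane := ⟨W.1.2.2, W.2⟩

namespace SymSpace

variable {P : SymSpace} {W U : Submodule ℝ V}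

/-- Negative definiteness of `P^⊥` is what makes `π_P` injective on isotropic subspaces, so that
each is a graph over its projection. -/
lemma eq_zero_of_isotropic (hW : IsAnnihilator W) {w : V} (hw : w ∈ W) (h : w ∈ P.perp) :
    w = 0 := by
  by_contra h0
  exact (q_neg h h0).ne (hW.q_eq_zero w hw w hw)

lemma proj_eq_zero_iff {v : V} : P.proj v = 0 ↔ v ∈ P.perp :=
  Submodule.projection_apply_eq_zero_iff _

lemma proj_injOn (hW : IsAnnihilator W) {v w : V} (hv : v ∈ W) (hw : w ∈ W)
    (h : P.proj v = P.proj w) : v = w := by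
  have h1 : v - w ∈ P.perp := proj_eq_zero_iff.1 (by rw [map_sub, h, sub_self])
  exact sub_eq_zero.1 (eq_zero_of_isotropic hW (W.sub_mem hv hw) h1)

lemma finrank_map_proj (hW : IsAnnihilator W) :
    Module.finrank ℝ (W.map P.proj) = Module.finrank ℝ W := by
  have hi : Function.Injective (P.proj.domRestrict W) := fun v w h =>
    Subtype.ext (proj_injOn hW v.2 w.2 h)
  rw [← LinearMap.range_domRestrict]
  exact LinearMap.finrank_range_of_inj hi

lemma map_proj_le : W.map P.proj ≤ P.1 := by
  rintro _ ⟨v, -, rfl⟩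
  exact proj_mem v

/-- As `π_P` is injective on `W`, a projection contained in `U` already fills `U` by dimension. -/
lemma map_proj_eq_iff (hW : IsAnnihilator W) (hU : U ≤ P.1)
    (hd : Module.finrank ℝ W = Module.finrank ℝ U) : W.map P.proj = U ↔ W ≤ U ⊔ P.perp := by
  constructor
  · rintro rfl w hw
    rw [← add_sub_cancel (P.proj w) w]
    exact Submodule.add_mem_sup (Submodule.mem_map_of_mem hw) (sub_proj_mem w)
  · intro h
    refine Submodule.eq_of_le_of_finrank_eq ?_ (by rw [finrank_map_proj hW, hd])
    rintro _ ⟨w, hw, rfl⟩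
    obtain ⟨u, hu, v, hv, rfl⟩ := Submodule.mem_sup.1 (h hw)
    rwa [proj_add (hU hu) hv]

lemma isGraphOver_iff (hW : IsAnnihilator W) (hU : U ≤ P.1) :
    P.IsGraphOver U W ↔ W.map P.proj = U := by
  constructor
  · rintro ⟨φ, hφ, rfl⟩
    have hp : ∀ u : U, P.proj ((U.subtype + φ) u) = u := fun u => proj_add (hU u.2) (hφ u)
    apply le_antisymm
    · rintro _ ⟨_, ⟨u, rfl⟩, rfl⟩
      rw [hp]; exact u.2
    · intro u hu
      exact ⟨_, ⟨⟨u, hu⟩, rfl⟩, hp _⟩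
  · rintro rfl
    let f : W →ₗ[ℝ] W.map P.proj :=
      (P.proj.domRestrict W).codRestrict _ fun w => Submodule.mem_map_of_mem w.2
    have hf : Function.Bijective f := by
      refine ⟨fun v w h => Subtype.ext (proj_injOn (P := P) hW v.2 w.2
        (congrArg Subtype.val h :)), ?_⟩
      rintro ⟨_, w, hw, rfl⟩
      exact ⟨⟨w, hw⟩, rfl⟩
    let e := LinearEquiv.ofBijective f hf
    have he : ∀ u, P.proj (e.symm u : V) = u := fun u => congrArg Subtype.val (e.apply_symm_apply u)
    -- The graph is that of the inverse of `π_P|_W` minus the inclusion of the projection.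
    refine ⟨W.subtype ∘ₗ e.symm.toLinearMap - (W.map P.proj).subtype, fun u => ?_, ?_⟩
    · rw [← proj_eq_zero_iff]
      have h1 := proj_mem (P := P) (e.symm u : V)
      have h2 : P.proj (P.proj (e.symm u : V)) = P.proj (e.symm u : V) :=
        Submodule.projection_apply_of_mem_left _ h1
      rw [he] at h2
      simp [he, h2]
    · rw [add_sub_cancel, LinearMap.range_comp, LinearEquiv.range, Submodule.map_top,
        Submodule.range_subtype]

lemma proj_lin (h : P.H) (v : V) : P.proj (lin h.1 v) = P.proj v := by
  have : lin h.1 v = P.proj v + lin h.1 (v - P.proj v) := by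
    rw [map_sub, h.2 _ (proj_mem v), add_sub_cancel]
  rw [this, proj_add (proj_mem v) (lin_mem_perp h (sub_proj_mem v))]

lemma map_proj_map_lin (h : P.H) (W : Submodule ℝ V) :
    (W.map (lin h.1)).map P.proj = W.map P.proj := by
  rw [← Submodule.map_comp]
  congr 1
  ext1 v
  exact proj_lin h v

/-- The unit vector of `P^⊥` over a unit vector of the projection. -/
lemma exists_add_mem (hW : IsAnnihilator W) {a : V} (ha : a ∈ W.map P.proj) (haa : q a a = 1) :
    ∃ b ∈ P.perp, q b b = -1 ∧ a + b ∈ W := by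
  obtain ⟨w, hw, rfl⟩ := ha
  have hb := sub_proj_mem (P := P) w
  have hs : P.proj w + (w - P.proj w) = w := add_sub_cancel _ _
  refine ⟨w - P.proj w, hb, ?_, by rwa [hs]⟩
  have h0 := hW.q_eq_zero w hw w hw
  rw [← hs] at h0
  simp only [map_add, LinearMap.add_apply, haa, q_eq_zero (proj_mem w) hb,
    q_eq_zero' (proj_mem w) hb] at h0
  linarith

/-- An `h` preserving `W` commutes with `π_P`-projection to the fixed space `P`; injectivity of
`π_P` on `W` then makes `h` fix every vector of `W`, in particular the `P^⊥`-part of one over a unit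
vector. -/
lemma H_eq_one_of_map_le (hW : IsAnnihilator W) (hne : W ≠ ⊥) {h : P.H}
    (hh : W.map (lin h.1) = W) : h = 1 := by
  obtain ⟨a, ha, haa⟩ := exists_unit (P := P) (U := W.map P.proj) map_proj_le (by
    rw [finrank_map_proj hW]
    exact Nat.pos_of_ne_zero fun h0 => hne (Submodule.finrank_eq_zero.1 h0))
  obtain ⟨b, hb, bb, hab⟩ := exists_add_mem hW ha haa
  have h1 : lin h.1 (a + b) = a + b :=
    proj_injOn (P := P) hW (hh ▸ Submodule.mem_map_of_mem hab) hab (proj_lin h _)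
  rw [map_add, h.2 a (map_proj_le ha)] at h1
  exact H_eq_one hb bb (add_left_cancel h1)

/-! ### Annihilator subspaces as graphs -/

end SymSpace

/-- The continuous bilinear map underlying the cross product. -/
def crossL : V →L[ℝ] V →L[ℝ] V := cross.toContinuousBilinearMap

/-- The map whose values on a subspace `U` containing the unit vector `a` are the annihilator
subspace over `U` that contains `a + b`. -/
def graphMap (a b : V) : V →L[ℝ] V := .id ℝ V - crossL a ∘L crossL.flip b

lemma graphMap_apply (a b x : V) : graphMap a b x = x - cross a (cross x b) := rfl

lemma contDiff_graphMap (b : V) : ContDiff ℝ ω fun a => graphMap a b :=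
  contDiff_const.sub (crossL.contDiff.clm_comp contDiff_const)

namespace SymSpace

variable {P : SymSpace} {W U : Submodule ℝ V} {a b c x y z : V}

lemma proj_graphMap (ha : a ∈ P.1) (hb : b ∈ P.perp) (hx : x ∈ P.1) :
    P.proj (graphMap a b x) = x := by
  rw [graphMap_apply, sub_eq_add_neg]
  exact proj_add hx (P.perp.neg_mem (cross_mem_perp ha (cross_mem_perp hx hb)))

lemma graphMap_self (ha : a ∈ P.1) (hb : b ∈ P.perp) (haa : q a a = 1) :
    graphMap a b a = a + b := by
  rw [graphMap_apply, cross_cross, haa, q_eq_zero ha hb]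
  simp

/-- The map `x ↦ a × (x × b)` is an anti-isometry from `P` into `P^⊥`: multiplication by `a`
preserves `q` there, while multiplication by the negative unit vector `b` reverses it. -/
lemma q_graphMap (ha : a ∈ P.1) (hb : b ∈ P.perp) (haa : q a a = 1) (hbb : q b b = -1)
    (hx : x ∈ P.1) (hy : y ∈ P.1) : q (graphMap a b x) (graphMap a b y) = 0 := by
  have hxb := cross_mem_perp hx hb
  have hyb := cross_mem_perp hy hb
  have h1 : q (cross x b) (cross y b) = -q x y := by
    rw [cross_swap x b, cross_swap y b]
    simp only [map_neg, LinearMap.neg_apply, neg_neg]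
    rw [q_cross_cross_polar, hbb, q_eq_zero' hx hb]
    ring
  simp only [graphMap_apply, map_sub, LinearMap.sub_apply]
  rw [q_cross_cross_polar, haa, h1, q_eq_zero ha hxb, q_eq_zero hx (cross_mem_perp ha hyb),
    q_eq_zero' hy (cross_mem_perp ha hxb)]
  ring

/-- The four terms of the product cancel in pairs, because `a × (a × (c × b)) = -c × b` and `b × (a
× (c × b)) = a × c`. -/
lemma cross_graphMap (ha : a ∈ P.1) (hb : b ∈ P.perp) (haa : q a a = 1) (hbb : q b b = -1)
    (hc : c ∈ P.1) : cross (a + b) (graphMap a b c) = 0 := by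
  have hcb := cross_mem_perp hc hb
  have hbc : cross c b = -cross b c := cross_swap c b
  have h1 : cross a (cross a (cross c b)) = -cross c b := by
    rw [cross_cross, haa, q_eq_zero ha hcb]; simp
  have h2 : cross b (cross a (cross c b)) = cross a c := by
    rw [cross_cross_of_orthogonal (q_eq_zero' ha hb) (by rw [q_comm, q_cross_right])
      (q_eq_zero ha hcb), hbc, map_neg, cross_cross, hbb, q_eq_zero' hc hb]
    simp
  rw [graphMap_apply]
  simp only [map_add, map_sub, LinearMap.add_apply, h1, h2]
  rw [hbc]
  abel

/-- The graph over a line or plane `U` is an annihilator subspace. -/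
lemma isAnnihilator_map_graphMap (hU : U ≤ P.1) (ha : a ∈ P.1) (hb : b ∈ P.perp)
    (haa : q a a = 1) (hbb : q b b = -1) (hc : c ∈ P.1)
    (hUac : U ≤ Submodule.span ℝ {a, c}) :
    IsAnnihilator (U.map (graphMap a b : V →ₗ[ℝ] V)) := by
  constructor
  · rintro _ ⟨x, hx, rfl⟩ _ ⟨y, hy, rfl⟩
    exact q_graphMap ha hb haa hbb (hU hx) (hU hy)
  · rintro _ ⟨x, hx, rfl⟩ _ ⟨y, hy, rfl⟩
    obtain ⟨s, t, rfl⟩ := Submodule.mem_span_pair.1 (hUac hx)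
    obtain ⟨s', t', rfl⟩ := Submodule.mem_span_pair.1 (hUac hy)
    have h := cross_graphMap ha hb haa hbb hc
    have h' : cross (graphMap a b c) (a + b) = 0 := by rw [cross_swap, h, neg_zero]
    simp only [ContinuousLinearMap.coe_coe, map_add (graphMap a b), map_smul,
      graphMap_self ha hb haa]
    rw [map_add cross, LinearMap.add_apply, map_add, map_add]
    simp only [map_smul, LinearMap.smul_apply, h, h', cross_self, smul_zero, add_zero]

lemma finrank_map_graphMap (hU : U ≤ P.1) (ha : a ∈ P.1) (hb : b ∈ P.perp) :
    Module.finrank ℝ (U.map (graphMap a b : V →ₗ[ℝ] V)) = Module.finrank ℝ U := by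
  have hi : Function.Injective ((graphMap a b : V →ₗ[ℝ] V).domRestrict U) := fun v w h => by
    refine Subtype.ext ?_
    rw [← proj_graphMap ha hb (hU v.2), ← proj_graphMap ha hb (hU w.2)]
    exact congrArg P.proj h
  rw [← LinearMap.range_domRestrict]
  exact LinearMap.finrank_range_of_inj hi

lemma map_proj_map_graphMap (hU : U ≤ P.1) (ha : a ∈ P.1) (hb : b ∈ P.perp) :
    (U.map (graphMap a b : V →ₗ[ℝ] V)).map P.proj = U := by
  ext v
  constructor
  · rintro ⟨_, ⟨u, hu, rfl⟩, rfl⟩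
    rw [ContinuousLinearMap.coe_coe, proj_graphMap ha hb (hU hu)]; exact hu
  · intro hv
    exact ⟨_, ⟨v, hv, rfl⟩, proj_graphMap ha hb (hU hv)⟩

/-- Elements of `H_P` respect `×` and fix `a` and `x`, so they act only on the parameter `b`.
Together with simple transitivity on unit vectors of `P^⊥`, this turns fibers into free orbits. -/
lemma lin_graphMap (h : P.H) (ha : a ∈ P.1) (hx : x ∈ P.1) :
    lin h.1 (graphMap a b x) = graphMap a (lin h.1 b) x := by
  simp only [graphMap_apply, map_sub, lin_cross, h.2 x hx, h.2 a ha]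

lemma map_lin_map_graphMap (h : P.H) (hU : U ≤ P.1) (ha : a ∈ P.1) :
    (U.map (graphMap a b : V →ₗ[ℝ] V)).map (lin h.1) =
      U.map (graphMap a (lin h.1 b) : V →ₗ[ℝ] V) := by
  ext v
  constructor
  · rintro ⟨_, ⟨u, hu, rfl⟩, rfl⟩
    exact ⟨u, hu, (lin_graphMap h ha (hU hu)).symm⟩
  · rintro ⟨u, hu, rfl⟩
    exact ⟨_, ⟨u, hu, rfl⟩, lin_graphMap h ha (hU hu)⟩

/-- If `a + b` and `x + y` span an annihilator subspace, then each of `b` and `y` determines the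
other. -/
lemma annihilator_relation (ha : a ∈ P.1) (hb : b ∈ P.perp) (hx : x ∈ P.1) (hy : y ∈ P.perp)
    (haa : q a a = 1) (h : cross (a + b) (x + y) = 0) :
    y = -cross a (cross x b) ∧ q x x • b = -cross x (cross a y) := by
  -- Only the `P^⊥`-part of the equation is used: it says `a × y = x × b`. Multiplying it by `a`, or
  -- by `x`, gives the two formulas.
  have h1 : cross a x + cross b y + (cross a y + cross b x) = 0 + 0 := by
    simp only [map_add, LinearMap.add_apply] at h
    rw [add_zero, ← h]; abel
  have h2 := (add_eq_add (P.1.add_mem (cross_mem ha hx) (cross_mem_of_perp hb hy)) P.1.zero_mem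
    (P.perp.add_mem (cross_mem_perp ha hy) (cross_mem_perp' hx hb)) P.perp.zero_mem h1).2
  have h3 : cross a y = cross x b := by
    rw [cross_swap x b]; exact eq_neg_of_add_eq_zero_left h2
  constructor
  · rw [← h3, cross_cross, haa, q_eq_zero ha hy]; simp
  · rw [h3, cross_cross, q_eq_zero hx hb]; simp

/-- An annihilator subspace is the graph determined by any of its vectors. -/
lemma eq_map_graphMap (hW : IsAnnihilator W) (ha : a ∈ P.1) (hb : b ∈ P.perp) (haa : q a a = 1)
    (hab : a + b ∈ W) : W = (W.map P.proj).map (graphMap a b : V →ₗ[ℝ] V) := by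
  have key : ∀ w ∈ W, graphMap a b (P.proj w) = w := fun w hw => by
    have hs : P.proj w + (w - P.proj w) = w := add_sub_cancel _ _
    have h := (annihilator_relation ha hb (proj_mem w) (sub_proj_mem w) haa (by
      rw [hs]; exact hW.cross_eq_zero _ hab _ hw)).1
    rw [graphMap_apply, sub_eq_add_neg, ← h, hs]
  ext w
  constructor
  · intro hw
    exact ⟨_, ⟨w, hw, rfl⟩, key w hw⟩
  · rintro ⟨_, ⟨w, hw, rfl⟩, rfl⟩
    rw [ContinuousLinearMap.coe_coe, key w hw]; exact hw

/-- Annihilator subspaces with the same projection are related by an element of `H_P`, which is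
determined by its action on a vector. -/
lemma exists_map_lin_graphMap_eq (hz : z ∈ P.perp) (hzz : q z z = -1) (hW : IsAnnihilator W)
    (ha : a ∈ W.map P.proj) (haa : q a a = 1) :
    ∃ h : P.H, a + lin h.1 z ∈ W ∧ ∀ W', IsAnnihilator W' → a + lin h.1 z ∈ W' →
      ((W'.map P.proj).map (graphMap a z : V →ₗ[ℝ] V)).map (lin h.1) = W' := by
  obtain ⟨b, hb, hbb, hab⟩ := exists_add_mem hW ha haa
  obtain ⟨h, rfl⟩ := exists_H_apply_eq hz hb hzz hbb
  have ha' : a ∈ P.1 := map_proj_le ha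
  -- The same `h` serves every annihilator subspace through this vector; for a flag these are the
  -- line and the plane.
  refine ⟨h, hab, fun W' hW' hab' => ?_⟩
  rw [map_lin_map_graphMap h map_proj_le ha', ← eq_map_graphMap hW' ha' hb haa hab']

open Filter Topology in
/-- The element of `H_P` carrying a section to a point depends analytically on the point. -/
lemma exists_analytic_transport {X E : Type*} [NormedAddCommGroup E] [NormedSpace ℝ E] {eX : X → E}
    {x₀ : X} {W : X → Submodule ℝ V} (hWan : AnalyticNear eX (fun x => grEmb (W x)) x₀)
    (hW : ∀ x, IsAnnihilator (W x)) (hne : W x₀ ≠ ⊥) {a : X → V} (ha : AnalyticNear eX a x₀)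
    (haP : ∀ᶠ x in comap eX (𝓝 (eX x₀)), a x ∈ P.1 ∧ q (a x) (a x) = 1)
    (hz : z ∈ P.perp) (hzz : q z z = -1) :
    ∃ D : X → V →L[ℝ] V, AnalyticNear eX D x₀ ∧ ∀ᶠ x in comap eX (𝓝 (eX x₀)),
      ∀ h : P.H, a x + lin h.1 z ∈ W x → D x = P.hEmb h := by
  obtain ⟨T, hT, hTe, -⟩ := exists_transport hz hzz
  obtain ⟨w₀, hw₀, hw₀0⟩ := Submodule.exists_mem_ne_zero_of_ne_bot hne
  -- Projecting a fixed `w₀ ∈ W x₀` to `W x` gives a vector varying analytically. It need not lie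
  -- over `a x`, but the second formula of `annihilator_relation` recovers `h z` from it as long as
  -- its projection to `P` is nonzero.
  let w : X → V := fun x => grEmb (W x) w₀
  have hw : AnalyticNear eX w x₀ := hWan.clm_apply (.const w₀)
  have hp : AnalyticNear eX (fun x => P.proj (w x)) x₀ := hw.linearMap _
  have hr : AnalyticNear eX (fun x => w x - P.proj (w x)) x₀ := hw.sub hp
  have hq : AnalyticNear eX (fun x => q (P.proj (w x)) (P.proj (w x))) x₀ :=
    (hp.clm q.toContinuousBilinearMap).clm_apply hp
  have hq0 : q (P.proj (w x₀)) (P.proj (w x₀)) ≠ 0 := by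
    refine (P.2.2.1 _ (proj_mem _) fun h => hw₀0 ?_).ne'
    have h1 : w x₀ = w₀ := grEmb_apply_eq hw₀
    rw [h1, proj_eq_zero_iff] at h
    exact eq_zero_of_isotropic (hW x₀) hw₀ h
  have hc : AnalyticNear eX (fun x => -crossL (P.proj (w x)) (crossL (a x) (w x - P.proj (w x))))
      x₀ := by
    have h1 := (hp.clm crossL).clm_apply ((ha.clm crossL).clm_apply hr)
    exact h1.clm (-ContinuousLinearMap.id ℝ V)
  refine ⟨_, ((hq.comp (contDiffAt_inv ℝ hq0)).smul hc).comp hT.contDiffAt, ?_⟩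
  filter_upwards [haP, hq.tendsto.eventually_ne hq0] with x hx hqx h hh
  have hs : P.proj (w x) + (w x - P.proj (w x)) = w x := add_sub_cancel _ _
  have h1 := (annihilator_relation hx.1 (lin_mem_perp h hz) (proj_mem (w x)) (sub_proj_mem (w x))
    hx.2 (by rw [hs]; exact (hW x).cross_eq_zero _ hh _ (grEmb_apply_mem _ _))).2
  rw [← hTe h]
  congr 1
  change (q (P.proj (w x)) (P.proj (w x)))⁻¹ • -cross _ (cross _ _) = _
  rw [← h1, smul_smul, inv_mul_cancel₀ hqx, one_smul]

end SymSpace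


/-! ### The three bundles -/

/-- The vector `p u` rescaled to length one. -/
def unitVec (u : V) (p : V →L[ℝ] V) : V := (√(q (p u) (p u)))⁻¹ • p u

lemma contDiffAt_unitVec {u : V} {p : V →L[ℝ] V} (h : 0 < q (p u) (p u)) :
    ContDiffAt ℝ ω (unitVec u) p := by
  have h1 : ContDiff ℝ ω fun p : V →L[ℝ] V => p u := contDiff_id.clm_apply contDiff_const
  have h2 : ContDiff ℝ ω fun p : V →L[ℝ] V => q (p u) (p u) :=
    (q.toContinuousBilinearMap.contDiff.comp h1).clm_apply h1
  have h3 : ContDiffAt ℝ ω (fun p : V →L[ℝ] V => √(q (p u) (p u))) p :=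
    (Real.contDiffAt_sqrt h.ne').comp p h2.contDiffAt
  exact (h3.inv (Real.sqrt_ne_zero'.2 h)).smul h1.contDiffAt

lemma q_unitVec {u : V} {p : V →L[ℝ] V} (h : 0 < q (p u) (p u)) :
    q (unitVec u p) (unitVec u p) = 1 := by
  simp only [unitVec, map_smul, LinearMap.smul_apply, smul_eq_mul]
  rw [← mul_assoc, ← mul_inv, Real.mul_self_sqrt h.le, inv_mul_cancel₀ h.ne']

namespace SymSpace

variable {P : SymSpace}

lemma q_grEmb_pos {k : ℕ} (U : P.Gr k) {u : V} (h : U.emb u ≠ 0) : 0 < q (U.emb u) (U.emb u) :=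
  P.2.2.1 _ (U.2.1 (grEmb_apply_mem _ _)) h

lemma unitVec_mem {k : ℕ} (U : P.Gr k) (u : V) : unitVec u U.emb ∈ U.1 :=
  U.1.smul_mem _ (grEmb_apply_mem _ _)

lemma exists_emb_ne_zero {k : ℕ} (hk : k ≠ 0) (U : P.Gr k) : ∃ u, U.emb u ≠ 0 := by
  have : U.1 ≠ ⊥ := fun h => hk (by rw [← U.2.2, h, finrank_bot])
  obtain ⟨u, hu, h0⟩ := Submodule.exists_mem_ne_zero_of_ne_bot this
  exact ⟨u, by rw [Gr.emb, grEmb_apply_eq hu]; exact h0⟩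

lemma isOpen_apply_ne_zero (u : V) : IsOpen {p : V →L[ℝ] V | p u ≠ 0} :=
  isOpen_ne_fun (by fun_prop) continuous_const

/-- The annihilator subspace over a line. -/
lemma exists_ein {U : Submodule ℝ V} (hU : U ≤ P.1) (hd : Module.finrank ℝ U = 1) {a b : V}
    (ha : a ∈ U) (hb : b ∈ P.perp) (haa : q a a = 1) (hbb : q b b = -1) :
    ∃ ℓ : Ein, ℓ.1 = U.map (graphMap a b : V →ₗ[ℝ] V) := by
  have ha0 : a ≠ 0 := fun h => by simp [h] at haa
  -- A line is the degenerate case `c = 0` of the graph construction.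
  have hspan : U ≤ Submodule.span ℝ {a, 0} := by
    have : Submodule.span ℝ {a} = U := Submodule.eq_of_le_of_finrank_eq
      (Submodule.span_le.2 (by simpa using ha)) (by rw [finrank_span_singleton ha0, hd])
    rw [← this]
    exact Submodule.span_mono (by simp)
  exact ⟨⟨_, (finrank_map_graphMap hU (hU ha) hb).trans hd,
    (isAnnihilator_map_graphMap hU (hU ha) hb haa hbb P.1.zero_mem hspan).1⟩, rfl⟩

/-- An orthonormal pair spans a plane. -/
lemma eq_span_pair {U : Submodule ℝ V} (hd : Module.finrank ℝ U = 2) {a c : V}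
    (ha : a ∈ U) (hc : c ∈ U) (haa : q a a = 1) (hcc : q c c = 1) (hac : q a c = 0) :
    Submodule.span ℝ {a, c} = U := by
  have hli : LinearIndependent ℝ ![a, c] := by
    rw [LinearIndependent.pair_iff]
    intro s t h
    have h1 := congrArg (q a) h
    have h2 := congrArg (q c) h
    simp only [map_add, map_smul, map_zero, haa, hcc, hac, q_comm c a, smul_eq_mul] at h1 h2
    constructor <;> linarith
  have hr : Set.range ![a, c] = {a, c} := by simp [Set.pair_comm]
  refine Submodule.eq_of_le_of_finrank_eq (Submodule.span_le.2 ?_) ?_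
  · rintro x (rfl | rfl)
    exacts [ha, hc]
  · rw [hd, ← hr, finrank_span_eq_card hli]; simp

/-- The annihilator subspace over a plane. -/
lemma exists_pho {U : Submodule ℝ V} (hU : U ≤ P.1) (hd : Module.finrank ℝ U = 2) {a b : V}
    (ha : a ∈ U) (hb : b ∈ P.perp) (haa : q a a = 1) (hbb : q b b = -1) :
    ∃ W : Pho, W.plane = U.map (graphMap a b : V →ₗ[ℝ] V) := by
  obtain ⟨c, hc, hcc, hac⟩ := exists_orthogonal hU (by omega) ha haa
  have h := isAnnihilator_map_graphMap hU (hU ha) hb haa hbb (hU hc)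
    (eq_span_pair hd ha hc haa hcc hac).ge
  exact ⟨⟨⟨_, (finrank_map_graphMap hU (hU ha) hb).trans hd, h.1⟩, h.2⟩, rfl⟩

section Analytic

open Filter Topology

variable {X E : Type*} [NormedAddCommGroup E] [NormedSpace ℝ E] {eX : X → E} {x₀ : X}

lemma analyticNear_smul {W W' : X → Submodule ℝ V} {h : X → P.H}
    (hh : AnalyticNear eX (fun x => P.hEmb (h x)) x₀)
    (hW : AnalyticNear eX (fun x => grEmb (W x)) x₀)
    (hd : ∀ x, Module.finrank ℝ (W x) = Module.finrank ℝ (W x₀))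
    (hW' : ∀ x, W' x = (W x).map (lin (h x).1)) : AnalyticNear eX (fun x => grEmb (W' x)) x₀ :=
  hh.grEmb_map hW hW' fun x => by rw [hW', hW', finrank_map, finrank_map, hd]

lemma analyticNear_proj {W W' : X → Submodule ℝ V}
    (hW : AnalyticNear eX (fun x => grEmb (W x)) x₀) (hA : ∀ x, IsAnnihilator (W x))
    (hd : ∀ x, Module.finrank ℝ (W x) = Module.finrank ℝ (W x₀))
    (hW' : ∀ x, W' x = (W x).map P.proj) : AnalyticNear eX (fun x => grEmb (W' x)) x₀ :=
  AnalyticNear.grEmb_map (.const (LinearMap.toContinuousLinearMap P.proj)) hW hW' fun x => by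
    rw [hW', hW', finrank_map_proj (hA _), finrank_map_proj (hA _), hd]

lemma analyticNear_unitVec {k : ℕ} {u : V} {U : X → P.Gr k}
    (hU : AnalyticNear eX (fun x => (U x).emb) x₀) (hu : (U x₀).emb u ≠ 0) :
    AnalyticNear eX (fun x => unitVec u (U x).emb) x₀ :=
  hU.comp (contDiffAt_unitVec (q_grEmb_pos _ hu))

lemma analyticNear_graphMap {z : V} {W U : X → Submodule ℝ V} {a : X → V}
    (hU : AnalyticNear eX (fun x => grEmb (U x)) x₀) (ha : AnalyticNear eX a x₀)
    (hd : ∀ x, Module.finrank ℝ (W x) = Module.finrank ℝ (W x₀))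
    (hW : ∀ x, W x = (U x).map (graphMap (a x) z : V →ₗ[ℝ] V)) :
    AnalyticNear eX (fun x => grEmb (W x)) x₀ :=
  (ha.comp (contDiff_graphMap z).contDiffAt).grEmb_map hU hW hd

lemma eventually_unitVec {k : ℕ} {u : V} {U : X → P.Gr k}
    (hU : AnalyticNear eX (fun x => (U x).emb) x₀) (hu : (U x₀).emb u ≠ 0) :
    ∀ᶠ x in comap eX (𝓝 (eX x₀)), unitVec u (U x).emb ∈ P.1 ∧
      q (unitVec u (U x).emb) (unitVec u (U x).emb) = 1 := by
  filter_upwards [hU.tendsto.eventually ((isOpen_apply_ne_zero u).mem_nhds hu)] with x hx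
  exact ⟨(U x).2.1 (unitVec_mem _ u), q_unitVec (q_grEmb_pos _ hx)⟩

end Analytic

variable (P)

/-- The projection of isotropic lines. -/
def einProj (ℓ : Ein) : P.Gr 1 :=
  ⟨ℓ.1.map P.proj, map_proj_le, (finrank_map_proj ℓ.isAnnihilator).trans ℓ.2.1⟩

/-- The projection of annihilator photons. -/
def phoProj (W : Pho) : P.Gr 2 :=
  ⟨W.plane.map P.proj, map_proj_le, (finrank_map_proj W.isAnnihilator).trans W.1.2.1⟩

/-- The projection of pointed annihilator photons. -/
def flagProj (p : F12) : P.Flag :=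
  ⟨(P.einProj p.1.1, P.phoProj p.1.2), Submodule.map_mono p.2⟩

variable {P}

lemma einProj_smul (h : P.H) (ℓ : Ein) : P.einProj (h • ℓ) = P.einProj ℓ :=
  Subtype.ext (map_proj_map_lin h ℓ.1)

lemma phoProj_smul (h : P.H) (W : Pho) : P.phoProj (h • W) = P.phoProj W :=
  Subtype.ext (map_proj_map_lin h W.plane)

lemma ein_ne_bot (ℓ : Ein) : ℓ.1 ≠ ⊥ := fun h => by
  have := ℓ.2.1
  rw [h, finrank_bot] at this
  exact zero_ne_one this

lemma pho_ne_bot (W : Pho) : W.plane ≠ ⊥ := fun h => by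
  have : Module.finrank ℝ W.plane = 2 := W.1.2.1
  rw [h, finrank_bot] at this
  norm_num at this

lemma ein_free (h : P.H) (ℓ : Ein) (e : h • ℓ = ℓ) : h = 1 :=
  H_eq_one_of_map_le ℓ.isAnnihilator (ein_ne_bot ℓ) (congrArg Subtype.val e)

lemma pho_free (h : P.H) (W : Pho) (e : h • W = W) : h = 1 :=
  H_eq_one_of_map_le W.isAnnihilator (pho_ne_bot W) (congrArg Pho.plane e)

lemma pho_ext {W W' : Pho} (h : W.plane = W'.plane) : W = W' := Subtype.ext (Subtype.ext h)

/-- `ℓ ↦ π_P(ℓ)` is a principal bundle. -/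
theorem isPrincipalBundle_ein : IsPrincipalBundle Iso.emb Gr.emb P.hEmb P.einProj := by
  have hproj : ∀ ℓ : Ein, AnalyticNear Iso.emb (fun ℓ => (P.einProj ℓ).emb) ℓ := fun ℓ =>
    analyticNear_proj (W := fun ℓ : Ein => ℓ.1) .emb (fun ℓ => ℓ.isAnnihilator)
      (fun x => x.2.1.trans ℓ.2.1.symm) fun _ => rfl
  refine isPrincipalBundle_of_sections (fun p => ?_) hproj einProj_smul ein_free fun U => ?_
  · exact analyticNear_smul (h := fun p : P.H × Ein => p.1) (W := fun p : P.H × Ein => p.2.1)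
      (.of_contDiffAt (F := Prod.fst) contDiffAt_fst)
      (.of_contDiffAt (F := Prod.snd) contDiffAt_snd)
      (fun x => x.2.2.1.trans p.2.2.1.symm) fun _ => rfl
  obtain ⟨u, hu⟩ := exists_emb_ne_zero one_ne_zero U
  obtain ⟨z, hz, hzz⟩ := P.exists_mem_perp
  -- On `N` the normalized projection of `u` is an analytic unit vector `a ∈ U`, and the section is
  -- the graph with parameters `a` and the constant `z`.
  let N : Set (P.Gr 1) := {U | U.emb u ≠ 0}
  have hsec : ∀ c : N, ∃ ℓ : Ein,
      ℓ.1 = c.1.1.map (graphMap (unitVec u c.1.emb) z : V →ₗ[ℝ] V) := fun c =>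
    exists_ein c.1.2.1 c.1.2.2 (unitVec_mem _ u) hz (q_unitVec (q_grEmb_pos _ c.2)) hzz
  choose s hs using hsec
  refine ⟨N, hu, ⟨_, isOpen_apply_ne_zero u, rfl⟩, s, fun c => ?_, fun c => ?_, fun ℓ hℓ => ?_,
    fun ℓ₀ hℓ₀ => ?_⟩
  · refine Subtype.ext ?_
    change (s c).1.map P.proj = _
    rw [hs, map_proj_map_graphMap c.1.2.1 (c.1.2.1 (unitVec_mem _ u)) hz]
  · have h1 : AnalyticNear (fun c : N => c.1.emb) (fun c : N => c.1.emb) c := .emb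
    exact analyticNear_graphMap (W := fun c => (s c).1) h1
      (analyticNear_unitVec (U := fun c : N => c.1) h1 c.2)
      (fun x => (s x).2.1.trans (s c).2.1.symm) hs
  · obtain ⟨h, h1, h2⟩ := exists_map_lin_graphMap_eq hz hzz ℓ.isAnnihilator
      (unitVec_mem (P.einProj ℓ) u) (q_unitVec (q_grEmb_pos _ hℓ))
    refine ⟨h, Subtype.ext ?_⟩
    change (s _).1.map (lin h.1) = ℓ.1
    rw [hs]
    exact h2 _ ℓ.isAnnihilator h1
  · obtain ⟨D, hD, he⟩ := exists_analytic_transport (W := fun ℓ : Ein => ℓ.1) (x₀ := ℓ₀) .emb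
      (fun ℓ => ℓ.isAnnihilator) (ein_ne_bot ℓ₀) (analyticNear_unitVec (hproj ℓ₀) hℓ₀)
      (eventually_unitVec (hproj ℓ₀) hℓ₀) hz hzz
    refine ⟨D, hD, ?_⟩
    filter_upwards [he] with ℓ h1 hℓ h hh
    refine h1 h ?_
    have ha := unitVec_mem (P.einProj ℓ) u
    have haP := (P.einProj ℓ).2.1 ha
    have e : ℓ.1 = (s ⟨P.einProj ℓ, hℓ⟩).1.map (lin h.1) := congrArg Subtype.val hh.symm
    rw [hs, map_lin_map_graphMap h (P.einProj ℓ).2.1 haP] at e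
    rw [e, ← graphMap_self haP (lin_mem_perp h hz) (q_unitVec (q_grEmb_pos _ hℓ))]
    exact Submodule.mem_map_of_mem ha

/-- `ω ↦ π_P(ω)` is a principal bundle. -/
theorem isPrincipalBundle_pho : IsPrincipalBundle Pho.emb Gr.emb P.hEmb P.phoProj := by
  have hd : ∀ W W' : Pho, Module.finrank ℝ W.plane = Module.finrank ℝ W'.plane :=
    fun W W' => W.1.2.1.trans W'.1.2.1.symm
  have hproj : ∀ W : Pho, AnalyticNear Pho.emb (fun W => (P.phoProj W).emb) W := fun W =>
    analyticNear_proj (W := Pho.plane) .emb Pho.isAnnihilator (fun x => hd x W) fun _ => rfl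
  refine isPrincipalBundle_of_sections (fun p => ?_) hproj phoProj_smul pho_free fun U => ?_
  · exact analyticNear_smul (h := fun p : P.H × Pho => p.1) (W := fun p : P.H × Pho => p.2.plane)
      (.of_contDiffAt (F := Prod.fst) contDiffAt_fst)
      (.of_contDiffAt (F := Prod.snd) contDiffAt_snd) (fun x => hd _ _) fun _ => rfl
  obtain ⟨u, hu⟩ := exists_emb_ne_zero two_ne_zero U
  obtain ⟨z, hz, hzz⟩ := P.exists_mem_perp
  let N : Set (P.Gr 2) := {U | U.emb u ≠ 0}
  have hsec : ∀ c : N, ∃ W : Pho,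
      W.plane = c.1.1.map (graphMap (unitVec u c.1.emb) z : V →ₗ[ℝ] V) := fun c =>
    exists_pho c.1.2.1 c.1.2.2 (unitVec_mem _ u) hz (q_unitVec (q_grEmb_pos _ c.2)) hzz
  choose s hs using hsec
  refine ⟨N, hu, ⟨_, isOpen_apply_ne_zero u, rfl⟩, s, fun c => ?_, fun c => ?_, fun W hW => ?_,
    fun W₀ hW₀ => ?_⟩
  · refine Subtype.ext ?_
    change (s c).plane.map P.proj = _
    rw [hs, map_proj_map_graphMap c.1.2.1 (c.1.2.1 (unitVec_mem _ u)) hz]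
  · have h1 : AnalyticNear (fun c : N => c.1.emb) (fun c : N => c.1.emb) c := .emb
    exact analyticNear_graphMap (W := fun c => (s c).plane) h1
      (analyticNear_unitVec (U := fun c : N => c.1) h1 c.2) (fun x => hd _ _) hs
  · obtain ⟨h, h1, h2⟩ := exists_map_lin_graphMap_eq hz hzz W.isAnnihilator
      (unitVec_mem (P.phoProj W) u) (q_unitVec (q_grEmb_pos _ hW))
    refine ⟨h, pho_ext ?_⟩
    change (s _).plane.map (lin h.1) = W.plane
    rw [hs]
    exact h2 _ W.isAnnihilator h1
  · obtain ⟨D, hD, he⟩ := exists_analytic_transport (W := Pho.plane) (x₀ := W₀) .emb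
      Pho.isAnnihilator (pho_ne_bot W₀) (analyticNear_unitVec (hproj W₀) hW₀)
      (eventually_unitVec (hproj W₀) hW₀) hz hzz
    refine ⟨D, hD, ?_⟩
    filter_upwards [he] with W h1 hW h hh
    refine h1 h ?_
    have ha := unitVec_mem (P.phoProj W) u
    have haP := (P.phoProj W).2.1 ha
    have e : W.plane = (s ⟨P.phoProj W, hW⟩).plane.map (lin h.1) := congrArg Pho.plane hh.symm
    rw [hs, map_lin_map_graphMap h (P.phoProj W).2.1 haP] at e
    rw [e, ← graphMap_self haP (lin_mem_perp h hz) (q_unitVec (q_grEmb_pos _ hW))]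
    exact Submodule.mem_map_of_mem ha

lemma flag_ext {p p' : F12} (h : p.line = p'.line) (h' : p.plane = p'.plane) : p = p' :=
  Subtype.ext (Prod.ext (Subtype.ext h) (pho_ext h'))

lemma flagProj_smul (h : P.H) (p : F12) : P.flagProj (h • p) = P.flagProj p :=
  Subtype.ext (Prod.ext (einProj_smul h p.1.1) (phoProj_smul h p.1.2))

lemma flag_free (h : P.H) (p : F12) (e : h • p = p) : h = 1 :=
  ein_free h p.1.1 (congrArg (fun p : F12 => p.1.1) e)

/-- `(ℓ, ω) ↦ (π_P(ℓ), π_P(ω))` is a principal bundle. -/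
theorem isPrincipalBundle_flag : IsPrincipalBundle F12.emb Flag.emb P.hEmb P.flagProj := by
  have hd₁ : ∀ p p' : F12, Module.finrank ℝ p.line = Module.finrank ℝ p'.line :=
    fun p p' => p.1.1.2.1.trans p'.1.1.2.1.symm
  have hd₂ : ∀ p p' : F12, Module.finrank ℝ p.plane = Module.finrank ℝ p'.plane :=
    fun p p' => p.1.2.1.2.1.trans p'.1.2.1.2.1.symm
  have hline : ∀ p, AnalyticNear F12.emb (fun p => grEmb p.line) p := fun p =>
    .of_contDiffAt (F := Prod.fst) contDiffAt_fst
  have hplane : ∀ p, AnalyticNear F12.emb (fun p => grEmb p.plane) p := fun p =>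
    .of_contDiffAt (F := Prod.snd) contDiffAt_snd
  have hproj₁ : ∀ p, AnalyticNear F12.emb (fun p => (P.flagProj p).1.1.emb) p := fun p =>
    analyticNear_proj (hline p) (fun p => p.1.1.isAnnihilator) (fun x => hd₁ x p) fun _ => rfl
  have hproj₂ : ∀ p, AnalyticNear F12.emb (fun p => (P.flagProj p).1.2.emb) p := fun p =>
    analyticNear_proj (hplane p) (fun p => p.1.2.isAnnihilator) (fun x => hd₂ x p) fun _ => rfl
  refine isPrincipalBundle_of_sections (fun p => ?_) (fun p => (hproj₁ p).prodMk (hproj₂ p))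
    flagProj_smul flag_free fun U => ?_
  · refine AnalyticNear.prodMk ?_ ?_
    · exact analyticNear_smul (h := fun p : P.H × F12 => p.1) (W := fun p : P.H × F12 => p.2.line)
        (.of_contDiffAt (F := Prod.fst) contDiffAt_fst)
        (.of_contDiffAt (F := Prod.fst ∘ Prod.snd) (contDiffAt_fst.comp _ contDiffAt_snd))
        (fun x => hd₁ _ _) fun _ => rfl
    · exact analyticNear_smul (h := fun p : P.H × F12 => p.1) (W := fun p : P.H × F12 => p.2.plane)
        (.of_contDiffAt (F := Prod.fst) contDiffAt_fst)
        (.of_contDiffAt (F := Prod.snd ∘ Prod.snd) (contDiffAt_snd.comp _ contDiffAt_snd))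
        (fun x => hd₂ _ _) fun _ => rfl
  obtain ⟨u, hu⟩ := exists_emb_ne_zero one_ne_zero U.1.1
  obtain ⟨z, hz, hzz⟩ := P.exists_mem_perp
  -- The condition involves only the line: its unit vector also lies in the plane, so one pair `(a,
  -- z)` determines both graphs.
  let N : Set P.Flag := {U | U.1.1.emb u ≠ 0}
  have hsec : ∀ c : N, ∃ p : F12,
      p.line = c.1.1.1.1.map (graphMap (unitVec u c.1.1.1.emb) z : V →ₗ[ℝ] V) ∧
      p.plane = c.1.1.2.1.map (graphMap (unitVec u c.1.1.1.emb) z : V →ₗ[ℝ] V) := fun c => by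
    have h1 := unitVec_mem c.1.1.1 u
    have h2 := q_unitVec (q_grEmb_pos _ c.2)
    obtain ⟨ℓ, hℓ⟩ := exists_ein c.1.1.1.2.1 c.1.1.1.2.2 h1 hz h2 hzz
    obtain ⟨W, hW⟩ := exists_pho c.1.1.2.2.1 c.1.1.2.2.2 (c.1.2 h1) hz h2 hzz
    exact ⟨⟨(ℓ, W), by rw [hℓ, hW]; exact Submodule.map_mono c.1.2⟩, hℓ, hW⟩
  choose s hs₁ hs₂ using hsec
  refine ⟨N, hu, ⟨Prod.fst ⁻¹' {p | p u ≠ 0}, (isOpen_apply_ne_zero u).preimage continuous_fst,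
    rfl⟩, s, fun c => ?_, fun c => ?_, fun p hp => ?_, fun p₀ hp₀ => ?_⟩
  · have haP := c.1.1.1.2.1 (unitVec_mem c.1.1.1 u)
    refine Subtype.ext (Prod.ext (Subtype.ext ?_) (Subtype.ext ?_))
    · change (s c).line.map P.proj = _
      rw [hs₁, map_proj_map_graphMap c.1.1.1.2.1 haP hz]
    · change (s c).plane.map P.proj = _
      rw [hs₂, map_proj_map_graphMap c.1.1.2.2.1 haP hz]
  · have h1 : AnalyticNear (fun c : N => c.1.emb) (fun c : N => c.1.1.1.emb) c :=
      .of_contDiffAt (F := Prod.fst) contDiffAt_fst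
    have h2 : AnalyticNear (fun c : N => c.1.emb) (fun c : N => c.1.1.2.emb) c :=
      .of_contDiffAt (F := Prod.snd) contDiffAt_snd
    have ha := analyticNear_unitVec (U := fun c : N => c.1.1.1) h1 c.2
    exact (analyticNear_graphMap (W := fun c => (s c).line) h1 ha (fun x => hd₁ _ _) hs₁).prodMk
      (analyticNear_graphMap (W := fun c => (s c).plane) h2 ha (fun x => hd₂ _ _) hs₂)
  · obtain ⟨h, h1, h2⟩ := exists_map_lin_graphMap_eq hz hzz p.1.1.isAnnihilator
      (unitVec_mem (P.flagProj p).1.1 u) (q_unitVec (q_grEmb_pos _ hp))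
    refine ⟨h, flag_ext ?_ ?_⟩
    · change (s _).line.map (lin h.1) = p.line
      rw [hs₁]
      exact h2 _ p.1.1.isAnnihilator h1
    · change (s _).plane.map (lin h.1) = p.plane
      rw [hs₂]
      exact h2 _ p.1.2.isAnnihilator (p.2 h1)
  · obtain ⟨D, hD, he⟩ := exists_analytic_transport (hline p₀)
      (fun p => p.1.1.isAnnihilator) (ein_ne_bot p₀.1.1) (analyticNear_unitVec (hproj₁ p₀) hp₀)
      (eventually_unitVec (hproj₁ p₀) hp₀) hz hzz
    refine ⟨D, hD, ?_⟩
    filter_upwards [he] with p h1 hp h hh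
    refine h1 h ?_
    have ha := unitVec_mem (P.flagProj p).1.1 u
    have haP := (P.flagProj p).1.1.2.1 ha
    have e : p.line = (s ⟨P.flagProj p, hp⟩).line.map (lin h.1) := congrArg F12.line hh.symm
    rw [hs₁, map_lin_map_graphMap h (P.flagProj p).1.1.2.1 haP] at e
    rw [e, ← graphMap_self haP (lin_mem_perp h hz) (q_unitVec (q_grEmb_pos _ hp))]
    exact Submodule.mem_map_of_mem ha

end SymSpace


/-! ### Opposite subspaces and their standard form -/

/-- Two subspaces that are not orthogonal. -/
def LineOpposite (L L' : Submodule ℝ V) : Prop := ∃ v ∈ L, ∃ w ∈ L', q v w ≠ 0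

/-- The pairing of the two subspaces by `q` has rank at least two. -/
def PlaneOpposite (W W' : Submodule ℝ V) : Prop :=
  ∃ v₁ ∈ W, ∃ v₂ ∈ W, ∃ w₁ ∈ W', ∃ w₂ ∈ W', q v₁ w₁ * q v₂ w₂ - q v₁ w₂ * q v₂ w₁ ≠ 0

lemma LineOpposite.map {L L' : Submodule ℝ V} (h : LineOpposite L L') (g : G2) :
    LineOpposite (L.map (lin g)) (L'.map (lin g)) := by
  obtain ⟨v, hv, w, hw, e⟩ := h
  exact ⟨_, ⟨v, hv, rfl⟩, _, ⟨w, hw, rfl⟩, by rwa [q_lin]⟩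

lemma PlaneOpposite.map {W W' : Submodule ℝ V} (h : PlaneOpposite W W') (g : G2) :
    PlaneOpposite (W.map (lin g)) (W'.map (lin g)) := by
  obtain ⟨v₁, h₁, v₂, h₂, w₁, k₁, w₂, k₂, e⟩ := h
  exact ⟨_, ⟨v₁, h₁, rfl⟩, _, ⟨v₂, h₂, rfl⟩, _, ⟨w₁, k₁, rfl⟩, _, ⟨w₂, k₂, rfl⟩, by
    simpa only [q_lin] using e⟩

section Open

variable {X : Type*} [TopologicalSpace X] {W W' : X → Submodule ℝ V}

lemma continuous_q_grEmb (hW : Continuous fun x => grEmb (W x))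
    (hW' : Continuous fun x => grEmb (W' x)) (v w : V) :
    Continuous fun x => q (grEmb (W x) v) (grEmb (W' x) w) := by
  have h1 : Continuous fun x => grEmb (W x) v := hW.clm_apply continuous_const
  have h2 : Continuous fun x => grEmb (W' x) w := hW'.clm_apply continuous_const
  exact (q.toContinuousBilinearMap.continuous.comp h1).clm_apply h2

/-- Vectors of the moving subspaces are replaced by projections of fixed ambient vectors, which
exhibits the set as a union of open conditions. -/
lemma isOpen_lineOpposite (hW : Continuous fun x => grEmb (W x))
    (hW' : Continuous fun x => grEmb (W' x)) : IsOpen {x | LineOpposite (W x) (W' x)} := by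
  have : {x | LineOpposite (W x) (W' x)} =
      ⋃ (v : V) (w : V), {x | q (grEmb (W x) v) (grEmb (W' x) w) ≠ 0} := by
    ext x
    simp only [Set.mem_ofPred_eq, Set.mem_iUnion]
    constructor
    · rintro ⟨v, hv, w, hw, e⟩
      exact ⟨v, w, by rwa [grEmb_apply_eq hv, grEmb_apply_eq hw]⟩
    · rintro ⟨v, w, e⟩
      exact ⟨_, grEmb_apply_mem _ _, _, grEmb_apply_mem _ _, e⟩
  rw [this]
  exact isOpen_iUnion fun v => isOpen_iUnion fun w =>
    isOpen_ne_fun (continuous_q_grEmb hW hW' v w) continuous_const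

lemma isOpen_planeOpposite (hW : Continuous fun x => grEmb (W x))
    (hW' : Continuous fun x => grEmb (W' x)) : IsOpen {x | PlaneOpposite (W x) (W' x)} := by
  have : {x | PlaneOpposite (W x) (W' x)} = ⋃ (v₁ : V) (v₂ : V) (w₁ : V) (w₂ : V),
      {x | q (grEmb (W x) v₁) (grEmb (W' x) w₁) * q (grEmb (W x) v₂) (grEmb (W' x) w₂) -
        q (grEmb (W x) v₁) (grEmb (W' x) w₂) * q (grEmb (W x) v₂) (grEmb (W' x) w₁) ≠ 0} := by
    ext x
    simp only [Set.mem_ofPred_eq, Set.mem_iUnion]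
    constructor
    · rintro ⟨v₁, h₁, v₂, h₂, w₁, k₁, w₂, k₂, e⟩
      exact ⟨v₁, v₂, w₁, w₂, by
        rwa [grEmb_apply_eq h₁, grEmb_apply_eq h₂, grEmb_apply_eq k₁, grEmb_apply_eq k₂]⟩
    · rintro ⟨v₁, v₂, w₁, w₂, e⟩
      exact ⟨_, grEmb_apply_mem _ _, _, grEmb_apply_mem _ _, _, grEmb_apply_mem _ _, _,
        grEmb_apply_mem _ _, e⟩
  rw [this]
  refine isOpen_iUnion fun v₁ => isOpen_iUnion fun v₂ => isOpen_iUnion fun w₁ =>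
    isOpen_iUnion fun w₂ => isOpen_ne_fun (Continuous.sub (Continuous.mul ?_ ?_)
      (Continuous.mul ?_ ?_)) continuous_const <;>
  exact continuous_q_grEmb hW hW' _ _

end Open

/-- Both triads are images of the standard one, `(e₀, e₁, e₃)`. -/
lemma exists_map_triad {s j t s' j' t' : V} (h : IsTriad s j t) (h' : IsTriad s' j' t') :
    ∃ g : G2, lin g s = s' ∧ lin g j = j' ∧ lin g t = t' := by
  have e : ∀ {s j t : V} (h : IsTriad s j t), lin h.frame (EuclideanSpace.single 0 1) = s ∧
      lin h.frame (EuclideanSpace.single 1 1) = j ∧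
      lin h.frame (EuclideanSpace.single 3 1) = t := fun h => by
    simp [h.lin_frame, frameMap_apply]
  have e' : ∀ {s j t : V} (h : IsTriad s j t), lin h.frame⁻¹ s = EuclideanSpace.single 0 1 ∧
      lin h.frame⁻¹ j = EuclideanSpace.single 1 1 ∧
      lin h.frame⁻¹ t = EuclideanSpace.single 3 1 := fun h => by
    have h0 := lin_inv_apply h.frame (EuclideanSpace.single 0 1)
    have h1 := lin_inv_apply h.frame (EuclideanSpace.single 1 1)
    have h3 := lin_inv_apply h.frame (EuclideanSpace.single 3 1)
    rw [(e h).1] at h0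
    rw [(e h).2.1] at h1
    rw [(e h).2.2] at h3
    exact ⟨h0, h1, h3⟩
  refine ⟨h'.frame * h.frame⁻¹, ?_, ?_, ?_⟩
  · rw [lin_mul, LinearMap.comp_apply, (e' h).1, (e h').1]
  · rw [lin_mul, LinearMap.comp_apply, (e' h).2.1, (e h').2.1]
  · rw [lin_mul, LinearMap.comp_apply, (e' h).2.2, (e h').2.2]

/-- The partner of `j` in the standard form of a pair of opposite photons. -/
def partner (s j t : V) : V := cross s (cross t j)

lemma lin_partner (g : G2) (s j t : V) :
    lin g (partner s j t) = partner (lin g s) (lin g j) (lin g t) := by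
  simp only [partner, lin_cross]

/-- The triad of a pair of dual bases of opposite photons. -/
lemma isTriad_of_dual {x₁ x₂ y₁ y₂ : V} (hx₁ : q x₁ x₁ = 0) (hx₂ : q x₂ x₂ = 0) (hx : q x₁ x₂ = 0)
    (hy₁ : q y₁ y₁ = 0) (hy₂ : q y₂ y₂ = 0) (hy : q y₁ y₂ = 0) (cx : cross x₁ x₂ = 0)
    (cy : cross y₁ y₂ = 0) (h₁₁ : q x₁ y₁ = 1 / 2) (h₂₂ : q x₂ y₂ = 1 / 2) (h₁₂ : q x₁ y₂ = 0)
    (h₂₁ : q x₂ y₁ = 0) :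
    IsTriad (x₁ + y₁) (x₂ + y₂) (x₁ - y₁) ∧
      partner (x₁ + y₁) (x₂ + y₂) (x₁ - y₁) = x₂ - y₂ := by
  have e₁₁ := q_comm y₁ x₁
  have e₂₂ := q_comm y₂ x₂
  have e₁₂ := q_comm y₂ x₁
  have e₂₁ := q_comm y₁ x₂
  have ex := q_comm x₂ x₁
  have ey := q_comm y₂ y₁
  constructor
  · constructor
    · simp only [map_add, LinearMap.add_apply]; linarith
    · simp only [map_add, LinearMap.add_apply]; linarith
    · simp only [map_sub, LinearMap.sub_apply]; linarith
    · simp only [map_add, LinearMap.add_apply]; linarith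
    · simp only [map_add, map_sub, LinearMap.add_apply]; linarith
    · simp only [map_add, map_sub, LinearMap.add_apply]; linarith
    · have t1 : q (cross x₁ y₂) x₁ = 0 := q_cross_left _ _
      have t2 : q (cross y₁ x₂) y₁ = 0 := q_cross_left _ _
      have t3 : q (cross x₁ y₂) y₁ = 0 := by
        rw [q_cross_cyclic, cross_swap y₂ y₁, cy]; simp
      have t4 : q (cross y₁ x₂) x₁ = 0 := by
        rw [q_cross_cyclic, cross_swap x₂ x₁, cx]; simp
      simp only [map_add, map_sub, LinearMap.add_apply, cx, cy, t1, t2, t3, t4]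
      simp
  · have t1 : cross x₁ (cross x₁ y₂) = 0 := by rw [cross_cross, hx₁, h₁₂]; simp
    have t2 : cross y₁ (cross y₁ x₂) = 0 := by rw [cross_cross, hy₁, e₂₁, h₂₁]; simp
    have t3 : cross x₁ (cross y₁ x₂) = -x₂ := by
      rw [cross_cross_polar, cx, h₁₁, hx, e₂₁, h₂₁]; simp
    have t4 : cross y₁ (cross x₁ y₂) = -y₂ := by
      rw [cross_cross_polar, cy, e₁₁, h₁₁, hy, h₁₂]; simp
    simp only [partner, map_add, map_sub, LinearMap.add_apply, LinearMap.sub_apply, cx, cy, t1, t2,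
      t3, t4, map_zero]
    abel

/-- Vectors of opposite planes that are not orthogonal can be completed to dual bases. -/
lemma PlaneOpposite.exists_dual {W W' : Submodule ℝ V} (h : PlaneOpposite W W') {v w : V}
    (hv : v ∈ W) (hw : w ∈ W') (hvw : q v w ≠ 0) :
    ∃ x ∈ W, ∃ y ∈ W', q x w = 0 ∧ q v y = 0 ∧ q x y = 1 / 2 := by
  obtain ⟨v₁, h₁, v₂, h₂, w₁, k₁, w₂, k₂, e⟩ := h
  let f : V → V := fun x => x - (q x w / q v w) • v
  let f' : V → V := fun y => y - (q v y / q v w) • w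
  have hf : ∀ x, q (f x) w = 0 := fun x => by
    simp only [f, map_sub, LinearMap.sub_apply, map_smul, LinearMap.smul_apply, smul_eq_mul]
    field_simp; ring
  have hf' : ∀ y, q v (f' y) = 0 := fun y => by
    simp only [f', map_sub, map_smul, smul_eq_mul]
    field_simp; ring
  have hff : ∀ x y, q (f x) (f' y) = q x y - q x w * q v y / q v w := fun x y => by
    have h1 : q (f x) (f' y) = q (f x) y := by
      simp only [f', map_sub (q (f x)), map_smul, hf, smul_zero, sub_zero]
    rw [h1]
    simp only [f, map_sub, LinearMap.sub_apply, map_smul, LinearMap.smul_apply, smul_eq_mul]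
    ring
  -- If all these values vanished, the pairing would be `q x w * q v y / q v w`, of rank one, and
  -- all its `2 × 2` minors would be zero.
  have hne : ∃ x ∈ W, ∃ y ∈ W', q (f x) (f' y) ≠ 0 := by
    by_contra! hall
    apply e
    have a₁₁ := hall v₁ h₁ w₁ k₁
    have a₁₂ := hall v₁ h₁ w₂ k₂
    have a₂₁ := hall v₂ h₂ w₁ k₁
    have a₂₂ := hall v₂ h₂ w₂ k₂
    rw [hff, sub_eq_zero] at a₁₁ a₁₂ a₂₁ a₂₂
    rw [a₁₁, a₁₂, a₂₁, a₂₂]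
    ring
  obtain ⟨x, hx, y, hy, hxy⟩ := hne
  refine ⟨f x, W.sub_mem hx (W.smul_mem _ hv), (1 / (2 * q (f x) (f' y))) • f' y,
    W'.smul_mem _ (W'.sub_mem hy (W'.smul_mem _ hw)), hf x, ?_, ?_⟩
  · rw [map_smul, hf', smul_zero]
  · rw [map_smul, smul_eq_mul]; field_simp

lemma span_pair_eq_of_dual {W : Submodule ℝ V} (hd : Module.finrank ℝ W = 2) {x₁ x₂ y₁ y₂ : V}
    (h₁ : x₁ ∈ W) (h₂ : x₂ ∈ W) (h₁₁ : q x₁ y₁ ≠ 0) (h₂₂ : q x₂ y₂ ≠ 0) (h₁₂ : q x₁ y₂ = 0)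
    (h₂₁ : q x₂ y₁ = 0) : W = Submodule.span ℝ {x₁, x₂} := by
  have hli : LinearIndependent ℝ ![x₁, x₂] := by
    rw [LinearIndependent.pair_iff]
    intro s t h
    have h1 := congrArg (fun v => q v y₁) h
    have h2 := congrArg (fun v => q v y₂) h
    simp only [map_add, map_smul, LinearMap.add_apply, LinearMap.smul_apply, map_zero, h₁₂, h₂₁,
      LinearMap.zero_apply, smul_eq_mul, mul_zero, add_zero, zero_add] at h1 h2
    exact ⟨(mul_eq_zero.1 h1).resolve_right h₁₁, (mul_eq_zero.1 h2).resolve_right h₂₂⟩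
  have hr : Set.range ![x₁, x₂] = {x₁, x₂} := by simp [Set.pair_comm]
  refine (Submodule.eq_of_le_of_finrank_eq (Submodule.span_le.2 ?_) ?_).symm
  · rintro x (rfl | rfl)
    exacts [h₁, h₂]
  · rw [hd, ← hr, finrank_span_eq_card hli]; simp

/-- Standard form of a pair of opposite photons with a pair of vectors in them. -/
lemma exists_triad_planes {W W' : Submodule ℝ V} (hW : IsAnnihilator W) (hW' : IsAnnihilator W')
    (hd : Module.finrank ℝ W = 2) (hd' : Module.finrank ℝ W' = 2) (h : PlaneOpposite W W')
    {v w : V} (hv : v ∈ W) (hw : w ∈ W') (hvw : q v w ≠ 0) :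
    ∃ s j t, IsTriad s j t ∧ W = Submodule.span ℝ {s + t, j + partner s j t} ∧
      W' = Submodule.span ℝ {s - t, j - partner s j t} ∧
      (∃ c : ℝ, c ≠ 0 ∧ s + t = c • v) ∧ ∃ c : ℝ, c ≠ 0 ∧ s - t = c • w := by
  -- The pairing is scaled to `1 / 2` so that `v + y₁` and `v - y₁` have lengths `1` and `-1`.
  set y₁ := (1 / (2 * q v w)) • w with hy₁
  have hy₁W : y₁ ∈ W' := W'.smul_mem _ hw
  have hvy : q v y₁ = 1 / 2 := by rw [hy₁, map_smul, smul_eq_mul]; field_simp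
  obtain ⟨x₂, hx₂, y₂, hy₂, h₂₁, h₁₂, h₂₂⟩ := h.exists_dual hv hy₁W (by rw [hvy]; norm_num)
  obtain ⟨ht, hp⟩ := isTriad_of_dual (hW.q_eq_zero v hv v hv) (hW.q_eq_zero _ hx₂ _ hx₂)
    (hW.q_eq_zero _ hv _ hx₂) (hW'.q_eq_zero _ hy₁W _ hy₁W) (hW'.q_eq_zero _ hy₂ _ hy₂)
    (hW'.q_eq_zero _ hy₁W _ hy₂) (hW.cross_eq_zero _ hv _ hx₂) (hW'.cross_eq_zero _ hy₁W _ hy₂)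
    hvy h₂₂ h₁₂ h₂₁
  have e1 : v + y₁ + (v - y₁) = (2 : ℝ) • v := by module
  have e2 : v + y₁ - (v - y₁) = (2 : ℝ) • y₁ := by module
  have e3 : x₂ + y₂ + (x₂ - y₂) = (2 : ℝ) • x₂ := by module
  have e4 : x₂ + y₂ - (x₂ - y₂) = (2 : ℝ) • y₂ := by module
  refine ⟨_, _, _, ht, ?_, ?_, ⟨2, two_ne_zero, e1⟩, ⟨2 * (1 / (2 * q v w)), ?_, ?_⟩⟩
  · rw [hp, e1, e3]
    refine span_pair_eq_of_dual hd (W.smul_mem _ hv) (W.smul_mem _ hx₂) (y₁ := y₁) (y₂ := y₂)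
      ?_ ?_ ?_ ?_ <;>
    simp only [map_smul, LinearMap.smul_apply, hvy, h₂₂, h₁₂, h₂₁] <;> norm_num
  · rw [hp, e2, e4]
    refine span_pair_eq_of_dual hd' (W'.smul_mem _ hy₁W) (W'.smul_mem _ hy₂) (y₁ := v) (y₂ := x₂)
      ?_ ?_ ?_ ?_ <;>
    simp only [map_smul, LinearMap.smul_apply, q_comm _ v, q_comm _ x₂, hvy, h₂₂, h₁₂, h₂₁] <;>
    norm_num
  · exact mul_ne_zero two_ne_zero (one_div_ne_zero (mul_ne_zero two_ne_zero hvw))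
  · rw [e2, hy₁, smul_smul]

/-- Standard form of a pair of isotropic vectors that are not orthogonal. -/
lemma exists_triad_lines {v w : V} (hv : q v v = 0) (hw : q w w = 0) (hvw : q v w ≠ 0) :
    ∃ s j t, IsTriad s j t ∧ (∃ c : ℝ, c ≠ 0 ∧ s + t = c • v) ∧ ∃ c : ℝ, c ≠ 0 ∧ s - t = c • w := by
  set y := (1 / (2 * q v w)) • w with hy
  have hyy : q y y = 0 := by
    simp only [hy, map_smul, LinearMap.smul_apply, hw, smul_zero]
  have hvy : q v y = 1 / 2 := by rw [hy, map_smul, smul_eq_mul]; field_simp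
  have hyv := q_comm y v
  set s := v + y with hs
  set t := v - y with ht
  have ss : q s s = 1 := by
    simp only [hs, map_add, LinearMap.add_apply]; linarith
  have tt : q t t = -1 := by
    simp only [ht, map_sub, LinearMap.sub_apply]; linarith
  have st : q s t = 0 := by
    simp only [hs, ht, map_add, map_sub, LinearMap.add_apply]; linarith
  have cc : q (cross s t) (cross s t) = -1 := by rw [q_cross_cross, ss, tt, st]; norm_num
  have cs := q_cross_left s t
  have ct := q_cross_right s t
  -- Orthogonality to `s` and `t` is two conditions on the positive definite 3-space of the first
  -- coordinates.
  obtain ⟨u, hus, hut, huu⟩ : ∃ u, q u s = 0 ∧ q u t = 0 ∧ 0 < q u u := by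
    let L : (Fin 3 → ℝ) →ₗ[ℝ] ℝ × ℝ :=
      ((q.flip s).prod (q.flip t)) ∘ₗ
        ({ toFun := fun x => !₂[x 0, x 1, x 2, 0, 0, 0, 0]
           map_add' := fun x y => by ext i; fin_cases i <;> simp
           map_smul' := fun c x => by ext i; fin_cases i <;> simp } : (Fin 3 → ℝ) →ₗ[ℝ] V)
    have hL : LinearMap.ker L ≠ ⊥ := LinearMap.ker_ne_bot_of_finrank_lt (by simp)
    obtain ⟨x, hx, hx0⟩ := Submodule.exists_mem_ne_zero_of_ne_bot hL
    have hx' := LinearMap.mem_ker.1 hx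
    refine ⟨!₂[x 0, x 1, x 2, 0, 0, 0, 0], congrArg Prod.fst hx', congrArg Prod.snd hx', ?_⟩
    rw [q_apply]
    simp only [Matrix.cons_val]
    by_contra hle
    have h0 := mul_self_nonneg (x 0)
    have h1 := mul_self_nonneg (x 1)
    have h2 := mul_self_nonneg (x 2)
    have e0 : x 0 = 0 := mul_self_eq_zero.1 (by linarith)
    have e1 : x 1 = 0 := mul_self_eq_zero.1 (by linarith)
    have e2 : x 2 = 0 := mul_self_eq_zero.1 (by linarith)
    apply hx0
    ext i; fin_cases i <;> simp [e0, e1, e2]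
  -- Removing the component along the negative unit vector `s × t` only increases the length: `q j j
  -- = q u u + (q u (s × t))²`.
  set j := u + q u (cross s t) • cross s t with hj
  have js : q j s = 0 := by
    simp only [hj, map_add, LinearMap.add_apply, map_smul, LinearMap.smul_apply, hus, cs, smul_zero,
      add_zero]
  have jt : q j t = 0 := by
    simp only [hj, map_add, LinearMap.add_apply, map_smul, LinearMap.smul_apply, hut, ct, smul_zero,
      add_zero]
  have jc : q j (cross s t) = 0 := by
    simp only [hj, map_add, LinearMap.add_apply, map_smul, LinearMap.smul_apply, cc, smul_eq_mul]
    ring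
  have jj : 0 < q j j := by
    have h1 : q j j = q j u + q u (cross s t) * q j (cross s t) := by
      conv_lhs => rw [hj, map_add, map_smul, smul_eq_mul, ← hj]
    rw [h1, jc, mul_zero, add_zero, q_comm, hj, map_add, map_smul, smul_eq_mul]
    nlinarith [mul_self_nonneg (q u (cross s t))]
  obtain ⟨c, -, hc⟩ := exists_smul_q_eq_one jj
  refine ⟨s, c • j, t, ⟨ss, hc, tt, ?_, st, ?_, ?_⟩, ⟨2, two_ne_zero, ?_⟩,
    ⟨2 * (1 / (2 * q v w)), ?_, ?_⟩⟩
  · rw [map_smul, q_comm, js, smul_zero]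
  · rw [map_smul, LinearMap.smul_apply, jt, smul_zero]
  · have : q (cross s j) t = 0 := by
      rw [q_cross_left_eq, jc, neg_zero]
    rw [map_smul, map_smul, LinearMap.smul_apply, this, smul_zero]
  · rw [hs, ht]; module
  · exact mul_ne_zero two_ne_zero (one_div_ne_zero (mul_ne_zero two_ne_zero hvw))
  · have : s - t = (2 : ℝ) • y := by rw [hs, ht]; module
    rw [this, hy, smul_smul]

lemma eq_span_singleton {L : Submodule ℝ V} (hd : Module.finrank ℝ L = 1) {v w : V} (hv : v ∈ L)
    (hv0 : v ≠ 0) (h : ∃ c : ℝ, c ≠ 0 ∧ w = c • v) : L = Submodule.span ℝ {w} := by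
  obtain ⟨c, hc, rfl⟩ := h
  refine (Submodule.eq_of_le_of_finrank_eq (Submodule.span_le.2 ?_) ?_).symm
  · rintro x rfl
    exact L.smul_mem _ hv
  · rw [hd, finrank_span_singleton (smul_ne_zero hc hv0)]

lemma ne_zero_of_q {v w : V} (h : q v w ≠ 0) : v ≠ 0 ∧ w ≠ 0 := by
  constructor <;> rintro rfl <;> simp at h

/-! ### Transitivity on opposite pairs -/

/-- `G₂'` is transitive on pairs of opposite isotropic lines. -/
lemma ein_transitive {x y x' y' : Ein} (h : LineOpposite x.1 y.1) (h' : LineOpposite x'.1 y'.1) :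
    ∃ g : G2, g • x = x' ∧ g • y = y' := by
  have key : ∀ {x y : Ein}, LineOpposite x.1 y.1 → ∃ s j t, IsTriad s j t ∧
      x.1 = Submodule.span ℝ {s + t} ∧ y.1 = Submodule.span ℝ {s - t} := by
    rintro x y ⟨v, hv, w, hw, hvw⟩
    obtain ⟨s, j, t, ht, h1, h2⟩ := exists_triad_lines (x.2.2 v hv v hv) (y.2.2 w hw w hw) hvw
    exact ⟨s, j, t, ht, eq_span_singleton x.2.1 hv (ne_zero_of_q hvw).1 h1,
      eq_span_singleton y.2.1 hw (ne_zero_of_q hvw).2 h2⟩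
  obtain ⟨s, j, t, ht, hx, hy⟩ := key h
  obtain ⟨s', j', t', ht', hx', hy'⟩ := key h'
  obtain ⟨g, rfl, rfl, rfl⟩ := exists_map_triad ht ht'
  refine ⟨g, Subtype.ext ?_, Subtype.ext ?_⟩
  · change x.1.map (lin g) = x'.1
    rw [hx, hx', Submodule.map_span, Set.image_singleton, map_add]
  · change y.1.map (lin g) = y'.1
    rw [hy, hy', Submodule.map_span, Set.image_singleton, map_sub]

lemma PlaneOpposite.exists_q_ne_zero {W W' : Submodule ℝ V} (h : PlaneOpposite W W') :
    ∃ v ∈ W, ∃ w ∈ W', q v w ≠ 0 := by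
  obtain ⟨v₁, h₁, v₂, h₂, w₁, k₁, w₂, k₂, e⟩ := h
  by_contra! hall
  apply e
  rw [hall v₁ h₁ w₁ k₁, hall v₁ h₁ w₂ k₂]
  ring

/-- `G₂'` is transitive on pairs of opposite annihilator photons. -/
lemma pho_transitive {x y x' y' : Pho} (h : PlaneOpposite x.plane y.plane)
    (h' : PlaneOpposite x'.plane y'.plane) : ∃ g : G2, g • x = x' ∧ g • y = y' := by
  have key : ∀ {x y : Pho}, PlaneOpposite x.plane y.plane → ∃ s j t, IsTriad s j t ∧
      x.plane = Submodule.span ℝ {s + t, j + partner s j t} ∧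
      y.plane = Submodule.span ℝ {s - t, j - partner s j t} := by
    intro x y h
    obtain ⟨v, hv, w, hw, hvw⟩ := h.exists_q_ne_zero
    obtain ⟨s, j, t, ht, h1, h2, -⟩ := exists_triad_planes x.isAnnihilator y.isAnnihilator
      x.1.2.1 y.1.2.1 h hv hw hvw
    exact ⟨s, j, t, ht, h1, h2⟩
  obtain ⟨s, j, t, ht, hx, hy⟩ := key h
  obtain ⟨s', j', t', ht', hx', hy'⟩ := key h'
  obtain ⟨g, rfl, rfl, rfl⟩ := exists_map_triad ht ht'
  refine ⟨g, SymSpace.pho_ext ?_, SymSpace.pho_ext ?_⟩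
  · change x.plane.map (lin g) = x'.plane
    rw [hx, hx', Submodule.map_span, Set.image_pair, map_add, map_add, lin_partner]
  · change y.plane.map (lin g) = y'.plane
    rw [hy, hy', Submodule.map_span, Set.image_pair, map_sub, map_sub, lin_partner]

/-- `G₂'` is transitive on pairs of opposite pointed annihilator photons. -/
lemma flag_transitive {x y x' y' : F12}
    (h : LineOpposite x.line y.line ∧ PlaneOpposite x.plane y.plane)
    (h' : LineOpposite x'.line y'.line ∧ PlaneOpposite x'.plane y'.plane) :
    ∃ g : G2, g • x = x' ∧ g • y = y' := by
  have key : ∀ {x y : F12}, LineOpposite x.line y.line ∧ PlaneOpposite x.plane y.plane →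
      ∃ s j t, IsTriad s j t ∧
      x.plane = Submodule.span ℝ {s + t, j + partner s j t} ∧
      y.plane = Submodule.span ℝ {s - t, j - partner s j t} ∧
      x.line = Submodule.span ℝ {s + t} ∧ y.line = Submodule.span ℝ {s - t} := by
    rintro x y ⟨⟨v, hv, w, hw, hvw⟩, h⟩
    obtain ⟨s, j, t, ht, h1, h2, h3, h4⟩ := exists_triad_planes x.1.2.isAnnihilator
      y.1.2.isAnnihilator x.1.2.1.2.1 y.1.2.1.2.1 h (x.2 hv) (y.2 hw) hvw
    exact ⟨s, j, t, ht, h1, h2, eq_span_singleton x.1.1.2.1 hv (ne_zero_of_q hvw).1 h3,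
      eq_span_singleton y.1.1.2.1 hw (ne_zero_of_q hvw).2 h4⟩
  obtain ⟨s, j, t, ht, hx, hy, kx, ky⟩ := key h
  obtain ⟨s', j', t', ht', hx', hy', kx', ky'⟩ := key h'
  obtain ⟨g, rfl, rfl, rfl⟩ := exists_map_triad ht ht'
  refine ⟨g, SymSpace.flag_ext ?_ ?_, SymSpace.flag_ext ?_ ?_⟩
  · change x.line.map (lin g) = x'.line
    rw [kx, kx', Submodule.map_span, Set.image_singleton, map_add]
  · change x.plane.map (lin g) = x'.plane
    rw [hx, hx', Submodule.map_span, Set.image_pair, map_add, map_add, lin_partner]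
  · change y.line.map (lin g) = y'.line
    rw [ky, ky', Submodule.map_span, Set.image_singleton, map_sub]
  · change y.plane.map (lin g) = y'.plane
    rw [hy, hy', Submodule.map_span, Set.image_pair, map_sub, map_sub, lin_partner]

/-! ### Transversality criteria -/

section Criteria

open Filter Topology

variable {G F B : Type*} [Group G] [TopologicalSpace F] [MulAction G F]

/-- Invariance and transitivity identify the orbit of the pair with the relation itself, which is
open. -/
lemma transverse_of_transitive {R : F → F → Prop} (hopen : IsOpen {p : F × F | R p.1 p.2})
    (hinv : ∀ (g : G) x y, R x y → R (g • x) (g • y))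
    (htrans : ∀ x y x' y', R x y → R x' y' → ∃ g : G, g • x = x' ∧ g • y = y') {x y : F}
    (h : R x y) : Transverse G x y := by
  have : MulAction.orbit G ((x, y) : F × F) = {p : F × F | R p.1 p.2} := by
    ext ⟨x', y'⟩
    constructor
    · rintro ⟨g, hg⟩
      rw [← hg]
      exact hinv g x y h
    · intro h'
      obtain ⟨g, rfl, rfl⟩ := htrans x y x' y' h h'
      exact ⟨g, rfl⟩
  rw [Transverse, this]
  exact hopen

/-- A pair with an invariant property that is destroyed by small motions is not transverse. -/
lemma not_transverse_of_path {R : F → F → Prop} (hinv : ∀ (g : G) x y, R x y → R (g • x) (g • y))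
    {z y : F} (hR : R z y) {γ : ℝ → F} {θ₀ : ℝ} (hγ : ContinuousAt γ θ₀) (h₀ : γ θ₀ = y)
    (hev : ∀ᶠ θ in 𝓝[≠] θ₀, ¬R z (γ θ)) : ¬Transverse G z y := by
  intro h
  have h1 : ∀ᶠ θ in 𝓝 θ₀, (z, γ θ) ∈ MulAction.orbit G ((z, y) : F × F) := by
    have hc : ContinuousAt (fun θ => (z, γ θ)) θ₀ := continuousAt_const.prodMk hγ
    refine hc.eventually (IsOpen.mem_nhds h ?_)
    change (z, γ θ₀) ∈ MulAction.orbit G (z, y)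
    rw [h₀]
    exact MulAction.mem_orbit_self _
  obtain ⟨θ, ⟨g, hg⟩, h3⟩ := ((h1.filter_mono nhdsWithin_le_nhds).and hev).exists
  apply h3
  have e1 : g • z = z := congrArg Prod.fst hg
  have e2 : g • y = γ θ := congrArg Prod.snd hg
  have := hinv g z y hR
  rwa [e1, e2] at this

/-- A point outside the fiber fails to be transverse to some point of it, so nothing can be added.
-/
lemma maximallyTransverse_fiber {π : F → B}
    (h₁ : ∀ x y, π x = π y → x ≠ y → Transverse G x y)
    (h₂ : ∀ b z, π z ≠ b → ∃ y, π y = b ∧ ¬Transverse G z y) (b : B) :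
    MaximallyTransverse G (π ⁻¹' {b}) := by
  refine ⟨fun x hx y hy hne => h₁ x y (Eq.trans hx (Eq.symm hy)) hne, fun T hT hST => ?_⟩
  refine Set.Subset.antisymm (fun t ht => ?_) hST
  by_contra hne
  obtain ⟨y, hy, hty⟩ := h₂ b t hne
  exact hty (hT ht (hST hy) fun h => hne (by rw [h]; exact hy))

end Criteria


namespace SymSpace

open Filter Topology

variable {P : SymSpace}

/-! ### Distinct points of a fiber are transverse -/

lemma exists_unit_of_annihilator {W : Submodule ℝ V} (hW : IsAnnihilator W) (hne : W ≠ ⊥) :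
    ∃ a ∈ W.map P.proj, q a a = 1 :=
  exists_unit map_proj_le (by
    rw [finrank_map_proj hW]
    exact Nat.pos_of_ne_zero fun h0 => hne (Submodule.finrank_eq_zero.1 h0))

/-- Distinct annihilator subspaces with the same projection differ over every unit vector. -/
lemma exists_distinct {W W' : Submodule ℝ V} (hW : IsAnnihilator W) (hW' : IsAnnihilator W')
    (h : W.map P.proj = W'.map P.proj) (hne : W ≠ W') {a : V} (ha : a ∈ W.map P.proj)
    (haa : q a a = 1) : ∃ b ∈ P.perp, ∃ b' ∈ P.perp, -1 < q b b' ∧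
      (∀ x ∈ W.map P.proj, graphMap a b x ∈ W) ∧ ∀ x ∈ W.map P.proj, graphMap a b' x ∈ W' := by
  obtain ⟨b, hb, bb, hab⟩ := exists_add_mem hW ha haa
  obtain ⟨b', hb', bb', hab'⟩ := exists_add_mem hW' (h ▸ ha) haa
  have e := eq_map_graphMap hW (map_proj_le ha) hb haa hab
  have e' := eq_map_graphMap hW' (map_proj_le ha) hb' haa hab'
  rw [← h] at e'
  refine ⟨b, hb, b', hb', ?_, fun x hx => e.ge (Submodule.mem_map_of_mem hx),
    fun x hx => e'.ge (Submodule.mem_map_of_mem hx)⟩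
  -- The parameters differ, so `q (b - b') (b - b') = -2 - 2 * q b b'` is negative.
  have hbb : b - b' ≠ 0 := fun h0 => hne (by rw [e, e', sub_eq_zero.1 h0])
  have h1 := q_neg (P.perp.sub_mem hb hb') hbb
  simp only [map_sub, LinearMap.sub_apply, bb, bb', q_comm b' b] at h1
  linarith

/-- Over a common unit vector `a`, `q (a + b) (a + b') = 1 + q b b' > 0`. -/
lemma lineOpposite_of_ne {W W' : Submodule ℝ V} (hW : IsAnnihilator W) (hW' : IsAnnihilator W')
    (h0 : W ≠ ⊥) (h : W.map P.proj = W'.map P.proj) (hne : W ≠ W') : LineOpposite W W' := by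
  obtain ⟨a, ha, haa⟩ := exists_unit_of_annihilator (P := P) hW h0
  obtain ⟨b, hb, b', hb', hbb, hm, hm'⟩ := exists_distinct hW hW' h hne ha haa
  have haP : a ∈ P.1 := map_proj_le ha
  refine ⟨_, hm a ha, _, hm' a ha, ?_⟩
  rw [graphMap_self haP hb haa, graphMap_self haP hb' haa]
  simp only [map_add, LinearMap.add_apply, haa, q_eq_zero haP hb', q_eq_zero' haP hb]
  linarith

/-- For an orthonormal basis `a`, `c` of the common projection put `m = q b (a × (c × b'))`. The
pairing has diagonal entries `1 + q b b'` and off-diagonal entries `-m` and `m`, so its determinant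
is `(1 + q b b')² + m² > 0`. -/
lemma planeOpposite_of_ne {W W' : Submodule ℝ V} (hW : IsAnnihilator W) (hW' : IsAnnihilator W')
    (hd : Module.finrank ℝ W = 2) (h : W.map P.proj = W'.map P.proj) (hne : W ≠ W') :
    PlaneOpposite W W' := by
  have h0 : W ≠ ⊥ := fun h => by rw [h, finrank_bot] at hd; norm_num at hd
  obtain ⟨a, ha, haa⟩ := exists_unit_of_annihilator (P := P) hW h0
  obtain ⟨c, hc, hcc, hac⟩ := exists_orthogonal (P := P) map_proj_le
    (by rw [finrank_map_proj hW, hd]; norm_num) ha haa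
  obtain ⟨b, hb, b', hb', hbb, hm, hm'⟩ := exists_distinct hW hW' h hne ha haa
  have haP : a ∈ P.1 := map_proj_le ha
  have hcP : c ∈ P.1 := map_proj_le hc
  refine ⟨_, hm a ha, _, hm c hc, _, hm' a ha, _, hm' c hc, ?_⟩
  have hcb := cross_mem_perp hcP hb
  have hcb' := cross_mem_perp hcP hb'
  have hacb := cross_mem_perp haP hcb
  have hacb' := cross_mem_perp haP hcb'
  have k₁ : q (cross a (cross c b)) b' = -q b (cross a (cross c b')) := by
    rw [q_cross_left_eq, q_cross_left_eq, neg_neg,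
      cross_cross_of_orthogonal (by rw [q_comm, hac]) (q_eq_zero hcP hb') (q_eq_zero haP hb'),
      map_neg]
  have k₂ : q (cross a (cross c b)) (cross a (cross c b')) = q b b' := by
    rw [q_cross_cross_polar, q_cross_cross_polar, haa, hcc, q_eq_zero haP hcb,
      q_eq_zero hcP hb]
    ring
  rw [graphMap_self haP hb haa, graphMap_self haP hb' haa, graphMap_apply, graphMap_apply]
  simp only [map_add, map_sub, LinearMap.add_apply, LinearMap.sub_apply, haa, hcc, hac, k₁, k₂,
    q_comm c a, q_eq_zero haP hb', q_eq_zero' haP hb, q_eq_zero hcP hb', q_eq_zero' hcP hb,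
    q_eq_zero haP hacb', q_eq_zero' haP hacb, q_eq_zero hcP hacb', q_eq_zero' hcP hacb]
  have : 0 < (1 + q b b') * (1 + q b b') := mul_pos (by linarith) (by linarith)
  nlinarith [mul_self_nonneg (q b (cross a (cross c b'))), this]

/-! ### Paths in `H_P` and pairs that are not transverse -/

/-- A rotation in a plane of `P^⊥` as a path in `H_P`. -/
lemma exists_path {d d' : V} (hd : d ∈ P.perp) (hd' : d' ∈ P.perp) (hdd : q d d = -1)
    (hdd' : q d' d' = -1) (h0 : q d d' = 0) (θ₀ : ℝ) :
    ∃ h : ℝ → P.H, h θ₀ = 1 ∧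
      (∀ θ, lin (h θ).1 (Real.cos θ₀ • d + Real.sin θ₀ • d') = Real.cos θ • d + Real.sin θ • d') ∧
      ∀ θ, AnalyticNear (id : ℝ → ℝ) (fun θ => P.hEmb (h θ)) θ := by
  have hb : ∀ θ : ℝ, Real.cos θ • d + Real.sin θ • d' ∈ P.perp := fun θ =>
    P.perp.add_mem (P.perp.smul_mem _ hd) (P.perp.smul_mem _ hd')
  have hbb : ∀ θ : ℝ, q (Real.cos θ • d + Real.sin θ • d') (Real.cos θ • d + Real.sin θ • d') =
      -1 := fun θ => by
    simp only [map_add, map_smul, LinearMap.add_apply, LinearMap.smul_apply, hdd, hdd', h0,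
      q_comm d' d, smul_eq_mul]
    linear_combination -Real.sin_sq_add_cos_sq θ
  obtain ⟨T, hT, hTe, hex⟩ := exists_transport (hb θ₀) (hbb θ₀)
  choose h hh using fun θ => hex _ (hb θ) (hbb θ)
  refine ⟨h, H_eq_one (hb θ₀) (hbb θ₀) (hh θ₀), hh, fun θ => ?_⟩
  have h1 : AnalyticNear (id : ℝ → ℝ) (fun θ : ℝ => Real.cos θ • d + Real.sin θ • d') θ :=
    .of_contDiffAt ((Real.contDiff_cos.smul contDiff_const).add
      (Real.contDiff_sin.smul contDiff_const)).contDiffAt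
  refine (h1.comp hT.contDiffAt).congr (Eventually.of_forall fun θ => ?_)
  rw [← hTe, hh]

lemma exists_orthogonal_perp {d : V} (hd : d ∈ P.perp) (hdd : q d d = -1) :
    ∃ d' ∈ P.perp, q d' d' = -1 ∧ q d d' = 0 := by
  obtain ⟨x, hx, -, -, xx, -⟩ := P.exists_orthonormal_pair
  refine ⟨cross x d, cross_mem_perp hx hd, ?_, ?_⟩
  · rw [q_cross_cross, xx, hdd, q_eq_zero hx hd]; norm_num
  · rw [q_comm, q_cross_right]

lemma eq_span_of_finrank_eq_one {U : Submodule ℝ V} (hd : Module.finrank ℝ U = 1) {a : V}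
    (ha : a ∈ U) (haa : q a a = 1) : U = Submodule.span ℝ {a} :=
  eq_span_singleton hd ha (ne_zero_of_q (by rw [haa]; norm_num)).1 ⟨1, one_ne_zero, by simp⟩

/-- For an isotropic line outside a fiber there is a line in the fiber orthogonal to it, and this
is destroyed by small motions. -/
lemma exists_orthogonal_ein (ℓ : Ein) (U : P.Gr 1) (hne : P.einProj ℓ ≠ U) :
    ∃ ℓ' : Ein, P.einProj ℓ' = U ∧ ¬LineOpposite ℓ.1 ℓ'.1 ∧ ∃ (h : ℝ → P.H) (θ₀ : ℝ), h θ₀ = 1 ∧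
      (∀ θ, AnalyticNear (id : ℝ → ℝ) (fun θ => P.hEmb (h θ)) θ) ∧
      ∀ᶠ θ in 𝓝[≠] θ₀, LineOpposite ℓ.1 (h θ • ℓ').1 := by
  obtain ⟨a, ha, haa⟩ := exists_unit U.2.1 (by rw [U.2.2]; norm_num)
  obtain ⟨c, hc, hcc⟩ := exists_unit_of_annihilator (P := P) ℓ.isAnnihilator (ein_ne_bot ℓ)
  obtain ⟨d, hd, hdd, hcd⟩ := exists_add_mem ℓ.isAnnihilator hc hcc
  have haP := U.2.1 ha
  have hcP : c ∈ P.1 := map_proj_le hc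
  obtain ⟨d', hd', hdd', h0⟩ := exists_orthogonal_perp hd hdd
  have hspan : U.1 = Submodule.span ℝ {a} := eq_span_of_finrank_eq_one U.2.2 ha haa
  have hspan' : (P.einProj ℓ).1 = Submodule.span ℝ {c} :=
    eq_span_of_finrank_eq_one (P.einProj ℓ).2.2 hc hcc
  -- Distinct lines in the definite space `P` give `c ≠ ±a`, hence strict inequality in
  -- Cauchy–Schwarz on both sides.
  have k₁ : q c a < 1 := by
    have : c - a ≠ 0 := fun h => hne (Subtype.ext (by
      rw [hspan, hspan', sub_eq_zero.1 h]))
    have := P.2.2.1 _ (P.1.sub_mem hcP haP) this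
    simp only [map_sub, LinearMap.sub_apply, haa, hcc, q_comm a c] at this
    linarith
  have k₂ : -1 < q c a := by
    have : c + a ≠ 0 := fun h => hne (Subtype.ext (by
      rw [hspan, hspan', eq_neg_of_add_eq_zero_left h, ← Set.neg_singleton, Submodule.span_neg]))
    have := P.2.2.1 _ (P.1.add_mem hcP haP) this
    simp only [map_add, LinearMap.add_apply, haa, hcc, q_comm a c] at this
    linarith
  -- The pairing of `c + d` with `a + cos θ d + sin θ d'` is `q c a - cos θ`. It vanishes at `θ₀`,
  -- which is interior to `[0, π]`, where the cosine is injective; so it is nonzero at nearby `θ ≠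
  -- θ₀`.
  set θ₀ := Real.arccos (q c a) with hθ₀
  have hcos : Real.cos θ₀ = q c a := Real.cos_arccos k₂.le k₁.le
  have hθ : θ₀ ∈ Set.Ioo 0 Real.pi := by
    refine ⟨Real.arccos_pos.2 k₁, lt_of_le_of_ne (Real.arccos_le_pi _) fun h => ?_⟩
    rw [h, Real.cos_pi] at hcos
    linarith
  obtain ⟨h, h1, h2, h3⟩ := exists_path hd hd' hdd hdd' h0 θ₀
  have hb : ∀ θ : ℝ, Real.cos θ • d + Real.sin θ • d' ∈ P.perp := fun θ =>
    P.perp.add_mem (P.perp.smul_mem _ hd) (P.perp.smul_mem _ hd')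
  have hbb : q (Real.cos θ₀ • d + Real.sin θ₀ • d') (Real.cos θ₀ • d + Real.sin θ₀ • d') = -1 := by
    simp only [map_add, map_smul, LinearMap.add_apply, LinearMap.smul_apply, hdd, hdd', h0,
      q_comm d' d, smul_eq_mul]
    linear_combination -Real.sin_sq_add_cos_sq θ₀
  obtain ⟨ℓ', hℓ'⟩ := exists_ein U.2.1 U.2.2 ha (hb θ₀) haa hbb
  have hq : ∀ θ, q (c + d) (a + (Real.cos θ • d + Real.sin θ • d')) = q c a - Real.cos θ := by
    intro θ
    simp only [map_add, map_smul, LinearMap.add_apply, hdd, h0, q_eq_zero' haP hd,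
      q_eq_zero hcP hd, q_eq_zero hcP hd', smul_eq_mul]
    ring
  have hmem : a + (Real.cos θ₀ • d + Real.sin θ₀ • d') ∈ ℓ'.1 := by
    rw [hℓ', ← graphMap_self haP (hb θ₀) haa]
    exact Submodule.mem_map_of_mem ha
  have hℓs : ℓ.1 = Submodule.span ℝ {c + d} := by
    refine eq_span_singleton ℓ.2.1 hcd (fun e => ?_) ⟨1, one_ne_zero, by simp⟩
    have := (add_eq_add hcP P.1.zero_mem hd P.perp.zero_mem (by rw [e, add_zero])).1
    rw [this] at hcc
    simp at hcc
  refine ⟨ℓ', Subtype.ext ?_, ?_, h, θ₀, h1, h3, ?_⟩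
  · change ℓ'.1.map P.proj = _
    rw [hℓ', map_proj_map_graphMap U.2.1 haP (hb θ₀)]
  · rintro ⟨v, hv, w, hw, hvw⟩
    rw [hℓs, Submodule.mem_span_singleton] at hv
    rw [hℓ', hspan, Submodule.map_span, Set.image_singleton, ContinuousLinearMap.coe_coe,
      graphMap_self haP (hb θ₀) haa, Submodule.mem_span_singleton] at hw
    obtain ⟨r, rfl⟩ := hv
    obtain ⟨r', rfl⟩ := hw
    apply hvw
    have hq₀ := hq θ₀
    rw [hcos, sub_self, ← hcos] at hq₀
    simp only [map_smul, LinearMap.smul_apply, hq₀, smul_zero]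
  · have hev : ∀ᶠ θ in 𝓝[≠] θ₀, θ ∈ Set.Ioo 0 Real.pi :=
      nhdsWithin_le_nhds (isOpen_Ioo.mem_nhds hθ)
    filter_upwards [hev, self_mem_nhdsWithin] with θ h4 h5
    refine ⟨c + d, hcd, a + (Real.cos θ • d + Real.sin θ • d'), ?_, ?_⟩
    · exact ⟨_, hmem, by rw [map_add, (h θ).2 a haP, h2]⟩
    · rw [hq, ← hcos, sub_ne_zero]
      intro e
      exact h5 (Real.injOn_cos ⟨h4.1.le, h4.2.le⟩ ⟨hθ.1.le, hθ.2.le⟩ e.symm)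

/-- For an annihilator photon outside a fiber there is a photon in the fiber that meets it, and
this is destroyed by small motions. -/
lemma exists_meeting_pho (W : Pho) (U : P.Gr 2) (hne : P.phoProj W ≠ U) :
    ∃ W' : Pho, P.phoProj W' = U ∧ W.plane ⊓ W'.plane ≠ ⊥ ∧ ∃ (h : ℝ → P.H) (θ₀ : ℝ), h θ₀ = 1 ∧
      (∀ θ, AnalyticNear (id : ℝ → ℝ) (fun θ => P.hEmb (h θ)) θ) ∧
      ∀ᶠ θ in 𝓝[≠] θ₀, W.plane ⊓ (h θ • W').plane = ⊥ := by
  -- Two distinct planes of the 3-space `P` meet in a line. The photon over `U` is chosen to share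
  -- with `W` the vector over that line.
  have hdim : Module.finrank ℝ ((P.phoProj W).1 ⊓ U.1 : Submodule ℝ V) = 1 := by
    have h1 := Submodule.finrank_sup_add_finrank_inf_eq (P.phoProj W).1 U.1
    have h2 : Module.finrank ℝ ((P.phoProj W).1 ⊔ U.1 : Submodule ℝ V) ≤ 3 :=
      (Submodule.finrank_mono (sup_le (P.phoProj W).2.1 U.2.1)).trans_eq P.2.1
    have h3 : Module.finrank ℝ ((P.phoProj W).1 ⊓ U.1 : Submodule ℝ V) < 2 := by
      by_contra hge
      have e1 : ((P.phoProj W).1 ⊓ U.1 : Submodule ℝ V) = (P.phoProj W).1 :=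
        Submodule.eq_of_le_of_finrank_le inf_le_left (by rw [(P.phoProj W).2.2]; omega)
      have e2 : ((P.phoProj W).1 ⊓ U.1 : Submodule ℝ V) = U.1 :=
        Submodule.eq_of_le_of_finrank_le inf_le_right (by rw [U.2.2]; omega)
      exact hne (Subtype.ext (e1.symm.trans e2))
    rw [(P.phoProj W).2.2, U.2.2] at h1
    omega
  obtain ⟨a, ha, haa⟩ := exists_unit (P := P) (U := (P.phoProj W).1 ⊓ U.1)
    (inf_le_right.trans U.2.1) (by rw [hdim]; norm_num)
  have haP := U.2.1 ha.2
  obtain ⟨b, hb, hbb, hab⟩ := exists_add_mem W.isAnnihilator ha.1 haa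
  obtain ⟨d', hd', hdd', h0⟩ := exists_orthogonal_perp hb hbb
  obtain ⟨h, h1, h2, h3⟩ := exists_path hb hd' hbb hdd' h0 0
  obtain ⟨W', hW'⟩ := exists_pho U.2.1 U.2.2 ha.2 hb haa hbb
  have hab' : a + b ∈ W'.plane := by
    rw [hW', ← graphMap_self haP hb haa]
    exact Submodule.mem_map_of_mem ha.2
  have hproj : W'.plane.map P.proj = U.1 := by
    rw [hW', map_proj_map_graphMap U.2.1 haP hb]
  refine ⟨W', Subtype.ext hproj, fun hbot => ?_, h, 0, h1, h3, ?_⟩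
  · have : a + b ∈ W.plane ⊓ W'.plane := ⟨hab, hab'⟩
    rw [hbot, Submodule.mem_bot] at this
    have := (add_eq_add haP P.1.zero_mem hb P.perp.zero_mem (by rw [this, add_zero])).1
    rw [this] at haa
    simp at haa
  · have hev : ∀ᶠ θ in 𝓝[≠] (0 : ℝ), θ ∈ Set.Ioo (-Real.pi) Real.pi :=
      nhdsWithin_le_nhds (isOpen_Ioo.mem_nhds ⟨by linarith [Real.pi_pos], Real.pi_pos⟩)
    filter_upwards [hev, self_mem_nhdsWithin] with θ h4 h5
    rw [Submodule.eq_bot_iff]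
    rintro w ⟨hw, hw'⟩
    -- A common vector `w` projects to the intersection of the two planes. Hence it is the multiple
    -- by the same `r` of both `a + b` and `a + cos θ b + sin θ d'`, and the `d'`-component gives `r
    -- sin θ = 0`.
    have hpw : P.proj w ∈ Submodule.span ℝ {a} := by
      rw [← eq_span_of_finrank_eq_one hdim ha haa]
      refine ⟨⟨w, hw, rfl⟩, ?_⟩
      rw [SetLike.mem_coe, ← hproj, ← map_proj_map_lin (h θ)]
      exact ⟨w, hw', rfl⟩
    obtain ⟨r, hr⟩ := Submodule.mem_span_singleton.1 hpw
    have hpa : P.proj (a + b) = a := proj_add haP hb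
    have e1 : w = r • (a + b) := proj_injOn (P := P) W.isAnnihilator hw (W.plane.smul_mem _ hab) (by
      rw [map_smul, hpa, hr])
    have e2 : w = r • lin (h θ).1 (a + b) :=
      proj_injOn (P := P) (h θ • W').isAnnihilator hw'
        ((h θ • W').plane.smul_mem _ (Submodule.mem_map_of_mem hab')) (by
          rw [map_smul, proj_lin, hpa, hr])
    have h6 := h2 θ
    simp only [Real.cos_zero, Real.sin_zero, one_smul, zero_smul, add_zero] at h6
    have h7 : r * Real.sin θ = 0 := by
      have h8 := congrArg (q d') (e1.symm.trans e2)
      rw [map_add, (h θ).2 a haP, h6] at h8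
      simp only [map_smul, map_add, q_comm d' b, h0, hdd', smul_eq_mul, mul_zero] at h8
      linarith
    rcases mul_eq_zero.1 h7 with hr0 | hs
    · rw [e1, hr0, zero_smul]
    · exact absurd ((Real.sin_eq_zero_iff_of_lt_of_lt h4.1 h4.2).1 hs) h5

lemma inf_eq_bot_of_map (g : G2) {W W' : Submodule ℝ V}
    (h : W.map (lin g) ⊓ W'.map (lin g) = ⊥) : W ⊓ W' = ⊥ := by
  rw [← Submodule.map_inf _ (lin_injective g)] at h
  exact Submodule.map_injective_of_injective (lin_injective g) (h.trans (Submodule.map_bot _).symm)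

lemma continuousAt_grEmb_smul {h : ℝ → P.H} {θ₀ : ℝ}
    (hh : ∀ θ, AnalyticNear (id : ℝ → ℝ) (fun θ => P.hEmb (h θ)) θ)
    (W : Submodule ℝ V) : ContinuousAt (fun θ => grEmb (W.map (lin (h θ).1))) θ₀ := by
  have := (analyticNear_smul (W := fun _ => W) (hh θ₀) (.const _) (fun _ => rfl)
    fun _ => rfl).tendsto
  rwa [comap_id] at this

lemma continuous_emb_ein : Continuous (fun ℓ : Ein => grEmb ℓ.1) := continuous_induced_dom

lemma continuous_emb_pho : Continuous (fun W : Pho => grEmb W.plane) := continuous_induced_dom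

lemma continuous_emb_flag : Continuous F12.emb := continuous_induced_dom

/-- The fibers of `Ein → Gr₁(P)` are maximally transverse. -/
theorem maximallyTransverse_ein (U : P.Gr 1) : MaximallyTransverse G2 (P.einProj ⁻¹' {U}) := by
  refine maximallyTransverse_fiber (fun x y hxy hne => ?_) (fun U ℓ hℓ => ?_) U
  · refine transverse_of_transitive (R := fun x y : Ein => LineOpposite x.1 y.1)
      (isOpen_lineOpposite (continuous_emb_ein.comp continuous_fst)
        (continuous_emb_ein.comp continuous_snd)) (fun g x y h => h.map g)
      (fun _ _ _ _ => ein_transitive) ?_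
    exact lineOpposite_of_ne (P := P) x.isAnnihilator y.isAnnihilator (ein_ne_bot x)
      (congrArg Subtype.val hxy) fun h => hne (Subtype.ext h)
  · obtain ⟨ℓ', h1, h2, h, θ₀, h3, h4, h5⟩ := exists_orthogonal_ein ℓ U hℓ
    refine ⟨ℓ', h1, not_transverse_of_path (R := fun x y : Ein => ¬LineOpposite x.1 y.1)
      (fun g x y h hg => h ?_) h2 (γ := fun θ => h θ • ℓ') (θ₀ := θ₀) ?_ (by rw [h3, one_smul]) ?_⟩
    · have := hg.map g⁻¹
      change LineOpposite (g⁻¹ • g • x).1 (g⁻¹ • g • y).1 at this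
      rwa [inv_smul_smul, inv_smul_smul] at this
    · exact (IsInducing.mk rfl : IsInducing (Iso.emb : Ein → _)).continuousAt_iff.2
        (continuousAt_grEmb_smul h4 ℓ'.1)
    · filter_upwards [h5] with θ h6 using not_not.2 h6

/-- The fibers of `Pho → Gr₂(P)` are maximally transverse. -/
theorem maximallyTransverse_pho (U : P.Gr 2) : MaximallyTransverse G2 (P.phoProj ⁻¹' {U}) := by
  refine maximallyTransverse_fiber (fun x y hxy hne => ?_) (fun U W hW => ?_) U
  · refine transverse_of_transitive (R := fun x y : Pho => PlaneOpposite x.plane y.plane)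
      (isOpen_planeOpposite (continuous_emb_pho.comp continuous_fst)
        (continuous_emb_pho.comp continuous_snd)) (fun g x y h => h.map g)
      (fun _ _ _ _ => pho_transitive) ?_
    exact planeOpposite_of_ne (P := P) x.isAnnihilator y.isAnnihilator x.1.2.1
      (congrArg Subtype.val hxy) fun h => hne (pho_ext h)
  · obtain ⟨W', h1, h2, h, θ₀, h3, h4, h5⟩ := exists_meeting_pho W U hW
    refine ⟨W', h1, not_transverse_of_path (R := fun x y : Pho => x.plane ⊓ y.plane ≠ ⊥)
      (fun g x y h hg => h ?_) h2 (γ := fun θ => h θ • W') (θ₀ := θ₀) ?_ (by rw [h3, one_smul]) ?_⟩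
    · exact inf_eq_bot_of_map g hg
    · exact (Topology.IsInducing.mk rfl : Topology.IsInducing Pho.emb).continuousAt_iff.2
        (continuousAt_grEmb_smul h4 W'.plane)
    · filter_upwards [h5] with θ h6 using not_not.2 h6

/-- The fibers of `F₁₂ → Flag(P)` are maximally transverse. -/
theorem maximallyTransverse_flag (U : P.Flag) :
    MaximallyTransverse G2 (P.flagProj ⁻¹' {U}) := by
  have hcont : ∀ {h : ℝ → P.H} {θ₀ : ℝ} (p : F12),
      (∀ θ, AnalyticNear (id : ℝ → ℝ) (fun θ => P.hEmb (h θ)) θ) →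
      ContinuousAt (fun θ => h θ • p) θ₀ := fun p h4 =>
    (Topology.IsInducing.mk rfl : Topology.IsInducing F12.emb).continuousAt_iff.2
    ((continuousAt_grEmb_smul h4 p.line).prodMk (continuousAt_grEmb_smul h4 p.plane))
  refine maximallyTransverse_fiber (fun x y hxy hne => ?_) (fun U p hp => ?_) U
  -- Two points of the fiber differ by some `h ≠ 1`. As `H_P` acts freely on lines and on photons,
  -- both components of the flags differ.
  · obtain ⟨h, rfl⟩ := (isPrincipalBundle_flag.fiber_iff x y).1 hxy
    have hh : h ≠ 1 := fun h1 => hne (by rw [h1, one_smul])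
    refine transverse_of_transitive (R := fun x y : F12 =>
      LineOpposite x.line y.line ∧ PlaneOpposite x.plane y.plane)
      ((isOpen_lineOpposite (continuous_fst.comp (continuous_emb_flag.comp continuous_fst))
        (continuous_fst.comp (continuous_emb_flag.comp continuous_snd))).inter
      (isOpen_planeOpposite (continuous_snd.comp (continuous_emb_flag.comp continuous_fst))
        (continuous_snd.comp (continuous_emb_flag.comp continuous_snd))))
      (fun g x y h => ⟨h.1.map g, h.2.map g⟩) (fun _ _ _ _ => flag_transitive) ⟨?_, ?_⟩
    · refine lineOpposite_of_ne (P := P) x.1.1.isAnnihilator (h • x).1.1.isAnnihilator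
        (ein_ne_bot x.1.1) (map_proj_map_lin h x.line).symm fun e => hh ?_
      exact ein_free h x.1.1 (Subtype.ext e.symm)
    · refine planeOpposite_of_ne (P := P) x.1.2.isAnnihilator (h • x).1.2.isAnnihilator
        x.1.2.1.2.1 (map_proj_map_lin h x.plane).symm fun e => hh ?_
      exact pho_free h x.1.2 (pho_ext e.symm)
  · obtain ⟨p₀, hp₀⟩ := (isPrincipalBundle_flag (P := P)).surjective U
    by_cases hℓ : P.einProj p.1.1 = U.1.1
    · have hW : P.phoProj p.1.2 ≠ U.1.2 := fun e => hp (Subtype.ext (Prod.ext hℓ e))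
      obtain ⟨W', h1, h2, h, θ₀, h3, h4, h5⟩ := exists_meeting_pho p.1.2 U.1.2 hW
      -- Photons over the same plane form one `H_P`-orbit, so some `k` moves the flag `p₀`, within
      -- its fiber, to one whose photon is `W'`. The other case does the same with lines.
      obtain ⟨k, rfl⟩ := (isPrincipalBundle_pho.fiber_iff p₀.1.2 W').1
        ((congrArg (fun U : P.Flag => U.1.2) hp₀).trans h1.symm)
      refine ⟨k • p₀, by rw [flagProj_smul, hp₀],
        not_transverse_of_path (R := fun x y : F12 => x.plane ⊓ y.plane ≠ ⊥)
        (fun g x y h hg => h ?_) h2 (γ := fun θ => h θ • k • p₀) (θ₀ := θ₀) (hcont _ h4)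
        (by rw [h3, one_smul]) ?_⟩
      · exact inf_eq_bot_of_map g hg
      · filter_upwards [h5] with θ h6 using not_not.2 h6
    · obtain ⟨ℓ', h1, h2, h, θ₀, h3, h4, h5⟩ := exists_orthogonal_ein p.1.1 U.1.1 hℓ
      obtain ⟨k, rfl⟩ := (isPrincipalBundle_ein.fiber_iff p₀.1.1 ℓ').1
        ((congrArg (fun U : P.Flag => U.1.1) hp₀).trans h1.symm)
      refine ⟨k • p₀, by rw [flagProj_smul, hp₀],
        not_transverse_of_path (R := fun x y : F12 => ¬LineOpposite x.line y.line)
        (fun g x y h hg => h ?_) h2 (γ := fun θ => h θ • k • p₀) (θ₀ := θ₀) (hcont _ h4)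
        (by rw [h3, one_smul]) ?_⟩
      · have := hg.map g⁻¹
        change LineOpposite (g⁻¹ • g • x).line (g⁻¹ • g • y).line at this
        rwa [inv_smul_smul, inv_smul_smul] at this
      · filter_upwards [h5] with θ h6 using not_not.2 h6

end SymSpace


/-! ### Isometries -/

lemma diagForm_apply {n : ℕ} (w : Fin n → ℝ) (x y : EuclideanSpace ℝ (Fin n)) :
    diagForm w x y = ∑ i, w i * x i * y i := rfl

lemma IsIsometric.injective {n : ℕ} {w : Fin n → ℝ} {f : EuclideanSpace ℝ (Fin n) →ₗ[ℝ] V}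
    (hf : IsIsometric w f) (hw : ∀ i, w i ≠ 0) : Function.Injective f := by
  rw [injective_iff_map_eq_zero]
  intro x hx
  ext i
  have h := hf x (EuclideanSpace.single i 1)
  rw [hx, diagForm_apply, Finset.sum_eq_single i] at h
  · simpa [hw i] using h
  · intro j _ hj
    simp [hj]
  · simp

lemma w14_ne_zero (i : Fin 5) : w14 i ≠ 0 := by fin_cases i <;> simp [w14]

lemma w24_ne_zero (i : Fin 6) : w24 i ≠ 0 := by fin_cases i <;> simp [w24]

/-- An isometric embedding of `ℝ^{1,4}` identifies `Ein^{0,3}` with the isotropic lines in its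
image. -/
lemma IsIsometric.exists_ein_diffeo {f : EuclideanSpace ℝ (Fin 5) →ₗ[ℝ] V} (hf : IsIsometric w14 f)
    {S : Set Ein} (hS : S = {ℓ : Ein | ℓ.1 ≤ LinearMap.range f}) :
    ∃ Φ : Ein03 ≃ S, IsDiffeo Iso.emb (fun ℓ => Iso.emb ℓ.1) Φ ∧ ∀ ℓ, (Φ ℓ).1.1 = ℓ.1.map f := by
  have hi := hf.injective w14_ne_zero
  obtain ⟨k, hk⟩ := LinearMap.exists_leftInverse_of_injective f (LinearMap.ker_eq_bot.2 hi)
  have hfk : ∀ v ∈ LinearMap.range f, f (k v) = v := by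
    rintro _ ⟨x, rfl⟩
    exact congrArg f (LinearMap.congr_fun hk x)
  have hdim : ∀ X : Submodule ℝ (EuclideanSpace ℝ (Fin 5)),
      Module.finrank ℝ (X.map f) = Module.finrank ℝ X := fun X =>
    (Submodule.equivMapOfInjective f hi X).finrank_eq.symm
  have hle : ∀ ℓ : S, ℓ.1.1 ≤ LinearMap.range f := fun ℓ => hS.le ℓ.2
  have hback : ∀ ℓ : S, (ℓ.1.1.map k).map f = ℓ.1.1 := fun ℓ => by
    ext v
    constructor
    · rintro ⟨_, ⟨v, hv, rfl⟩, rfl⟩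
      rw [hfk v (hle ℓ hv)]; exact hv
    · intro hv
      exact ⟨_, ⟨v, hv, rfl⟩, hfk v (hle ℓ hv)⟩
  let Φ : Ein03 ≃ S :=
    { toFun := fun ℓ => ⟨⟨ℓ.1.map f, (hdim _).trans ℓ.2.1, by
          rintro _ ⟨x, hx, rfl⟩ _ ⟨y, hy, rfl⟩
          exact (hf x y).trans (ℓ.2.2 x hx y hy)⟩, by
          rw [hS]
          exact LinearMap.map_le_range⟩
      invFun := fun ℓ => ⟨ℓ.1.1.map k, by rw [← hdim, hback]; exact ℓ.1.2.1, by
          rintro _ ⟨x, hx, rfl⟩ _ ⟨y, hy, rfl⟩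
          rw [← hf, hfk x (hle ℓ hx), hfk y (hle ℓ hy)]
          exact ℓ.1.2.2 x hx y hy⟩
      left_inv := fun ℓ => Subtype.ext (by
        change (ℓ.1.map f).map k = ℓ.1
        rw [← Submodule.map_comp, hk, Submodule.map_id])
      right_inv := fun ℓ => Subtype.ext (Subtype.ext (hback ℓ)) }
  refine ⟨Φ, ⟨smoothMap_of_analyticNear fun ℓ₀ => ?_, smoothMap_of_analyticNear fun ℓ₀ => ?_⟩,
    fun _ => rfl⟩
  · exact AnalyticNear.grEmb_map (W := fun ℓ : Ein03 => ℓ.1)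
      (.const (LinearMap.toContinuousLinearMap f)) .emb (fun _ => rfl)
      fun ℓ => (Φ ℓ).1.2.1.trans (Φ ℓ₀).1.2.1.symm
  · exact AnalyticNear.grEmb_map (W := fun ℓ : S => ℓ.1.1)
      (.const (LinearMap.toContinuousLinearMap k)) .emb (fun _ => rfl)
      fun ℓ => (Φ.symm ℓ).2.1.trans (Φ.symm ℓ₀).2.1.symm

/-- The standard inclusion `ℝ^{1,4} → ℝ^{3,4}`. -/
def incl14 : EuclideanSpace ℝ (Fin 5) →ₗ[ℝ] V where
  toFun t := !₂[t 0, 0, 0, t 1, t 2, t 3, t 4]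
  map_add' x y := by ext i; fin_cases i <;> simp
  map_smul' c x := by ext i; fin_cases i <;> simp

/-- The standard inclusion `ℝ^{2,4} → ℝ^{3,4}`. -/
def incl24 : EuclideanSpace ℝ (Fin 6) →ₗ[ℝ] V where
  toFun t := !₂[t 0, t 1, 0, t 2, t 3, t 4, t 5]
  map_add' x y := by ext i; fin_cases i <;> simp
  map_smul' c x := by ext i; fin_cases i <;> simp

lemma incl14_apply (t : EuclideanSpace ℝ (Fin 5)) :
    incl14 t = !₂[t 0, 0, 0, t 1, t 2, t 3, t 4] := rfl

lemma incl24_apply (t : EuclideanSpace ℝ (Fin 6)) :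
    incl24 t = !₂[t 0, t 1, 0, t 2, t 3, t 4, t 5] := rfl

lemma isIsometric_incl14 (g : G2) : IsIsometric w14 (lin g ∘ₗ incl14) := fun x y => by
  rw [LinearMap.comp_apply, LinearMap.comp_apply, q_lin, q_apply, diagForm_apply, incl14_apply,
    incl14_apply]
  simp [w14, Fin.sum_univ_succ]
  ring

lemma isIsometric_incl24 (g : G2) : IsIsometric w24 (lin g ∘ₗ incl24) := fun x y => by
  rw [LinearMap.comp_apply, LinearMap.comp_apply, q_lin, q_apply, diagForm_apply, incl24_apply,
    incl24_apply]
  simp [w24, Fin.sum_univ_succ]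
  ring

lemma mem_range_incl14 {v : V} : v ∈ LinearMap.range incl14 ↔ v 1 = 0 ∧ v 2 = 0 := by
  constructor
  · rintro ⟨t, rfl⟩
    simp [incl14_apply]
  · rintro ⟨h1, h2⟩
    refine ⟨!₂[v 0, v 3, v 4, v 5, v 6], ?_⟩
    rw [incl14_apply]
    ext i; fin_cases i <;> simp [h1, h2]

lemma mem_range_incl24 {v : V} : v ∈ LinearMap.range incl24 ↔ v 2 = 0 := by
  constructor
  · rintro ⟨t, rfl⟩
    simp [incl24_apply]
  · intro h2
    refine ⟨!₂[v 0, v 1, v 3, v 4, v 5, v 6], ?_⟩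
    rw [incl24_apply]
    ext i; fin_cases i <;> simp [h2]

/-- The coordinates of an element of `ℝ^{3,4}` as a sum of its two components. -/
lemma eq_add_components (v : V) :
    v = !₂[v 0, v 1, v 2, 0, 0, 0, 0] + !₂[0, 0, 0, v 3, v 4, v 5, v 6] := by
  ext i; fin_cases i <;> simp

namespace SymSpace

variable {P : SymSpace}

/-- The frame of a triad with first vector in `U` and third in `P^⊥` carries `ℝ e₀ ⊕ (0 ⊕ ℍ)` onto
`U ⊕ P^⊥`. -/
lemma exists_isometry14 (U : P.Gr 1) : ∃ f : EuclideanSpace ℝ (Fin 5) →ₗ[ℝ] V, IsIsometric w14 f ∧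
    LinearMap.range f = U.1 ⊔ P.perp := by
  obtain ⟨a, ha, haa⟩ := exists_unit U.2.1 (by rw [U.2.2]; norm_num)
  have haP := U.2.1 ha
  obtain ⟨y, hy, hyy, hay⟩ := exists_orthogonal (P := P) le_rfl (by rw [P.2.1]; norm_num) haP haa
  obtain ⟨z, hz, hzz⟩ := P.exists_mem_perp
  have ht := isTriad haP hy hz haa hyy hay hzz
  have had := adapted_frame ht haP hy hz
  refine ⟨lin ht.frame ∘ₗ incl14, isIsometric_incl14 _, ?_⟩
  rw [LinearMap.range_comp]
  apply le_antisymm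
  · rintro _ ⟨v, hv, rfl⟩
    obtain ⟨h1, h2⟩ := mem_range_incl14.1 hv
    rw [eq_add_components v, map_add]
    refine Submodule.add_mem_sup ?_ ((had.2 _).2 (by simp))
    rw [ht.lin_frame, frameMap_apply]
    simpa [h1, h2] using U.1.smul_mem (v 0) ha
  · refine sup_le ?_ fun v hv => ?_
    · rw [eq_span_of_finrank_eq_one U.2.2 ha haa, Submodule.span_le]
      rintro _ rfl
      refine ⟨EuclideanSpace.single 0 1, mem_range_incl14.2 (by simp), ?_⟩
      rw [ht.lin_frame, frameMap_apply]
      simp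
    · refine ⟨lin ht.frame⁻¹ v, mem_range_incl14.2 ?_, lin_apply_inv _ _⟩
      exact ((had.2 _).1 (by rwa [lin_apply_inv])).2

/-- The sum `U ⊕ P^⊥` in adapted coordinates. -/
lemma exists_map_range_incl24 (U : P.Gr 2) :
    ∃ g : G2, (LinearMap.range incl24).map (lin g) = U.1 ⊔ P.perp := by
  obtain ⟨a, ha, haa⟩ := exists_unit U.2.1 (by rw [U.2.2]; norm_num)
  obtain ⟨y, hy, hyy, hay⟩ := exists_orthogonal U.2.1 (by rw [U.2.2]; norm_num) ha haa
  have haP := U.2.1 ha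
  have hyP := U.2.1 hy
  obtain ⟨z, hz, hzz⟩ := P.exists_mem_perp
  have ht := isTriad haP hyP hz haa hyy hay hzz
  have had := adapted_frame ht haP hyP hz
  refine ⟨ht.frame, ?_⟩
  apply le_antisymm
  · rintro _ ⟨v, hv, rfl⟩
    have h2 := mem_range_incl24.1 hv
    rw [eq_add_components v, map_add]
    refine Submodule.add_mem_sup ?_ ((had.2 _).2 (by simp))
    rw [ht.lin_frame, frameMap_apply]
    simpa [h2] using U.1.add_mem (U.1.smul_mem (v 0) ha) (U.1.smul_mem (v 1) hy)
  · refine sup_le ?_ fun v hv => ?_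
    · rw [← eq_span_pair U.2.2 ha hy haa hyy hay, Submodule.span_le]
      rintro _ (rfl | rfl)
      · refine ⟨EuclideanSpace.single 0 1, mem_range_incl24.2 (by simp), ?_⟩
        rw [ht.lin_frame, frameMap_apply]
        simp
      · refine ⟨EuclideanSpace.single 1 1, mem_range_incl24.2 (by simp), ?_⟩
        rw [ht.lin_frame, frameMap_apply]
        simp
    · refine ⟨lin ht.frame⁻¹ v, mem_range_incl24.2 ?_, lin_apply_inv _ _⟩
      exact ((had.2 _).1 (by rwa [lin_apply_inv])).2.2

end SymSpace

/-! ### Subspaces of signature (2,4) -/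

/-- A nonzero normal vector to a subspace of signature `(2,4)` is positive. -/
lemma IsIsometric.q_normal_pos {f : EuclideanSpace ℝ (Fin 6) →ₗ[ℝ] V} (hf : IsIsometric w24 f)
    {v : V} (hv0 : v ≠ 0) (hv : ∀ x, q (f x) v = 0) : 0 < q v v := by
  by_contra hle
  let e : (Fin 4 → ℝ) →ₗ[ℝ] EuclideanSpace ℝ (Fin 6) :=
    { toFun := fun b => !₂[0, 0, b 0, b 1, b 2, b 3]
      map_add' := fun x y => by ext i; fin_cases i <;> simp
      map_smul' := fun c x => by ext i; fin_cases i <;> simp }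
  have hqe : ∀ b, q (f (e b)) (f (e b)) =
      -(b 0 * b 0 + b 1 * b 1 + b 2 * b 2 + b 3 * b 3) := fun b => by
    rw [hf, diagForm_apply]
    simp [e, w24, Fin.sum_univ_succ]
    ring
  let c : V →ₗ[ℝ] (Fin 4 → ℝ) :=
    { toFun := fun x => ![x 3, x 4, x 5, x 6]
      map_add' := fun x y => by ext i; fin_cases i <;> simp
      map_smul' := fun c x => by ext i; fin_cases i <;> simp }
  -- The negative 4-space of the image together with `v` has five parameters, against four negative
  -- coordinates. Some nonzero combination thus has `q ≥ 0`; if `q v v ≤ 0` it also has `q ≤ 0`, and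
  -- every coefficient is forced to vanish.
  let L : (Fin 4 → ℝ) × ℝ →ₗ[ℝ] V := (f ∘ₗ e).coprod (LinearMap.toSpanSingleton ℝ V v)
  have hker : LinearMap.ker (c ∘ₗ L) ≠ ⊥ := LinearMap.ker_ne_bot_of_finrank_lt (by simp)
  obtain ⟨⟨b, t⟩, hbt, hne⟩ := Submodule.exists_mem_ne_zero_of_ne_bot hker
  have hc : c (L (b, t)) = 0 := LinearMap.mem_ker.1 hbt
  set u := L (b, t) with hu
  have hu' : u = f (e b) + t • v := by simp [hu, L]
  have u3 : u 3 = 0 := congrFun hc 0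
  have u4 : u 4 = 0 := congrFun hc 1
  have u5 : u 5 = 0 := congrFun hc 2
  have u6 : u 6 = 0 := congrFun hc 3
  have hquu : q u u = u 0 * u 0 + u 1 * u 1 + u 2 * u 2 := by
    rw [q_apply, u3, u4, u5, u6]; ring
  have hquu' : q u u = -(b 0 * b 0 + b 1 * b 1 + b 2 * b 2 + b 3 * b 3) + t * t * q v v := by
    rw [hu']
    simp only [map_add, map_smul, LinearMap.add_apply, LinearMap.smul_apply, hqe, hv,
      q_comm v (f (e b)), smul_eq_mul]
    ring
  have hvv : t * t * q v v ≤ 0 := mul_nonpos_of_nonneg_of_nonpos (mul_self_nonneg t) (not_lt.1 hle)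
  have n0 := mul_self_nonneg (u 0)
  have n1 := mul_self_nonneg (u 1)
  have n2 := mul_self_nonneg (u 2)
  have m0 := mul_self_nonneg (b 0)
  have m1 := mul_self_nonneg (b 1)
  have m2 := mul_self_nonneg (b 2)
  have m3 := mul_self_nonneg (b 3)
  have u0 : u 0 = 0 := mul_self_eq_zero.1 (by linarith)
  have u1 : u 1 = 0 := mul_self_eq_zero.1 (by linarith)
  have u2 : u 2 = 0 := mul_self_eq_zero.1 (by linarith)
  have b0 : b 0 = 0 := mul_self_eq_zero.1 (by linarith)
  have b1 : b 1 = 0 := mul_self_eq_zero.1 (by linarith)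
  have b2 : b 2 = 0 := mul_self_eq_zero.1 (by linarith)
  have b3 : b 3 = 0 := mul_self_eq_zero.1 (by linarith)
  have hb : b = 0 := by ext i; fin_cases i <;> simp [b0, b1, b2, b3]
  have hu0 : u = 0 := by ext i; fin_cases i <;> simp [u0, u1, u2, u3, u4, u5, u6]
  rw [hu0, hb, map_zero, map_zero, zero_add] at hu'
  have ht : t = 0 := (smul_eq_zero.1 hu'.symm).resolve_right hv0
  exact hne (by rw [hb, ht]; rfl)

/-- `G₂'` is transitive on subspaces of signature `(2,4)`. -/
lemma IsIsometric.exists_map_range_incl24 {f : EuclideanSpace ℝ (Fin 6) →ₗ[ℝ] V}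
    (hf : IsIsometric w24 f) :
    ∃ g : G2, (LinearMap.range incl24).map (lin g) = LinearMap.range f := by
  obtain ⟨v, hv, hvv⟩ : ∃ v, (∀ x, q (f x) v = 0) ∧ q v v = 1 := by
    let L : V →ₗ[ℝ] (EuclideanSpace ℝ (Fin 6) →ₗ[ℝ] ℝ) := (LinearMap.lcomp ℝ ℝ f) ∘ₗ q
    have hker : LinearMap.ker L ≠ ⊥ := LinearMap.ker_ne_bot_of_finrank_lt (by
      rw [Module.finrank_linearMap]; simp)
    obtain ⟨v, hv, hv0⟩ := Submodule.exists_mem_ne_zero_of_ne_bot hker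
    have hv' : ∀ x, q (f x) v = 0 := fun x => by
      rw [q_comm]; exact LinearMap.congr_fun (LinearMap.mem_ker.1 hv) x
    obtain ⟨c, -, hc⟩ := exists_smul_q_eq_one (hf.q_normal_pos hv0 hv')
    exact ⟨c • v, fun x => by rw [map_smul, hv', smul_zero], hc⟩
  set y := f (EuclideanSpace.single 0 1) with hy
  have yy : q y y = 1 := by
    rw [hy, hf, diagForm_apply]; simp [w24]
  have yv : q y v = 0 := hv _
  -- With this choice `x × y = v`, so the frame of a triad starting with `x`, `y` sends `e₂` to the
  -- normal vector `v`, and `e₂^⊥` to the given subspace.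
  set x := cross y v with hx
  have xx : q x x = 1 := by rw [hx, q_cross_cross, yy, hvv, yv]; norm_num
  have xy : q x y = 0 := q_cross_left y v
  have cxy : cross x y = v := by
    rw [cross_swap, hx, cross_cross, yy, yv]; simp
  obtain ⟨z, hzz, hxz, hyz, hvz⟩ : ∃ z, q z z = -1 ∧ q x z = 0 ∧ q y z = 0 ∧ q v z = 0 := by
    -- Vectors of this negative plane are already orthogonal to `y` and `v`; orthogonality to `x` is
    -- one more condition on two parameters.
    let e : (Fin 2 → ℝ) →ₗ[ℝ] EuclideanSpace ℝ (Fin 6) :=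
      { toFun := fun b => !₂[0, 0, b 0, b 1, 0, 0]
        map_add' := fun x y => by ext i; fin_cases i <;> simp
        map_smul' := fun c x => by ext i; fin_cases i <;> simp }
    have hker : LinearMap.ker (q x ∘ₗ f ∘ₗ e) ≠ ⊥ := LinearMap.ker_ne_bot_of_finrank_lt (by simp)
    obtain ⟨b, hb, hb0⟩ := Submodule.exists_mem_ne_zero_of_ne_bot hker
    have h1 : q x (f (e b)) = 0 := LinearMap.mem_ker.1 hb
    have h2 : q (f (e b)) (f (e b)) < 0 := by
      have h3 : q (f (e b)) (f (e b)) = -(b 0 * b 0 + b 1 * b 1) := by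
        rw [hf, diagForm_apply]
        simp [e, w24, Fin.sum_univ_succ]
        ring
      rw [h3]
      by_contra hle
      have m0 := mul_self_nonneg (b 0)
      have m1 := mul_self_nonneg (b 1)
      have b0 : b 0 = 0 := mul_self_eq_zero.1 (by linarith)
      have b1 : b 1 = 0 := mul_self_eq_zero.1 (by linarith)
      exact hb0 (by ext i; fin_cases i <;> simp [b0, b1])
    have h4 : q y (f (e b)) = 0 := by
      rw [hy, hf, diagForm_apply]
      simp [e]
    obtain ⟨c, -, hc⟩ := exists_smul_q_eq_neg_one h2
    refine ⟨c • f (e b), hc, ?_, ?_, ?_⟩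
    · rw [map_smul, h1, smul_zero]
    · rw [map_smul, h4, smul_zero]
    · rw [map_smul, q_comm, hv, smul_zero]
  have ht : IsTriad x y z := ⟨xx, yy, hzz, xy, hxz, hyz, by rw [cxy, hvz]⟩
  refine ⟨ht.frame, ?_⟩
  have he : lin ht.frame (EuclideanSpace.single 2 1) = v := by
    rw [ht.lin_frame, frameMap_apply, cxy]; simp
  have hle : LinearMap.range f ≤ (LinearMap.range incl24).map (lin ht.frame) := by
    rintro _ ⟨u, rfl⟩
    refine ⟨lin ht.frame⁻¹ (f u), mem_range_incl24.2 ?_, lin_apply_inv _ _⟩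
    have h1 := q_lin ht.frame (lin ht.frame⁻¹ (f u)) (EuclideanSpace.single 2 1)
    rw [lin_apply_inv, he, hv, q_apply] at h1
    simpa using h1.symm
  refine (Submodule.eq_of_le_of_finrank_eq hle ?_).symm
  rw [← LinearMap.range_comp, LinearMap.finrank_range_of_inj (hf.injective w24_ne_zero),
    LinearMap.finrank_range_of_inj ((isIsometric_incl24 ht.frame).injective w24_ne_zero)]

lemma image_phoIn (g : G2) (X : Submodule ℝ V) :
    (fun W : Pho => g • W) '' PhoIn X = PhoIn (X.map (lin g)) := by
  ext W
  constructor
  · rintro ⟨W, hW, rfl⟩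
    exact Submodule.map_mono hW
  · intro hW
    refine ⟨g⁻¹ • W, ?_, smul_inv_smul g W⟩
    rintro _ ⟨w, hw, rfl⟩
    obtain ⟨x, hx, rfl⟩ := hW hw
    rw [lin_inv_apply]
    exact hx

end SplitG2

end

/-! ### The main theorem -/

open SplitG2
theorem mainTheorem10 (P : SymSpace) :
    -- the structure group is `Sp(1)`, the unit quaternions
    (∃ φ : unitary ℍ[ℝ] ≃* P.H, IsDiffeo (fun a : unitary ℍ[ℝ] => a.1) P.hEmb φ.toEquiv) ∧
    -- isotropic lines
    (∃ π : Ein → P.Gr 1, (∀ ℓ, (π ℓ).1 = ℓ.1.map P.proj) ∧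
      IsPrincipalBundle Iso.emb SymSpace.Gr.emb P.hEmb π ∧
      ∀ U : P.Gr 1,
        IsThreeSphere Iso.emb (π ⁻¹' {U}) ∧
        MaximallyTransverse G2 (π ⁻¹' {U}) ∧
        π ⁻¹' {U} = {ℓ : Ein | ℓ.1 ≤ U.1 ⊔ P.perp} ∧
        ∃ f : EuclideanSpace ℝ (Fin 5) →ₗ[ℝ] V, IsIsometric w14 f ∧
          LinearMap.range f = U.1 ⊔ P.perp ∧
          ∃ Φ : Ein03 ≃ π ⁻¹' {U}, IsDiffeo Iso.emb (fun ℓ => Iso.emb ℓ.1) Φ ∧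
            ∀ ℓ, (Φ ℓ).1.1 = ℓ.1.map f) ∧
    -- annihilator photons
    (∃ π : Pho → P.Gr 2, (∀ W, (π W).1 = W.plane.map P.proj) ∧
      IsPrincipalBundle Pho.emb SymSpace.Gr.emb P.hEmb π ∧
      ∀ U : P.Gr 2,
        IsThreeSphere Pho.emb (π ⁻¹' {U}) ∧
        MaximallyTransverse G2 (π ⁻¹' {U}) ∧
        π ⁻¹' {U} = PhoIn (U.1 ⊔ P.perp) ∧
        (∃ f : EuclideanSpace ℝ (Fin 6) →ₗ[ℝ] V, IsIsometric w24 f ∧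
          LinearMap.range f = U.1 ⊔ P.perp) ∧
        ∀ f : EuclideanSpace ℝ (Fin 6) →ₗ[ℝ] V, IsIsometric w24 f →
          ∃ g : G2, (fun W => g • W) '' (π ⁻¹' {U}) = PhoIn (LinearMap.range f)) ∧
    -- pointed annihilator photons
    (∃ π : F12 → P.Flag,
      (∀ p, (π p).1.1.1 = p.line.map P.proj ∧ (π p).1.2.1 = p.plane.map P.proj) ∧
      IsPrincipalBundle F12.emb SymSpace.Flag.emb P.hEmb π ∧
      ∀ U : P.Flag,
        IsThreeSphere F12.emb (π ⁻¹' {U}) ∧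
        MaximallyTransverse G2 (π ⁻¹' {U}) ∧
        π ⁻¹' {U} =
          {p | P.IsGraphOver U.1.1.1 p.line ∧ P.IsGraphOver U.1.2.1 p.plane}) := by
  have hH := P.exists_unitary_mulEquiv
  refine ⟨hH, ⟨P.einProj, fun _ => rfl, SymSpace.isPrincipalBundle_ein, fun U => ?_⟩,
    ⟨P.phoProj, fun _ => rfl, SymSpace.isPrincipalBundle_pho, fun U => ?_⟩,
    ⟨P.flagProj, fun _ => ⟨rfl, rfl⟩, SymSpace.isPrincipalBundle_flag, fun U => ?_⟩⟩
  · have hfib : P.einProj ⁻¹' {U} = {ℓ : Ein | ℓ.1 ≤ U.1 ⊔ P.perp} := by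
      ext ℓ
      exact Subtype.ext_iff.trans (SymSpace.map_proj_eq_iff ℓ.isAnnihilator U.2.1
        (ℓ.2.1.trans U.2.2.symm))
    obtain ⟨f, hf, hr⟩ := SymSpace.exists_isometry14 U
    exact ⟨SymSpace.isPrincipalBundle_ein.isThreeSphere hH U, SymSpace.maximallyTransverse_ein U,
      hfib, f, hf, hr, hf.exists_ein_diffeo (by rw [hr]; exact hfib)⟩
  · have hfib : P.phoProj ⁻¹' {U} = PhoIn (U.1 ⊔ P.perp) := by
      ext W
      exact Subtype.ext_iff.trans (SymSpace.map_proj_eq_iff W.isAnnihilator U.2.1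
        (W.1.2.1.trans U.2.2.symm))
    obtain ⟨g, hg⟩ := SymSpace.exists_map_range_incl24 U
    refine ⟨SymSpace.isPrincipalBundle_pho.isThreeSphere hH U, SymSpace.maximallyTransverse_pho U,
      hfib, ⟨_, isIsometric_incl24 g, by rw [LinearMap.range_comp, hg]⟩, fun f hf => ?_⟩
    obtain ⟨k, hk⟩ := hf.exists_map_range_incl24
    -- Both `U ⊕ P^⊥` and the range of `f` are translates of the standard `ℝ^{2,4}`, by `g` and `k`
    -- respectively.
    refine ⟨k * g⁻¹, ?_⟩
    rw [hfib, image_phoIn, ← hg, ← hk, ← Submodule.map_comp, ← lin_mul, inv_mul_cancel_right]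
  · refine ⟨SymSpace.isPrincipalBundle_flag.isThreeSphere hH U,
      SymSpace.maximallyTransverse_flag U, ?_⟩
    ext p
    refine Subtype.ext_iff.trans (Prod.ext_iff.trans (and_congr ?_ ?_))
    · exact Subtype.ext_iff.trans
        (SymSpace.isGraphOver_iff p.1.1.isAnnihilator U.1.1.2.1).symm
    · exact Subtype.ext_iff.trans
        (SymSpace.isGraphOver_iff p.1.2.isAnnihilator U.1.2.2.1).symm
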